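/- Let $k$ be a field of characteristic $0$ and $\beta\in k$ (for instance $k=\mathbb{Q}(\beta)$ with $\beta$ an indeterminate). Neutral fermions. Let $\phi_n$ $(n\in\mathbb{Z})$ satisfy $\phi_m\phi_n+\phi_n\phi_m=2(-1)^m\delta_{m+n,0}$. Let $\mathcal{F}$ be the Fock space with basis $\phi_{n_1}\cdots\phi_{n_r}|0\rangle$ $(r\ge 0,\ n_1>\dots>n_r\ge 0)$, where $\phi_{-n}|0\rangle=0$ for $n>0$, and let $\widehat{\mathcal{F}}\supset\mathcal{F}$ be the space of all formal, possibly infinite, linear combinations of these basis vectors. A vector is called even if only basis vectors with $r$ even occur in it. (The basis vectors with $r$ even are exactly the vectors $|\lambda\rangle$, $\lambda=(\lambda_1>\dots>\lambda_s>0)$ a strict partition, where $|\lambda\rangle=\phi_{\lambda_1}\cdots\phi_{\lambda_s}|0\rangle$ for $s$ even and $|\lambda\rangle=\phi_{\lambda_1}\cdots\phi_{\lambda_s}\phi_0|0\rangle$ for $s$ odd.) Let $\langle 0|$ be the functional that takes the coefficient of $|0\rangle$, let $*$ be the linear anti-involution with $\phi_n^*=(-1)^n\phi_{-n}$, and for $|w\rangle=X|0\rangle\in\mathcal{F}$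 put $\langle w|=\langle 0|X^*$; this gives $\langle w|v\rangle\in k$ for $w\in\mathcal{F}$, $v\in\widehat{\mathcal{F}}$. For $m$ odd let $b_m=\frac14\sum_{i\in\mathbb{Z}}(-1)^i\phi_{-i-m}\phi_i$. For $m\in\mathbb{Z}$ let $b^{(\beta)}_m$ be obtained from $\frac{(X-\beta/2)^m-(-X-\beta/2)^m}{2}$ (a polynomial in $X$ if $m\ge 0$, expanded in powers of $X^{-1}$ if $m<0$) by $X^j\mapsto b_j$, and let $b^{[\beta]}_m=(b^{(\beta)}_{-m})^*$. Put $$\mathcal{H}^{(\beta)}=2\sum_{n\ge1}\frac{p_n}{n}b^{(\beta)}_n,\qquad \mathcal{H}^{(\beta)}_-=2\sum_{n\ge1}\frac{p_n}{n}b^{(\beta)}_{-n},\qquad \mathcal{H}^{[\beta]}=2\sum_{n\ge1}\frac{p_n}{n}b^{[\beta]}_n,$$ and write $\mathcal{H}(x)$ for $\mathcal{H}$ with $p_n$ replaced by the power sum $p_n(x)=\sum_i x_i^n$ in $x=(x_1,x_2,\dots)$. Symmetric functions. Write $\overline{t}=-t/(1+\beta t)$. Let $G\Gamma$ be the space of symmetric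 formal power series $f$ over $k$ in $x_1,x_2,\dots$ such that $f(t,\overline{t},x_3,x_4,\dots)$ does not depend on $t$, and let $g\Gamma$ be the space of symmetric functions $g$ over $k$ (of bounded degree) such that $g(t,-t-\beta,x_3,x_4,\dots)$ does not depend on $t$. Put $p^{(\beta)}_n=p_n\!\left(\frac{x}{1+\frac{\beta}{2}x}\right)$ and $p^{[\beta]}_n=\sum_i\left((x_i+\tfrac{\beta}{2})^n-(\tfrac{\beta}{2})^n\right)$, $p^{(\beta)}_\lambda=\prod_ip^{(\beta)}_{\lambda_i}$ and $p^{[\beta]}_\lambda=\prod_ip^{[\beta]}_{\lambda_i}$. For a partition $\lambda$ let $z_\lambda=\prod_{i\ge1} i^{m_i}m_i!$, where $m_i$ is the number of parts equal to $i$, and let $\ell(\lambda)$ be its length. A partition is odd if all its parts are odd. Then the following hold. (1) For every odd partition $\lambda$, $p^{(\beta)}_\lambda\in G\Gamma$ and $p^{[\beta]}_\lambda\in g\Gamma$. There is exactly one $k$-bilinear form $\langle\cdot,\cdot\rangle:G\Gamma\times g\Gamma\to k$ such that $$\langle p^{(\beta)}_\lambda,p^{[\beta]}_\mu\rangle=2^{-\ell(\lambda)}z_\lambda\,\delta_{\lambda,\mu}\qquad(\lambda,\mu\text{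 odd partitions})$$ and such that for every $g\in g\Gamma$ the map $f\mapsto\langle f,g\rangle$ is continuous, i.e. there is an $N$ such that $\langle f,g\rangle=0$ for all $f\in G\Gamma$ without terms of degree $\le N$. (2) For all $v\in\widehat{\mathcal{F}}$ (in particular all $v\in\mathcal{F}$) and $w\in\mathcal{F}$, the series $$f=\langle 0|e^{\mathcal{H}^{(\beta)}(x)}|v\rangle,\qquad g=\langle 0|e^{\mathcal{H}^{[\beta]}(x)}|w\rangle$$ lie in $G\Gamma$ and $g\Gamma$ respectively, and, if at least one of $v$, $w$ is even, $$\langle f,g\rangle=\langle w|v\rangle.$$ (3) As formal power series in $x_1,x_2,\dots,y_1,y_2,\dots$, $$\langle 0|e^{\mathcal{H}^{(\beta)}(x)}e^{\mathcal{H}^{(\beta)}_-(y)}|0\rangle=\prod_{i,j}\frac{1-\overline{x_i}\,y_j}{1-x_iy_j}.$$ -/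

import Mathlib

open scoped BigOperators

noncomputable section

namespace NeutralFermion

variable {k : Type*} [Field k]

/-! ### The Fock space

A finite set `S = {n₁ > n₂ > ⋯ > n_r}` of natural numbers stands for the basis vector
`φ_{n₁} φ_{n₂} ⋯ φ_{n_r} |0⟩` of the Fock space `F`, so that `F` is `Finset ℕ →₀ k`.
The completed Fock space (arbitrary formal linear combinations of the basis vectors)
is `Finset ℕ → k`, and contains `F`.  -/

/-- The completed Fock space: formal (possibly infinite) linear combinations of the vectors
`φ_{n₁} ⋯ φ_{n_r} |0⟩`, `n₁ > ⋯ > n_r ≥ 0`. -/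
abbrev FockHat (k : Type*) : Type _ := Finset ℕ → k

/-- The Fock space `F`: finite linear combinations of the same vectors. -/
abbrev Fock (k : Type*) [Field k] : Type _ := Finset ℕ →₀ k

/-- The vacuum `|0⟩`. -/
def vac : FockHat k := fun S => if S = ∅ then 1 else 0

/-- The sign `(-1)^{#{s ∈ S : s > n}}` picked up by moving `φ_{±n}` past the `φ_s` with `s > n`. -/
def sgnAbove (n : ℕ) (S : Finset ℕ) : k := (-1) ^ (S.filter (fun s => n < s)).card

/-- The neutral fermion `φ_n` on the Fock space, as forced by
`φ_m φ_n + φ_n φ_m = 2 (-1)^m δ_{m+n,0}` and `φ_{-n} |0⟩ = 0` for `n > 0`.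
The value at `S` is the coefficient of the basis vector of `S` in `φ_n v`:
for `n > 0` the operator `φ_n` sends the basis vector of `T ∌ n` to
`± ` that of `T ∪ {n}` and kills it if `n ∈ T`; `φ_{-n}` sends the basis vector of `T ∋ n` to
`± 2 (-1)^n` times that of `T \ {n}` and kills it if `n ∉ T`; `φ_0` toggles `0`. -/
def phi (n : ℤ) (v : FockHat k) : FockHat k := fun S =>
  if 0 < n then
    if n.natAbs ∈ S then sgnAbove n.natAbs S * v (S.erase n.natAbs) else 0
  else if n < 0 then
    if n.natAbs ∉ S then
      2 * (-1) ^ n.natAbs * sgnAbove n.natAbs S * v (insert n.natAbs S)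
    else 0
  else sgnAbove 0 S * v (symmDiff S {0})

/-- `(φ_n)^* = (-1)^n φ_{-n}`. -/
def phiStar (n : ℤ) (v : FockHat k) : FockHat k := (-1 : k) ^ n.natAbs • phi (-n) v

/-- The Heisenberg generator `b_m = (1/4) ∑_{i ∈ ℤ} (-1)^i φ_{-i-m} φ_i` (`m` odd). -/
def heis (m : ℤ) (v : FockHat k) : FockHat k := fun S =>
  (1 / 4) * ∑ᶠ i : ℤ, (-1) ^ i.natAbs * phi (-i - m) (phi i v) S

/-- `(b_m)^* = (1/4) ∑_{i ∈ ℤ} (-1)^i (φ_i)^* (φ_{-i-m})^*` (`m` odd), the adjoint of `b_m`. -/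
def heisStar (m : ℤ) (v : FockHat k) : FockHat k := fun S =>
  (1 / 4) * ∑ᶠ i : ℤ, (-1) ^ i.natAbs * phiStar i (phiStar (-i - m) v) S

/-- The dual vector of a basis vector: for `S = {n₁ > ⋯ > n_r}` the functional
`⟨0| (φ_{n_r})^* ⋯ (φ_{n₁})^*`, where `⟨0|` takes the coefficient of `|0⟩`. -/
def braBasis (S : Finset ℕ) (v : FockHat k) : k :=
  ((S.sort (fun a b => b ≤ a)).foldl (fun (u : FockHat k) (n : ℕ) => phiStar (n : ℤ) u) v) ∅

/-- The vacuum expectation value `⟨w | v⟩`, where `⟨w| = |w⟩^*`. -/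
def braket (w : Fock k) (v : FockHat k) : k := w.sum fun S c => c * braBasis S v

/-- `|v⟩` lies in the even part of the (completed) Fock space: it is a (possibly infinite) linear
combination of the `φ_{n₁} ⋯ φ_{n_r} |0⟩` with `r` even.  These are exactly the vectors `|λ⟩`
attached to strict partitions `λ`. -/
def IsEven (v : FockHat k) : Prop := ∀ S, v S ≠ 0 → Even S.card

/-! ### The `β`-deformed Heisenberg generators and the exponentials -/

/-- The coefficient of `X^j` in `((X - β/2)^m - (-X - β/2)^m) / 2`, for `m ≥ 0`. -/
def posCoeff (β : k) (m j : ℕ) : k :=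
  (((Polynomial.X - Polynomial.C (β / 2)) ^ m -
    (-Polynomial.X - Polynomial.C (β / 2)) ^ m).coeff j) / 2

/-- The coefficient of `X^{-j}` in `((X - β/2)^{-m} - (-X - β/2)^{-m}) / 2` expanded in `X⁻¹`,
for `m > 0`.  Here `Y = X⁻¹`, `(X - β/2)⁻¹ = Y / (1 - (β/2) Y)` and
`(-X - β/2)⁻¹ = - Y / (1 + (β/2) Y)`. -/
def negCoeff (β : k) (m j : ℕ) : k :=
  (PowerSeries.coeff j
    ((PowerSeries.X * (1 - PowerSeries.C (β / 2) * PowerSeries.X)⁻¹) ^ m -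
      (-(PowerSeries.X * (1 + PowerSeries.C (β / 2) * PowerSeries.X)⁻¹)) ^ m)) / 2

/-- `b^{(β)}_m` for `m > 0`.  (The coefficients with `j` even vanish.) -/
def bPar (β : k) (m : ℕ+) (v : FockHat k) : FockHat k := fun S =>
  ∑ j ∈ Finset.range ((m : ℕ) + 1), posCoeff β m j * heis (j : ℤ) v S

/-- `b^{(β)}_{-m}` for `m > 0`, acting on the completed Fock space. -/
def bParNeg (β : k) (m : ℕ+) (v : FockHat k) : FockHat k := fun S =>
  ∑ᶠ j : ℕ, negCoeff β m j * heis (-(j : ℤ)) v S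

/-- `b^{[β]}_m = (b^{(β)}_{-m})^*` for `m > 0`; it acts on the vectors of `F`. -/
def bBrk (β : k) (m : ℕ+) (v : FockHat k) : FockHat k := fun S =>
  ∑ᶠ j : ℕ, negCoeff β m j * heisStar (-(j : ℤ)) v S

/-- Formal series in `p₁, p₂, …` with coefficients in the completed Fock space. -/
abbrev FockSeries (k : Type*) : Type _ := (ℕ+ →₀ ℕ) → FockHat k

/-- A vector as a constant series. -/
def constSeries (v : FockHat k) : FockSeries k := fun a => if a = 0 then v else 0

/-- The operator `2 ∑_{m ≥ 1} (p_m / m) T_m` on series, for operators `T₁, T₂, …`. -/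
def hamiltonian (T : ℕ+ → FockHat k → FockHat k) (u : FockSeries k) : FockSeries k :=
  fun a => ∑ m ∈ a.support, (2 / ((m : ℕ) : k)) • T m (u (a - Finsupp.single m 1))

/-- `e^H = ∑_i H^i / i!` for `H = 2 ∑_{m ≥ 1} (p_m / m) T_m`.  As `H` raises the degree in the
`p_m` by one, the terms with `i` larger than the degree of a monomial do not contribute. -/
def expHamiltonian (T : ℕ+ → FockHat k → FockHat k) (u : FockSeries k) : FockSeries k :=
  fun a => ∑ i ∈ Finset.range (a.degree + 1),
    ((Nat.factorial i : k)⁻¹) • ((hamiltonian T)^[i] u) a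

/-- `⟨0| e^H |v⟩` as a formal power series in `p₁, p₂, …`. -/
def vacExp (T : ℕ+ → FockHat k → FockHat k) (v : FockHat k) : MvPowerSeries ℕ+ k :=
  fun a => expHamiltonian T (constSeries v) a ∅

/-! ### Symmetric functions; the variables `x₁, x₂, …` are `X 0, X 1, …` -/

/-- `∑_i φ(x_i)` for a univariate power series `φ` without constant term, where the variable `x_i`
is `X (e i)`; the sum is taken coefficient by coefficient. -/
def sumVars {σ : Type*} (e : ℕ → σ) (φ : PowerSeries k) : MvPowerSeries σ k :=
  fun d => ∑ᶠ i : ℕ, MvPowerSeries.coeff d (PowerSeries.subst (MvPowerSeries.X (R := k) (e i)) φ)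

/-- The power sum `p_n(x)`, in the variables `X (e i)`. -/
def powerSum (k : Type*) [Field k] {σ : Type*} (e : ℕ → σ) (n : ℕ) : MvPowerSeries σ k :=
  sumVars e (PowerSeries.X ^ n)

/-- `p_n^{(β)}(x) = p_n(x / (1 + (β/2) x))`. -/
def powerSumPar (β : k) (n : ℕ) : MvPowerSeries ℕ k :=
  sumVars id ((PowerSeries.X * (1 + PowerSeries.C (β / 2) * PowerSeries.X)⁻¹) ^ n)

/-- `p_n^{[β]}(x) = p_n(x + β/2) - p_n(β/2) = ∑_i ((x_i + β/2)^n - (β/2)^n)`. -/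
def powerSumBrk (β : k) (n : ℕ) : MvPowerSeries ℕ k :=
  sumVars id ((PowerSeries.X + PowerSeries.C (β / 2)) ^ n - PowerSeries.C ((β / 2) ^ n))

/-- Partitions are finite multisets of positive integers; this is the condition that all parts
be odd. -/
def IsOddPartition (lam : Multiset ℕ) : Prop := ∀ i ∈ lam, Odd i

/-- `p_λ^{(β)} = ∏_i p_{λ_i}^{(β)}`. -/
def pPar (β : k) (lam : Multiset ℕ) : MvPowerSeries ℕ k := (lam.map (powerSumPar β)).prod

/-- `p_λ^{[β]} = ∏_i p_{λ_i}^{[β]}`. -/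
def pBrk (β : k) (lam : Multiset ℕ) : MvPowerSeries ℕ k := (lam.map (powerSumBrk β)).prod

/-- `z_λ = ∏_i i^{m_i} m_i!`, with `m_i` the multiplicity of the part `i`. -/
def zNum (lam : Multiset ℕ) : ℕ :=
  ∏ i ∈ lam.toFinset, i ^ lam.count i * Nat.factorial (lam.count i)

/-- Invariance under permutations of the variables. -/
def IsSymm (f : MvPowerSeries ℕ k) : Prop :=
  ∀ (s : Equiv.Perm ℕ) (d : ℕ →₀ ℕ),
    MvPowerSeries.coeff (d.equivMapDomain s) f = MvPowerSeries.coeff d f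

/-- Bounded total degree. -/
def IsBounded (f : MvPowerSeries ℕ k) : Prop :=
  ∃ D : ℕ, ∀ d : ℕ →₀ ℕ, MvPowerSeries.coeff d f ≠ 0 → d.degree ≤ D

/-- The substitution `x₁ ↦ t`, `x₂ ↦ t̄ = -t / (1 + β t)`, with `t` the variable `X 0`. -/
def cancelSubst (β : k) : ℕ → MvPowerSeries ℕ k := fun i =>
  if i = 1 then
    -(MvPowerSeries.X 0 * (1 + MvPowerSeries.C β * MvPowerSeries.X 0)⁻¹)
  else MvPowerSeries.X i

theorem hasSubst_cancelSubst (β : k) : MvPowerSeries.HasSubst (cancelSubst β) where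
  const_coeff s := by
    unfold cancelSubst
    split_ifs <;> simp
  coeff_zero d := by
    have h := (MvPowerSeries.HasSubst.X (σ := ℕ) (S := k)).coeff_zero d
    refine (h.union (Set.finite_singleton 1)).subset ?_
    intro s hs
    by_cases h1 : s = 1
    · right; exact h1
    · left
      simpa [cancelSubst, h1] using hs

/-- The space `GΓ`: symmetric formal power series `f` in `x₁, x₂, …` such that
`f(t, t̄, x₃, x₄, …)` does not depend on `t`. -/
def GGamma (β : k) : Submodule k (MvPowerSeries ℕ k) where
  carrier := {f | IsSymm f ∧ ∀ d : ℕ →₀ ℕ, d 0 ≠ 0 →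
    MvPowerSeries.coeff d (MvPowerSeries.subst (cancelSubst β) f) = 0}
  zero_mem' := by
    refine ⟨fun _ _ => by simp, fun d _ => ?_⟩
    rw [← MvPowerSeries.coe_substAlgHom (hasSubst_cancelSubst β), map_zero, map_zero]
  add_mem' := by
    rintro f g ⟨hf, hf'⟩ ⟨hg, hg'⟩
    refine ⟨fun s d => by simp [hf s d, hg s d], fun d hd => ?_⟩
    rw [MvPowerSeries.subst_add (hasSubst_cancelSubst β), map_add, hf' d hd, hg' d hd, add_zero]
  smul_mem' := by
    rintro c f ⟨hf, hf'⟩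
    refine ⟨fun s d => by simp [hf s d], fun d hd => ?_⟩
    rw [MvPowerSeries.subst_smul (hasSubst_cancelSubst β), map_smul, hf' d hd, smul_zero]

/-- The coefficient of the monomial `x₃^{e₂} x₄^{e₃} ⋯` in `f(t, -t-β, x₃, x₄, …)`, a polynomial
in `t`, for `f` of bounded degree and `e 0 = e 1 = 0`. -/
def dualCancelCoeff (β : k) (f : MvPowerSeries ℕ k) (e : ℕ →₀ ℕ) : Polynomial k :=
  ∑ᶠ ij : ℕ × ℕ,
    Polynomial.C (MvPowerSeries.coeff (Finsupp.single 0 ij.1 + Finsupp.single 1 ij.2 + e) f) *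
      (Polynomial.X ^ ij.1 * (-Polynomial.X - Polynomial.C β) ^ ij.2)

theorem dualCancel_finite (β : k) {f : MvPowerSeries ℕ k} (hf : IsBounded f) (e : ℕ →₀ ℕ) :
    (Function.support fun ij : ℕ × ℕ =>
      Polynomial.C (MvPowerSeries.coeff (Finsupp.single 0 ij.1 + Finsupp.single 1 ij.2 + e) f) *
      (Polynomial.X ^ ij.1 * (-Polynomial.X - Polynomial.C β) ^ ij.2)).Finite := by
  obtain ⟨D, hD⟩ := hf
  refine (Finset.finite_toSet (Finset.range (D + 1) ×ˢ Finset.range (D + 1))).subset ?_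
  rintro ⟨i, j⟩ h
  have h1 : MvPowerSeries.coeff (Finsupp.single 0 i + Finsupp.single 1 j + e) f ≠ 0 := by
    intro h0
    exact h (by simp [h0])
  have h2 := hD _ h1
  simp only [map_add, Finsupp.degree_single] at h2
  simp only [Finset.coe_product, Finset.coe_range, Set.mem_prod, Set.mem_Iio]
  omega

/-- The space `gΓ`: symmetric functions `f` (of bounded degree) in `x₁, x₂, …` such that
`f(t, -t-β, x₃, x₄, …)` does not depend on `t`. -/
def gGamma (β : k) : Submodule k (MvPowerSeries ℕ k) where
  carrier := {f | IsSymm f ∧ IsBounded f ∧ ∀ e : ℕ →₀ ℕ, e 0 = 0 → e 1 = 0 →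
    ∃ c : k, dualCancelCoeff β f e = Polynomial.C c}
  zero_mem' := by
    refine ⟨fun _ _ => by simp, ⟨0, fun d hd => absurd (by simp) hd⟩, fun e _ _ => ⟨0, ?_⟩⟩
    simp [dualCancelCoeff]
  add_mem' := by
    rintro f g ⟨hf, hfb, hf'⟩ ⟨hg, hgb, hg'⟩
    refine ⟨fun s d => by simp [hf s d, hg s d], ?_, fun e h0 h1 => ?_⟩
    · obtain ⟨D, hD⟩ := hfb
      obtain ⟨D', hD'⟩ := hgb
      refine ⟨max D D', fun d hd => ?_⟩
      by_cases h : MvPowerSeries.coeff d f = 0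
      · have : MvPowerSeries.coeff d g ≠ 0 := by
          intro h'
          exact hd (by simp [h, h'])
        exact (hD' d this).trans (le_max_right _ _)
      · exact (hD d h).trans (le_max_left _ _)
    · obtain ⟨a, ha⟩ := hf' e h0 h1
      obtain ⟨b, hb⟩ := hg' e h0 h1
      refine ⟨a + b, ?_⟩
      rw [map_add, ← ha, ← hb]
      unfold dualCancelCoeff
      rw [← finsum_add_distrib (dualCancel_finite β hfb e) (dualCancel_finite β hgb e)]
      refine finsum_congr fun ij => ?_
      rw [map_add, map_add, add_mul]
  smul_mem' := by
    rintro c f ⟨hf, hfb, hf'⟩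
    refine ⟨fun s d => by simp [hf s d], ?_, fun e h0 h1 => ?_⟩
    · obtain ⟨D, hD⟩ := hfb
      refine ⟨D, fun d hd => hD d fun h => hd (by simp [h])⟩
    · obtain ⟨a, ha⟩ := hf' e h0 h1
      refine ⟨c * a, ?_⟩
      rw [Polynomial.C_mul, ← ha]
      unfold dualCancelCoeff
      rw [mul_finsum' _ _ (dualCancel_finite β hfb e)]
      refine finsum_congr fun ij => ?_
      rw [map_smul, smul_eq_mul, Polynomial.C_mul, mul_assoc]

/-! ### The `β`-deformed bilinear form -/

/-- `B` is the `β`-deformed bilinear form: it has the prescribed values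
`⟨p_λ^{(β)}, p_μ^{[β]}⟩ = 2^{-ℓ(λ)} z_λ δ_{λ,μ}` for `λ`, `μ` odd, and it is continuous in the first
argument, with respect to the filtration by degree and the discrete topology on `k`. -/
def IsBetaForm (β : k) (B : GGamma β →ₗ[k] gGamma β →ₗ[k] k) : Prop :=
  (∀ lam mu : Multiset ℕ, IsOddPartition lam → IsOddPartition mu →
    ∀ (f : GGamma β) (g : gGamma β),
      (f : MvPowerSeries ℕ k) = pPar β lam → (g : MvPowerSeries ℕ k) = pBrk β mu →
      B f g = if lam = mu then ((2 : k) ^ Multiset.card lam)⁻¹ * (zNum lam : k) else 0) ∧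
  (∀ g : gGamma β, ∃ N : ℕ, ∀ f : GGamma β,
    (∀ d : ℕ →₀ ℕ, d.degree ≤ N → MvPowerSeries.coeff d (f : MvPowerSeries ℕ k) = 0) →
    B f g = 0)

/-- `⟨0| e^{H^{(β)}(x)} |v⟩`, under `p_n ↦ p_n(x)`. -/
def expectPar (β : k) (v : FockHat k) : MvPowerSeries ℕ k :=
  MvPowerSeries.subst (fun n : ℕ+ => powerSum k (id : ℕ → ℕ) (n : ℕ)) (vacExp (bPar β) v)

/-- `⟨0| e^{H^{[β]}(x)} |w⟩`, under `p_n ↦ p_n(x)`. -/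
def expectBrk (β : k) (w : Fock k) : MvPowerSeries ℕ k :=
  MvPowerSeries.subst (fun n : ℕ+ => powerSum k (id : ℕ → ℕ) (n : ℕ)) (vacExp (bBrk β) w)

/-! ### The Cauchy kernel; the variables are `x_i = X (inl i)` and `y_j = X (inr j)` -/

/-- `⟨0| e^{H^{(β)}} e^{H^{(β)}_-} |0⟩` as a series in two families `p_n` (those of `H^{(β)}`,
indexed by `inl n`) and `q_n` (those of `H^{(β)}_-`, indexed by `inr n`). -/
def cauchyExp (β : k) : MvPowerSeries (ℕ+ ⊕ ℕ+) k := fun d =>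
  expHamiltonian (bPar β)
    (constSeries (expHamiltonian (bParNeg β) (constSeries vac)
      (d.comapDomain Sum.inr Sum.inr_injective.injOn)))
    (d.comapDomain Sum.inl Sum.inl_injective.injOn) ∅

/-- `⟨0| e^{H^{(β)}(x)} e^{H^{(β)}_-(y)} |0⟩`. -/
def cauchyExpect (β : k) : MvPowerSeries (ℕ ⊕ ℕ) k :=
  MvPowerSeries.subst
    (Sum.elim (fun n : ℕ+ => powerSum k (Sum.inl : ℕ → ℕ ⊕ ℕ) (n : ℕ))
      (fun n : ℕ+ => powerSum k (Sum.inr : ℕ → ℕ ⊕ ℕ) (n : ℕ)))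
    (cauchyExp β)

/-- `(1 - x̄_i y_j) / (1 - x_i y_j)`, where `x̄ = -x / (1 + β x)`. -/
def cauchyFactor (β : k) (ij : ℕ × ℕ) : MvPowerSeries (ℕ ⊕ ℕ) k :=
  (1 - (-(MvPowerSeries.X (Sum.inl ij.1)) *
      (1 + MvPowerSeries.C β * MvPowerSeries.X (Sum.inl ij.1))⁻¹) *
      MvPowerSeries.X (Sum.inr ij.2)) *
    (1 - MvPowerSeries.X (Sum.inl ij.1) * MvPowerSeries.X (Sum.inr ij.2))⁻¹

open scoped MvPowerSeries.WithPiTopology in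
/-- `∏_i F i = a` as an infinite product of formal power series: every coefficient of the finite
partial products is eventually that of `a`. -/
def HasFormalProd {ι σ : Type*} (F : ι → MvPowerSeries σ k) (a : MvPowerSeries σ k) : Prop :=
  letI : TopologicalSpace k := ⊥
  HasProd F a

end NeutralFermion

end

/-! ### Transposed fermions and their anticommutation relations. -/

noncomputable section

namespace NeutralFermion

variable {k : Type*} [Field k]

/-! Operators on formal vectors are studied through their transposes on the space of finite vectors,
where only finitely many terms of the sum for `b_m`, `m ≠ 0`, act nontrivially on a given vector.
The transposed fermions satisfy the canonical anticommutation relations, which give the commutator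
of `b_m` with a fermion. A commutator of two odd `b`'s then commutes with all fermions, hence is a
scalar (`eq_smul_of_commute`), and evaluation at the vacuum yields the Heisenberg relations
(`heisT_neg_heisT`). Consequently the vectors `heisKet a`, products of odd `b`'s on the vacuum, have
the diagonal Gram matrix `normW`. By Euler's theorem there are as many odd as strict partitions, so
these vectors form an orthogonal basis of the even part, and Parseval's formula `braket_eq_sum`
holds.

The parameter `β` enters only through a change of variables. By the absorption identity for binomial
coefficients (`posCoeff_mul`, `negCoeff_mul`), regrouping the exponents by Heisenberg generator
gives `∑ (2/n) p_n^{(β)} b_n` and `∑ (2/n) p_n^{[β]} b_n` over odd `n`. Hence `f` and `g` are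
expansions in the `p_λ^{(β)}` and the `p_λ^{[β]}` whose coefficients `oddCoeff` do not involve `β`.
The form multiplies the coefficients by `normW`, and Parseval's sum appears.

For the form to exist and be unique, elements of `GΓ` and `gΓ` must expand uniquely in these
products. Since `t̄ = -t + ⋯` and `-t-β` has leading part `-t`, the lowest (respectively top) form
satisfies the classical cancellation property of Schur Q-functions. Such a form is determined by its
coefficients at strict partitions (`coeff_eq_zero_of_strict`). The products with odd parts are
independent because their leading forms are products of power sums, so Euler's count makes them
span.

For the Cauchy kernel, the same regrouping and orthogonality give `exp (∑ (2/n) p_n^{(β)}(x)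
p_n^{[β]}(y))`. With `u = x/(1+βx/2)` the exponent is the sum over pairs of variables of
`L(u(y+β/2)) - L(uβ/2)`, where `L(t) = log((1+t)/(1-t))`, and exponentiating gives the product. -/

/-- The pairing of a formal vector with a finite one, for which the basis is orthonormal. -/
def pair (v : FockHat k) : Fock k →ₗ[k] k := Finsupp.linearCombination k v

/-- The basis vector of `S`. -/
def ket (S : Finset ℕ) : Fock k := Finsupp.single S 1

/-- The coefficient of the transposed fermion `psi n` at `S`, up to sign. -/
def chi (n : ℤ) (S : Finset ℕ) : k :=
  if 0 < n then (if n.natAbs ∈ S then 1 else 0)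
  else if n < 0 then (if n.natAbs ∈ S then 0 else 2 * (-1) ^ n.natAbs) else 1

/-- The transpose of the fermion `phi n` with respect to `pair`. -/
def psi (n : ℤ) : Fock k →ₗ[k] Fock k :=
  Finsupp.linearCombination k fun S =>
    (chi n S * sgnAbove n.natAbs S : k) • ket (symmDiff S {n.natAbs})

theorem pair_ket (v : FockHat k) (S : Finset ℕ) : pair v (ket S) = v S := by
  simp [pair, ket]

theorem pair_apply (v : FockHat k) (w : Fock k) : pair v w = w.sum fun S c => c * v S := by
  simp [pair, Finsupp.linearCombination_apply]

theorem pair_add (v v' : FockHat k) : pair (v + v') = pair v + pair v' := by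
  refine LinearMap.ext fun w => ?_
  simp [pair_apply, Finsupp.sum, mul_add, Finset.sum_add_distrib]

theorem pair_smul (c : k) (v : FockHat k) : pair (c • v) = c • pair v := by
  refine LinearMap.ext fun w => ?_
  simp [pair_apply, Finsupp.sum, Finset.mul_sum, mul_left_comm]

theorem pair_zero : pair (0 : FockHat k) = 0 := by
  refine LinearMap.ext fun w => ?_
  simp [pair_apply]

theorem linearMap_ext_ket {M : Type*} [AddCommMonoid M] [Module k M] {f g : Fock k →ₗ[k] M}
    (h : ∀ S, f (ket S) = g (ket S)) : f = g := by
  refine Finsupp.lhom_ext' fun S => LinearMap.ext_ring ?_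
  simpa [ket] using h S

theorem psi_ket (n : ℤ) (S : Finset ℕ) :
    psi n (ket S : Fock k) =
      (chi n S * sgnAbove n.natAbs S : k) • ket (symmDiff S {n.natAbs}) := by
  simp [psi, ket]

theorem mem_toggle {S : Finset ℕ} {n x : ℕ} :
    x ∈ symmDiff S {n} ↔ (x ∈ S ∧ x ≠ n) ∨ (x = n ∧ n ∉ S) := by
  rw [Finset.mem_symmDiff]
  simp only [Finset.mem_singleton]
  constructor
  · rintro (h | ⟨rfl, h⟩)
    · exact Or.inl h
    · exact Or.inr ⟨rfl, h⟩
  · rintro (h | ⟨rfl, h⟩)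
    · exact Or.inl h
    · exact Or.inr ⟨rfl, h⟩

theorem toggle_of_mem {S : Finset ℕ} {n : ℕ} (h : n ∈ S) : symmDiff S {n} = S.erase n := by
  ext x
  rw [mem_toggle, Finset.mem_erase]
  tauto

theorem toggle_of_notMem {S : Finset ℕ} {n : ℕ} (h : n ∉ S) : symmDiff S {n} = insert n S := by
  ext x
  rw [mem_toggle, Finset.mem_insert]
  by_cases hx : x = n
  · subst hx; simp [h]
  · simp [hx]

theorem toggle_toggle (S : Finset ℕ) (n : ℕ) : symmDiff (symmDiff S {n}) {n} = S := by
  rw [symmDiff_assoc, symmDiff_self, symmDiff_bot]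

theorem toggle_comm (S : Finset ℕ) (m n : ℕ) :
    symmDiff (symmDiff S {n}) {m} = symmDiff (symmDiff S {m}) {n} := by
  exact symmDiff_right_comm ..

theorem sgnAbove_toggle_of_le {m n : ℕ} (h : n ≤ m) (S : Finset ℕ) :
    (sgnAbove m (symmDiff S {n}) : k) = sgnAbove m S := by
  unfold sgnAbove
  congr 2
  ext x
  simp only [Finset.mem_filter, mem_toggle]
  constructor
  · rintro ⟨h1 | h1, h2⟩
    · exact ⟨h1.1, h2⟩
    · omega
  · rintro ⟨h1, h2⟩
    exact ⟨Or.inl ⟨h1, by omega⟩, h2⟩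

/-- Exactly one more or one fewer element lies above `m`. The contrast with `sgnAbove_toggle_of_le`
is what makes fermions of different index anticommute. -/
theorem sgnAbove_toggle_of_lt {m n : ℕ} (h : m < n) (S : Finset ℕ) :
    (sgnAbove m (symmDiff S {n}) : k) = - sgnAbove m S := by
  unfold sgnAbove
  by_cases hn : n ∈ S
  · have : S.filter (fun s => m < s) = insert n ((symmDiff S {n}).filter (fun s => m < s)) := by
      ext x
      simp only [Finset.mem_filter, mem_toggle, Finset.mem_insert]
      by_cases hx : x = n
      · subst hx; simp [h, hn]
      · simp [hx]
    rw [this, Finset.card_insert_of_notMem (by simp [mem_toggle, hn]), pow_succ]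
    ring
  · have : (symmDiff S {n}).filter (fun s => m < s) = insert n (S.filter (fun s => m < s)) := by
      ext x
      simp only [Finset.mem_filter, mem_toggle, Finset.mem_insert]
      by_cases hx : x = n
      · subst hx; simp [h, hn]
      · simp [hx]
    rw [this, Finset.card_insert_of_notMem (by simp [hn]), pow_succ]
    ring

theorem sgnAbove_mul_self (n : ℕ) (S : Finset ℕ) : (sgnAbove n S : k) * sgnAbove n S = 1 := by
  unfold sgnAbove
  rw [← pow_add, ← two_mul, pow_mul]
  simp

theorem sgnAbove_ne_zero (n : ℕ) (S : Finset ℕ) : (sgnAbove n S : k) ≠ 0 := by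
  intro h
  have := sgnAbove_mul_self (k := k) n S
  simp [h] at this

theorem chi_toggle {m : ℤ} {n : ℕ} (h : m.natAbs ≠ n) (S : Finset ℕ) :
    (chi m (symmDiff S {n}) : k) = chi m S := by
  have : m.natAbs ∈ symmDiff S {n} ↔ m.natAbs ∈ S := by
    rw [mem_toggle]; tauto
  simp only [chi, this]

/-- The transposed fermions satisfy the canonical anticommutation relations. -/
theorem psi_anticomm (m n : ℤ) (w : Fock k) :
    psi m (psi n w) + psi n (psi m w) =
      (if m + n = 0 then 2 * (-1) ^ m.natAbs else 0 : k) • w := by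
  suffices h : (psi m ∘ₗ psi n + psi n ∘ₗ psi m : Fock k →ₗ[k] Fock k) =
      (if m + n = 0 then 2 * (-1) ^ m.natAbs else 0 : k) • LinearMap.id from
    LinearMap.congr_fun h w
  refine linearMap_ext_ket fun S => ?_
  simp only [LinearMap.add_apply, LinearMap.comp_apply, psi_ket, map_smul, LinearMap.smul_apply,
    LinearMap.id_apply, smul_smul]
  by_cases h : m.natAbs = n.natAbs
  · rw [h, toggle_toggle, ← add_smul]
    congr 1
    rw [sgnAbove_toggle_of_le le_rfl]
    have hs := sgnAbove_mul_self (k := k) n.natAbs S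
    -- For equal absolute values the signs square to `1`. If `m = n ≠ 0` both products vanish; if `m
    -- = -n ≠ 0` exactly one survives, depending on whether the element lies in `S`; for index `0`
    -- both are `1`.
    have key : (chi n S * chi m (symmDiff S {n.natAbs}) + chi m S * chi n (symmDiff S {n.natAbs}) : k)
        = (if m + n = 0 then 2 * (-1) ^ m.natAbs else 0 : k) := by
      have ht : n.natAbs ∈ symmDiff S {n.natAbs} ↔ n.natAbs ∉ S := by
        rw [mem_toggle]; tauto
      rcases Int.natAbs_eq_natAbs_iff.1 h with rfl | rfl
      · rcases lt_trichotomy m 0 with h0 | h0 | h0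
        · have : ¬ (m + m = 0) := by omega
          by_cases hS : m.natAbs ∈ S <;> simp [chi, ht, hS, h0, h0.not_gt, this]
        · subst h0; norm_num [chi]
        · have : ¬ (m + m = 0) := by omega
          by_cases hS : m.natAbs ∈ S <;> simp [chi, ht, hS, h0, this]
      · rw [Int.natAbs_neg] at *
        rcases lt_trichotomy n 0 with h0 | h0 | h0
        · by_cases hS : n.natAbs ∈ S <;> simp [chi, ht, hS, h0, h0.not_gt]
        · subst h0; norm_num [chi]
        · by_cases hS : n.natAbs ∈ S <;> simp [chi, ht, hS, h0, h0.not_gt]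
    rw [h] at key
    rw [← key]
    linear_combination (chi n S * chi m (symmDiff S {n.natAbs}) +
      chi m S * chi n (symmDiff S {n.natAbs})) * hs
  · have hmn : m + n ≠ 0 := by omega
    rw [if_neg hmn, zero_smul, toggle_comm S m.natAbs, ← add_smul]
    rw [chi_toggle h, chi_toggle (Ne.symm h)]
    convert zero_smul k _
    -- Only the sign of the smaller index notices the toggle at the larger one, so the two orders
    -- differ by `-1`.
    rcases lt_or_gt_of_ne h with h | h
    · rw [sgnAbove_toggle_of_lt h, sgnAbove_toggle_of_le h.le]; ring
    · rw [sgnAbove_toggle_of_lt h, sgnAbove_toggle_of_le h.le]; ring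

theorem phi_apply (n : ℤ) (v : FockHat k) (S : Finset ℕ) : phi n v S = pair v (psi n (ket S)) := by
  rw [psi_ket, map_smul, pair_ket, smul_eq_mul]
  unfold phi chi
  rcases lt_trichotomy n 0 with h | h | h
  · by_cases hS : n.natAbs ∈ S
    · simp [h, h.not_gt, hS]
    · simp [h, h.not_gt, hS, toggle_of_notMem]
  · subst h; simp
  · by_cases hS : n.natAbs ∈ S
    · simp [h, hS, toggle_of_mem]
    · simp [h, hS]

theorem pair_phi (n : ℤ) (v : FockHat k) (w : Fock k) : pair (phi n v) w = pair v (psi n w) := by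
  suffices h : pair (phi n v) = pair v ∘ₗ psi n from LinearMap.congr_fun h w
  refine linearMap_ext_ket fun S => ?_
  rw [pair_ket, phi_apply]; rfl

/-! ### The transposed Heisenberg operators -/

/-- The sign `(-1)^i` for an integer `i`. -/
def eps (i : ℤ) : k := (-1) ^ i.natAbs

theorem eps_add (i j : ℤ) : (eps (i + j) : k) = eps i * eps j := by
  unfold eps
  rw [← pow_add]
  rcases Nat.even_or_odd (i.natAbs + j.natAbs) with h | h
  · have : Even (i + j).natAbs := by
      rw [Int.natAbs_even, Int.even_add, ← Int.natAbs_even, ← Int.natAbs_even, ← Nat.even_add]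
      exact h
    rw [h.neg_one_pow, this.neg_one_pow]
  · have : Odd (i + j).natAbs := by
      rw [← Nat.not_even_iff_odd, Int.natAbs_even, Int.even_add, ← Int.natAbs_even,
        ← Int.natAbs_even, ← Nat.even_add, Nat.not_even_iff_odd]
      exact h
    rw [h.neg_one_pow, this.neg_one_pow]

theorem eps_neg (i : ℤ) : (eps (-i) : k) = eps i := by
  unfold eps; rw [Int.natAbs_neg]

theorem eps_mul_self (i : ℤ) : (eps i * eps i : k) = 1 := by
  unfold eps
  rw [← pow_add, ← two_mul, pow_mul]
  simp

theorem eps_odd {m : ℤ} (hm : Odd m) : (eps m : k) = -1 := by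
  unfold eps
  exact (Int.natAbs_odd.2 hm).neg_one_pow

/-- `w` is a combination of basis vectors of weight `d` and parity `p`. -/
def IsHomog (d : ℤ) (p : Prop) (w : Fock k) : Prop :=
  ∀ S, w S ≠ 0 → ((∑ s ∈ S, s : ℕ) : ℤ) = d ∧ (Even S.card ↔ p)

theorem IsHomog.zero {d : ℤ} {p : Prop} : IsHomog d p (0 : Fock k) := fun _ h => absurd rfl h

theorem IsHomog.add {d : ℤ} {p : Prop} {w w' : Fock k} (h : IsHomog d p w) (h' : IsHomog d p w') :
    IsHomog d p (w + w') := by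
  intro S hS
  by_cases h0 : w S = 0
  · exact h' S (by simpa [h0] using hS)
  · exact h S h0

theorem IsHomog.smul {d : ℤ} {p : Prop} {w : Fock k} (c : k) (h : IsHomog d p w) :
    IsHomog d p (c • w) := by
  intro S hS
  exact h S fun h0 => hS (by simp [h0])

theorem IsHomog.sum {ι : Type*} {d : ℤ} {p : Prop} {s : Finset ι} {f : ι → Fock k}
    (h : ∀ i ∈ s, IsHomog d p (f i)) : IsHomog d p (∑ i ∈ s, f i) :=
  Finset.sum_induction f (IsHomog d p) (fun _ _ => IsHomog.add) IsHomog.zero h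

theorem isHomog_ket (S : Finset ℕ) :
    IsHomog ((∑ s ∈ S, s : ℕ) : ℤ) (Even S.card) (ket S : Fock k) := by
  intro T hT
  rw [ket, Finsupp.single_apply_ne_zero] at hT
  rw [hT.1]; simp

theorem isHomog_linearMap {d e : ℤ} {p q : Prop} {f : Fock k →ₗ[k] Fock k}
    (hf : ∀ S : Finset ℕ, ((∑ s ∈ S, s : ℕ) : ℤ) = d → (Even S.card ↔ p) → IsHomog e q (f (ket S)))
    {w : Fock k} (hw : IsHomog d p w) : IsHomog e q (f w) := by
  have : w = ∑ S ∈ w.support, w S • ket S := by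
    conv_lhs => rw [← w.sum_single]
    simp [Finsupp.sum, ket]
  rw [this, map_sum]
  refine IsHomog.sum fun S hS => ?_
  rw [map_smul]
  have := hw S (Finsupp.mem_support_iff.1 hS)
  exact (hf S this.1 this.2).smul _

theorem card_toggle (S : Finset ℕ) (n : ℕ) : Even (symmDiff S {n}).card ↔ ¬ Even S.card := by
  by_cases h : n ∈ S
  · rw [toggle_of_mem h]
    have h1 := Finset.card_erase_add_one h
    rw [← h1, Nat.even_add_one, not_not]
  · rw [toggle_of_notMem h, Finset.card_insert_of_notMem h, Nat.even_add_one]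

/-- Where the coefficient `chi` is nonzero, a positive index removes its element and a negative
index inserts one, so the weight drops by `n` in both cases. -/
theorem IsHomog.psi {d : ℤ} {p : Prop} {w : Fock k} (h : IsHomog d p w) (n : ℤ) :
    IsHomog (d - n) (¬ p) (psi n w) := by
  refine isHomog_linearMap (fun S hS hp => ?_) h
  rw [psi_ket]
  by_cases hc : (chi n S : k) = 0
  · rw [hc, zero_mul, zero_smul]; exact IsHomog.zero
  refine IsHomog.smul _ ?_
  have hk := isHomog_ket (k := k) (symmDiff S {n.natAbs})
  have h1 : ((∑ s ∈ symmDiff S {n.natAbs}, s : ℕ) : ℤ) = d - n := by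
    by_cases hn : n.natAbs ∈ S
    · have h2 := Finset.add_sum_erase S (fun s => s) hn
      rw [toggle_of_mem hn]
      have : 0 ≤ n := by
        by_contra h0
        apply hc
        simp [chi, hn, not_le.1 h0, (not_le.1 h0).not_gt]
      omega
    · rw [toggle_of_notMem hn, Finset.sum_insert hn]
      have : n ≤ 0 := by
        by_contra h0
        apply hc
        simp [chi, hn, not_le.1 h0]
      rw [Nat.cast_add, hS]
      omega
  rw [h1] at hk
  intro T hT
  refine ⟨(hk T hT).1, (hk T hT).2.trans ?_⟩
  rw [card_toggle, hp]

theorem psi_ket_eq_zero {n : ℤ} {S : Finset ℕ} (h : ∀ s ∈ S, (s : ℤ) < n) (hn : 0 < n) :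
    psi n (ket S : Fock k) = 0 := by
  have : n.natAbs ∉ S := fun h' => by have := h _ h'; omega
  simp [psi_ket, chi, hn, this]

/-- A number that exceeds all elements of the sets in the support of `w`. -/
def bound (w : Fock k) : ℕ := w.support.sup fun S => S.sup fun s => s + 1

theorem psi_eq_zero_of_bound_le {n : ℤ} {w : Fock k} (h : (bound w : ℤ) ≤ n) (hn : 0 < n) :
    psi n w = 0 := by
  have : w = ∑ S ∈ w.support, w S • ket S := by
    conv_lhs => rw [← w.sum_single]
    simp [Finsupp.sum, ket]
  rw [this, map_sum]
  refine Finset.sum_eq_zero fun S hS => ?_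
  rw [map_smul, psi_ket_eq_zero _ hn, smul_zero]
  intro s hs
  have h1 : s + 1 ≤ S.sup fun s => s + 1 := Finset.le_sup (f := fun s => s + 1) hs
  have h2 : (S.sup fun s => s + 1) ≤ bound w :=
    Finset.le_sup (f := fun S : Finset ℕ => S.sup fun s => s + 1) hS
  omega

/-- If `i` is very negative, `-i - m` exceeds every element occurring in `w` and the inner fermion
kills `w`. If `i` is very large, the two fermions anticommute because `m ≠ 0`, and `psi i` kills
`w`. Thus the sum for `b_m` is finite on each vector. -/
theorem psi_psi_eq_zero {m i : ℤ} (hm : m ≠ 0) {w : Fock k} {B : ℤ}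
    (hw : (bound w : ℤ) ≤ B) (hi : i ∉ Finset.Icc (-(B + |m|)) (B + |m|)) :
    psi i (psi (-i - m) w) = 0 := by
  rw [Finset.mem_Icc, not_and_or, not_le, not_le] at hi
  have h1 := abs_nonneg m
  have h2 := le_abs_self m
  have h3 := neg_abs_le m
  have h4 := abs_pos.2 hm
  rcases hi with hi | hi
  · rw [psi_eq_zero_of_bound_le (n := -i - m) (by omega) (by omega), map_zero]
  · have := psi_anticomm (k := k) i (-i - m) w
    rw [if_neg (by omega), zero_smul, psi_eq_zero_of_bound_le (n := i) (w := w) (by omega) (by omega),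
      map_zero, add_zero] at this
    exact this

/-- The transpose of the Heisenberg generator `heis m`. -/
def heisT (m : ℤ) : Fock k →ₗ[k] Fock k :=
  Finsupp.linearCombination k fun S =>
    (1 / 4 : k) • ∑ᶠ i : ℤ, (eps i : k) • psi i (psi (-i - m) (ket S))

theorem heisT_ket (m : ℤ) (S : Finset ℕ) : heisT m (ket S : Fock k) =
    (1 / 4 : k) • ∑ᶠ i : ℤ, (eps i : k) • psi i (psi (-i - m) (ket S)) := by
  simp [heisT, ket]

theorem heisT_support_finite {m : ℤ} (hm : m ≠ 0) (w : Fock k) :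
    (Function.support fun i : ℤ => (eps i : k) • psi i (psi (-i - m) w)).Finite := by
  refine (Finset.finite_toSet (Finset.Icc (-(bound w + |m|)) (bound w + |m|))).subset ?_
  intro i hi
  by_contra h
  exact hi (by simp only [psi_psi_eq_zero hm le_rfl h, smul_zero])

theorem heisT_eq_finsum {m : ℤ} (hm : m ≠ 0) (w : Fock k) :
    heisT m w = (1 / 4 : k) • ∑ᶠ i : ℤ, (eps i : k) • psi i (psi (-i - m) w) := by
  induction w using Finsupp.induction_linear with
  | zero => simp
  | add f g hf hg =>
    rw [map_add, hf, hg, ← smul_add, ← finsum_add_distrib (heisT_support_finite hm f)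
      (heisT_support_finite hm g)]
    congr 2
    funext i
    rw [map_add, map_add, smul_add]
  | single S c =>
    have : (Finsupp.single S c : Fock k) = c • ket S := by simp [ket]
    rw [this, map_smul, heisT_ket, smul_comm c, smul_finsum' c (heisT_support_finite hm _)]
    congr 2
    funext i
    rw [map_smul, map_smul, smul_comm c]

/-- Any large enough window gives the same operator, so values at different vectors can be compared
over a common window. -/
theorem heisT_eq_sum {m : ℤ} (hm : m ≠ 0) {w : Fock k} {B : ℤ} (hB : bound w + |m| ≤ B) :
    heisT m w = (1 / 4 : k) • ∑ i ∈ Finset.Icc (-B) B, (eps i : k) • psi i (psi (-i - m) w) := by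
  rw [heisT_eq_finsum hm, finsum_eq_sum_of_support_subset]
  intro i hi
  by_contra h
  refine hi ?_
  have := psi_psi_eq_zero (k := k) (i := i) hm (w := w) (B := B - |m|) (by omega)
    (by simpa using h)
  simp only [this, smul_zero]

theorem heis_apply {m : ℤ} (hm : m ≠ 0) (v : FockHat k) (S : Finset ℕ) :
    heis m v S = pair v (heisT m (ket S)) := by
  rw [heisT_ket, map_smul, heis, smul_eq_mul]
  congr 1
  have := (pair v).toAddMonoidHom.map_finsum (heisT_support_finite (k := k) hm (ket S))
  refine Eq.trans ?_ this.symm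
  refine finsum_congr fun i => ?_
  simp only [LinearMap.toAddMonoidHom_coe, map_smul, smul_eq_mul]
  rw [phi_apply, pair_phi, eps]

theorem pair_heis {m : ℤ} (hm : m ≠ 0) (v : FockHat k) (w : Fock k) :
    pair (heis m v) w = pair v (heisT m w) := by
  suffices h : pair (heis m v) = pair v ∘ₗ heisT m from LinearMap.congr_fun h w
  refine linearMap_ext_ket fun S => ?_
  rw [pair_ket, heis_apply hm]; rfl

theorem phi_smul (n : ℤ) (c : k) (v : FockHat k) : phi n (c • v) = c • phi n v := by
  funext S
  simp [phi_apply, pair_smul]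

/-- After the shift `i ↦ i + m` the signs of the two adjoints combine with `(-1)^i` into
`(-1)^(i+m)`. Hence `b^{[β]}` is a series in the generators of positive index. -/
theorem heisStar_eq_heis (m : ℤ) (v : FockHat k) : heisStar m v = heis (-m) v := by
  funext S
  unfold heisStar heis
  congr 1
  refine finsum_eq_of_bijective (fun i => i + m) (Equiv.addRight m).bijective fun i => ?_
  have h1 : phiStar i (phiStar (-i - m) v) S = eps i * eps (-i - m) *
      phi (-i) (phi (-(-i - m)) v) S := by
    unfold phiStar
    rw [phi_smul]
    simp [eps, mul_assoc]
  rw [h1, ← eps, ← mul_assoc, ← mul_assoc, eps_mul_self, one_mul]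
  have e0 : (eps (-i - m) : k) = eps (i + m) := by rw [← eps_neg]; congr 1; ring
  have e1 : -(-i - m) = i + m := by ring
  have e2 : -(i + m) - -m = -i := by ring
  rw [e0, e1, e2, ← eps]

theorem IsHomog.heisT {d : ℤ} {p : Prop} {w : Fock k} {m : ℤ} (hm : m ≠ 0) (h : IsHomog d p w) :
    IsHomog (d + m) p (heisT m w) := by
  rw [heisT_eq_sum hm le_rfl]
  refine IsHomog.smul _ (IsHomog.sum fun i _ => IsHomog.smul _ ?_)
  have := (h.psi (-i - m)).psi i
  rw [not_not] at this
  convert this using 1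
  ring

/-- `[b_m^T, ψ_n] = -ψ_{n-m}`. -/
theorem heisT_psi [CharZero k] {m : ℤ} (hm : Odd m) (n : ℤ) (w : Fock k) :
    heisT m (psi n w) = psi n (heisT m w) - psi (n - m) w := by
  have hm0 : m ≠ 0 := by rintro rfl; simp at hm
  set B : ℤ := bound w + bound (psi n w) + |m| + |n| + |n - m| with hB
  have h1 := abs_nonneg n
  have h2 := abs_nonneg (n - m)
  have h3 := abs_nonneg m
  rw [heisT_eq_sum hm0 (B := B) (by omega), heisT_eq_sum hm0 (w := w) (B := B) (by omega)]
  rw [map_smul, map_sum]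
  -- Moving `psi n` to the left through both fermions leaves one contact term for each, located at
  -- `i = n - m` and at `i = -n`.
  have key : ∀ i ∈ Finset.Icc (-B) B, (eps i : k) • psi i (psi (-i - m) (psi n w)) =
      psi n ((eps i : k) • psi i (psi (-i - m) w)) +
      ((if i = n - m then 2 * eps m else 0 : k) • psi (n - m) w -
      (if i = -n then 2 else 0 : k) • psi (n - m) w) := by
    intro i _
    have a1 := psi_anticomm (k := k) (-i - m) n w
    have a2 := psi_anticomm (k := k) i n (psi (-i - m) w)
    rw [map_smul]
    rw [eq_sub_of_add_eq a1, map_sub, eq_sub_of_add_eq a2, map_smul, sub_sub_eq_add_sub,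
      smul_sub, smul_add, add_comm (eps i • _), smul_smul, smul_smul]
    have b1 : (eps i * if -i - m + n = 0 then 2 * (-1) ^ (-i - m).natAbs else 0 : k) • psi i w =
        (if i = n - m then 2 * eps m else 0 : k) • psi (n - m) w := by
      by_cases hi : i = n - m
      · rw [if_pos (by omega), if_pos hi, ← hi]
        congr 1
        have : (eps (-i - m) : k) = eps i * eps m := by
          rw [← eps_add, ← eps_neg]; congr 1; ring
        rw [← eps, this]
        linear_combination (2 * eps m) * eps_mul_self (k := k) i
      · rw [if_neg (by omega), if_neg hi]; simp
    have b2 : (eps i * if i + n = 0 then 2 * (-1) ^ i.natAbs else 0 : k) • psi (-i - m) w =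
        (if i = -n then 2 else 0 : k) • psi (n - m) w := by
      by_cases hi : i = -n
      · rw [if_pos (by omega), if_pos hi]
        have : -i - m = n - m := by omega
        rw [this]
        congr 1
        rw [← eps]
        linear_combination (2 : k) * eps_mul_self (k := k) i
      · rw [if_neg (by omega), if_neg hi]; simp
    rw [b1, b2]
    abel
  rw [Finset.sum_congr rfl key, Finset.sum_add_distrib, Finset.sum_sub_distrib, ← Finset.sum_smul,
    ← Finset.sum_smul, Finset.sum_ite_eq', Finset.sum_ite_eq']
  have c1 : n - m ∈ Finset.Icc (-B) B := by
    rw [Finset.mem_Icc]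
    have := le_abs_self (n - m)
    have := neg_abs_le (n - m)
    constructor <;> omega
  have c2 : -n ∈ Finset.Icc (-B) B := by
    rw [Finset.mem_Icc]
    have := le_abs_self n
    have := neg_abs_le n
    constructor <;> omega
  -- As `m` is odd the contact terms add up, `2 * (-1) - 2 = -4`, which the factor `1/4` normalizes
  -- to `-1`.
  rw [if_pos c1, if_pos c2, eps_odd hm, ← sub_smul, smul_add, smul_smul,
    show (1 / 4 * (2 * -1 - 2) : k) = -1 by norm_num, neg_one_smul, ← sub_eq_add_neg]

/-! ### Scalar commutators and the Heisenberg relations. -/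

theorem ket_apply (S T : Finset ℕ) : (ket S : Fock k) T = if S = T then 1 else 0 := by
  simp [ket, Finsupp.single_apply]

/-- Under `psi n` only the basis vector of `S` reaches that of `S.erase n`. So a vector killed by
`psi n` has no component containing `n`. -/
theorem psi_apply_erase {n : ℕ} (hn : 0 < n) {S : Finset ℕ} (hS : n ∈ S) (w : Fock k) :
    psi (n : ℤ) w (S.erase n) = sgnAbove n S * w S := by
  suffices h : (Finsupp.lapply (S.erase n) ∘ₗ psi (n : ℤ) : Fock k →ₗ[k] k) =
      (sgnAbove n S : k) • Finsupp.lapply S from LinearMap.congr_fun h w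
  refine linearMap_ext_ket fun T => ?_
  simp only [LinearMap.comp_apply, psi_ket, map_smul, Finsupp.lapply_apply, ket_apply,
    LinearMap.smul_apply, Int.natAbs_natCast, smul_eq_mul]
  by_cases h : T = S
  · subst h
    rw [if_pos (toggle_of_mem hS), if_pos rfl]
    simp [chi, hn, hS]
  · rw [if_neg h]
    by_cases hT : n ∈ T
    · rw [if_neg]
      · simp
      · rw [toggle_of_mem hT]
        intro h'
        apply h
        rw [← Finset.insert_erase hS, ← Finset.insert_erase hT, h']
    · simp [chi, hn, hT]

/-- An element of `S` can be created from the remaining ones with a nonzero coefficient; in other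
words, the vacuum is cyclic for the fermions. -/
theorem exists_ket_eq {S : Finset ℕ} [CharZero k] (hS : S.Nonempty) :
    ∃ (c : k) (n : ℤ) (T : Finset ℕ), T.card < S.card ∧ (ket S : Fock k) = c • psi n (ket T) := by
  obtain ⟨n, hn⟩ := hS
  refine ⟨(chi (-n : ℤ) (S.erase n) * sgnAbove n (S.erase n))⁻¹, -n, S.erase n,
    Finset.card_erase_lt_of_mem hn, ?_⟩
  rw [psi_ket, smul_smul, Int.natAbs_neg, Int.natAbs_natCast, inv_mul_cancel₀, one_smul,
    ← toggle_of_mem hn, toggle_toggle]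
  refine mul_ne_zero ?_ (sgnAbove_ne_zero _ _)
  unfold chi
  rcases Nat.eq_zero_or_pos n with rfl | h
  · simp
  · simp [h]

/-- A parity preserving operator that commutes with all fermions is a scalar. -/
theorem eq_smul_of_commute [CharZero k] {K : Fock k →ₗ[k] Fock k}
    (hK : ∀ (n : ℤ) (w : Fock k), K (psi n w) = psi n (K w))
    (hp : ∀ S, K (ket ∅) S ≠ 0 → Even S.card) (w : Fock k) : K w = K (ket ∅) ∅ • w := by
  -- `K (ket ∅)` is killed by every `psi n` with `n > 0`, so it is supported on subsets of `{0}`;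
  -- the parity hypothesis rules out `{0}`. Cyclicity then carries the scalar to all basis vectors.
  have h0 : K (ket ∅) = K (ket ∅) ∅ • ket ∅ := by
    ext S
    rw [Finsupp.smul_apply, ket, Finsupp.single_apply]
    split_ifs with hS
    · subst hS; simp
    · rw [smul_zero]
      by_contra hne
      by_cases h : ∃ n ∈ S, 0 < n
      · obtain ⟨n, hn, hpos⟩ := h
        have h1 := psi_apply_erase hpos hn (K (ket ∅))
        rw [← hK, psi_ket_eq_zero (by simp) (by exact_mod_cast hpos), map_zero] at h1
        exact mul_ne_zero (sgnAbove_ne_zero _ _) hne h1.symm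
      · have hS' : S = {0} := by
          have hsub : S ⊆ {0} := by
            intro x hx
            rw [Finset.mem_singleton]
            by_contra hx0
            exact h ⟨x, hx, Nat.pos_of_ne_zero hx0⟩
          rcases Finset.subset_singleton_iff.1 hsub with h' | h'
          · exact absurd h'.symm hS
          · exact h'
        have := hp S hne
        rw [hS'] at this
        simp at this
  suffices h : K = K (ket ∅) ∅ • LinearMap.id from LinearMap.congr_fun h w
  refine linearMap_ext_ket fun S => ?_
  induction hc : S.card using Nat.strong_induction_on generalizing S with
  | _ c ih =>
    rcases S.eq_empty_or_nonempty with rfl | hS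
    · simpa using h0
    · obtain ⟨a, n, T, hT, he⟩ := exists_ket_eq (k := k) hS
      have := ih T.card (hc ▸ hT) T rfl
      rw [he, map_smul, hK, this]
      simp [smul_comm a]

/-- The commutator of two transposed Heisenberg operators. -/
def heisComm (m n : ℤ) : Fock k →ₗ[k] Fock k := heisT m ∘ₗ heisT n - heisT n ∘ₗ heisT m

theorem heisComm_apply (m n : ℤ) (w : Fock k) :
    heisComm m n w = heisT m (heisT n w) - heisT n (heisT m w) := rfl

/-- The two derivations `ψ_j ↦ -ψ_{j-m}` and `ψ_j ↦ -ψ_{j-n}` commute, so the commutator of the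
`b`'s commutes with every fermion and is a scalar. -/
theorem heisComm_eq_smul [CharZero k] {m n : ℤ} (hm : Odd m) (hn : Odd n) (w : Fock k) :
    heisComm m n w = (heisComm m n (ket ∅ : Fock k) ∅) • w := by
  have hm0 : m ≠ 0 := by rintro rfl; simp at hm
  have hn0 : n ≠ 0 := by rintro rfl; simp at hn
  refine eq_smul_of_commute (fun j w => ?_) (fun S hS => ?_) w
  · simp only [heisComm_apply, heisT_psi hm, heisT_psi hn, map_sub]
    rw [sub_right_comm j m n]
    abel
  · have h := isHomog_ket (k := k) ∅
    have h1 := (h.heisT hn0).heisT hm0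
    have h2 := ((h.heisT hm0).heisT hn0).smul (-1 : k)
    rw [add_right_comm] at h2
    have h3 := h1.add h2
    rw [neg_one_smul, ← sub_eq_add_neg] at h3
    simpa using (h3 S hS).2

theorem heisT_neg_vac {m : ℤ} (hm : m < 0) : heisT m (ket ∅ : Fock k) = 0 := by
  ext S
  by_contra hne
  have := (((isHomog_ket (k := k) ∅).heisT hm.ne) S hne).1
  simp at this
  have h2 : (0 : ℤ) ≤ ∑ s ∈ S, (s : ℤ) := by positivity
  omega

theorem heisT_pos_apply_empty {m : ℤ} (hm : 0 < m) (w : Fock k) : heisT m w ∅ = 0 := by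
  suffices h : (Finsupp.lapply ∅ ∘ₗ heisT m : Fock k →ₗ[k] k) = 0 from LinearMap.congr_fun h w
  refine linearMap_ext_ket fun S => ?_
  by_contra hne
  have := (((isHomog_ket (k := k) S).heisT hm.ne') ∅ hne).1
  simp at this
  have h2 : (0 : ℤ) ≤ ∑ s ∈ S, (s : ℤ) := by positivity
  omega

/-- The scalar is read off at the vacuum, where it vanishes: transposes of positive index raise the
weight and leave no vacuum component. -/
theorem heisT_comm_of_pos [CharZero k] {m n : ℤ} (hm : Odd m) (hn : Odd n) (hm0 : 0 < m)
    (hn0 : 0 < n) (w : Fock k) : heisT m (heisT n w) = heisT n (heisT m w) := by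
  have := heisComm_eq_smul hm hn w
  rwa [heisComm_apply _ _ (ket ∅), Finsupp.sub_apply, heisT_pos_apply_empty hm0,
    heisT_pos_apply_empty hn0, sub_zero, zero_smul, heisComm_apply, sub_eq_zero] at this

theorem heisT_comm_of_neg [CharZero k] {m n : ℤ} (hm : Odd m) (hn : Odd n) (hm0 : m < 0)
    (hn0 : n < 0) (w : Fock k) : heisT m (heisT n w) = heisT n (heisT m w) := by
  have := heisComm_eq_smul hm hn w
  rwa [heisComm_apply _ _ (ket ∅), heisT_neg_vac hm0, heisT_neg_vac hn0, map_zero, map_zero,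
    sub_zero, Finsupp.zero_apply, zero_smul, heisComm_apply, sub_eq_zero] at this

/-- The two-point function. Its value at `0` is only half the full contraction because `ψ_0² = 1`.
-/
theorem eps_mul_psi_psi_vac (i : ℤ) :
    (eps i * psi i (psi (-i) (ket ∅ : Fock k)) ∅ : k) =
      if 0 < i then 2 else if i = 0 then 1 else 0 := by
  rcases lt_trichotomy i 0 with h | h | h
  · rw [psi_ket_eq_zero (n := -i) (by simp) (by omega)]
    simp [h.not_gt, h.ne]
  · subst h
    simp [psi_ket, chi, eps, sgnAbove, ket_apply]
    rw [toggle_of_notMem (by simp)]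
    simp [Finset.filter_singleton]
  · have := psi_anticomm (k := k) i (-i) (ket ∅)
    rw [psi_ket_eq_zero (n := i) (by simp) h, map_zero, add_zero, if_pos (by omega)] at this
    rw [this, if_pos h, ← eps]
    simp only [ket, Finsupp.smul_apply, Finsupp.single_eq_same, smul_eq_mul, mul_one]
    linear_combination (2 : k) * eps_mul_self (k := k) i

theorem psi_psi_vac_of_ne {i j : ℤ} (h : i + j ≠ 0) :
    psi i (psi j (ket ∅ : Fock k)) ∅ = 0 := by
  by_contra hne
  have := (((isHomog_ket (k := k) ∅).psi j).psi i ∅ hne).1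
  simp at this
  omega

/-- Moving `b_{-m}` through the pair of fermions onto the vacuum leaves the two-point step function
at `i + m` minus the same at `i`. These differ only for `-m ≤ i ≤ 0`, where the difference is `1` at
both ends and `2` at the `m - 1` points between; the total `2m` times `1/4` is `m/2`. -/
theorem heisT_neg_heisT_vac [CharZero k] {m n : ℤ} (hm : Odd m) (hn : Odd n) (hm0 : 0 < m)
    (hn0 : 0 < n) :
    heisT (-m) (heisT n (ket ∅ : Fock k)) ∅ = if m = n then (m : k) / 2 else 0 := by
  set B : ℤ := bound (ket ∅ : Fock k) + |n| + m with hB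
  have hnB : n ≤ |n| := le_abs_self n
  rw [heisT_eq_sum hn0.ne' (B := B) (by omega), map_smul, map_sum]
  have key : ∀ i : ℤ, heisT (-m) ((eps i : k) • psi i (psi (-i - n) (ket ∅))) ∅ =
      if m = n then ((if 0 < i + m then 2 else if i + m = 0 then 1 else 0 : k) -
        (if 0 < i then 2 else if i = 0 then 1 else 0 : k)) else 0 := by
    intro i
    rw [map_smul, heisT_psi hm.neg, heisT_psi hm.neg, heisT_neg_vac (by omega), map_zero, zero_sub,
      map_neg]
    by_cases hmn : m = n
    · subst hmn
      rw [if_pos rfl, ← eps_mul_psi_psi_vac, ← eps_mul_psi_psi_vac, eps_add, eps_odd hm]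
      have e1 : i - -m = i + m := by ring
      have e2 : -i - m = -(i + m) := by ring
      have e3 : -i - m - -m = -i := by ring
      rw [e1, e3, e2]
      simp
      ring
    · rw [if_neg hmn, Finsupp.smul_apply, Finsupp.sub_apply, Finsupp.neg_apply,
        psi_psi_vac_of_ne (by omega), psi_psi_vac_of_ne (by omega)]
      simp
  rw [Finsupp.smul_apply, Finsupp.finsetSum_apply, Finset.sum_congr rfl fun i _ => key i]
  by_cases hmn : m = n
  · simp only [if_pos hmn]
    have hsum : ∑ i ∈ Finset.Icc (-B) B, ((if 0 < i + m then 2 else if i + m = 0 then 1 else 0 : k) -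
        (if 0 < i then 2 else if i = 0 then 1 else 0 : k)) = 2 * m := by
      have hsub : Finset.Icc (-m) 0 ⊆ Finset.Icc (-B) B := by
        intro x hx
        rw [Finset.mem_Icc] at hx ⊢
        omega
      rw [← Finset.sum_subset hsub]
      · have h1 : ∀ i ∈ Finset.Icc (-m) 0,
            ((if 0 < i + m then 2 else if i + m = 0 then 1 else 0 : k) -
              (if 0 < i then 2 else if i = 0 then 1 else 0 : k)) =
            2 - (if i = -m then 1 else 0) - (if i = 0 then 1 else 0) := by
          intro i hi
          rw [Finset.mem_Icc] at hi
          rcases hi.1.eq_or_lt with h | h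
          · subst h
            simp [hm0.not_gt, hm0.ne']
            norm_num
          · rw [if_pos (by omega), if_neg (by omega : ¬ 0 < i), if_neg (by omega : ¬ i = -m)]
            simp
        rw [Finset.sum_congr rfl h1, Finset.sum_sub_distrib, Finset.sum_sub_distrib,
          Finset.sum_ite_eq', Finset.sum_ite_eq', if_pos (by rw [Finset.mem_Icc]; omega),
          if_pos (by rw [Finset.mem_Icc]; omega), Finset.sum_const, Int.card_Icc, nsmul_eq_mul]
        have : (((0 + 1 - -m).toNat : ℕ) : k) = (m : k) + 1 := by
          have h2 : (((0 + 1 - -m).toNat : ℕ) : ℤ) = m + 1 := by omega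
          have := congrArg (Int.cast : ℤ → k) h2
          push_cast at this
          exact_mod_cast this
        rw [this]
        ring
      · intro i _ hi
        rw [Finset.mem_Icc, not_and_or] at hi
        by_cases h : i < -m
        · rw [if_neg (by omega), if_neg (by omega), if_neg (by omega), if_neg (by omega), sub_zero]
        · rw [if_pos (by omega), if_pos (by omega), sub_self]
    rw [hsum, smul_eq_mul]
    ring
  · simp [hmn]

/-- The Heisenberg relation `[b_{-m}^T, b_n^T] = (m / 2) δ_{m,n}`. -/
theorem heisT_neg_heisT [CharZero k] {m n : ℤ} (hm : Odd m) (hn : Odd n) (hm0 : 0 < m)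
    (hn0 : 0 < n) (w : Fock k) :
    heisT (-m) (heisT n w) = heisT n (heisT (-m) w) + (if m = n then (m : k) / 2 else 0) • w := by
  have := heisComm_eq_smul hm.neg hn w
  rw [heisComm_apply _ _ (ket ∅), Finsupp.sub_apply, heisT_pos_apply_empty hn0, sub_zero,
    heisT_neg_heisT_vac hm hn hm0 hn0, heisComm_apply, sub_eq_iff_eq_add'] at this
  exact this

/-! ### Exponential series -/

section ExpSeries

variable {σ R : Type*} [CommRing R] [Algebra k R]

/-- The exponential of the linear series `∑ u_s X_s`. -/
def expSeries (k : Type*) [Field k] [Algebra k R] (u : σ → R) : MvPowerSeries σ R :=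
  fun a => a.prod fun s n => (Nat.factorial n : k)⁻¹ • u s ^ n

theorem coeff_expSeries (u : σ → R) (a : σ →₀ ℕ) :
    MvPowerSeries.coeff a (expSeries k u) = a.prod fun s n => (Nat.factorial n : k)⁻¹ • u s ^ n :=
  rfl

/-- The coefficient form of `∂/∂X_m e^{∑ u_s X_s} = u_m e^{∑ u_s X_s}`. -/
theorem mul_coeff_expSeries [CharZero k] (u : σ → R) (a : σ →₀ ℕ) {m : σ} (hm : m ∈ a.support) :
    u m * MvPowerSeries.coeff (a - Finsupp.single m 1) (expSeries k u) =
      (a m : k) • MvPowerSeries.coeff a (expSeries k u) := by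
  classical
  set g : σ → ℕ → R := fun s n => (Nat.factorial n : k)⁻¹ • u s ^ n with hg
  have hg0 : ∀ s, g s 0 = 1 := fun s => by simp [hg]
  rw [coeff_expSeries, coeff_expSeries, ← Finsupp.mul_prod_erase' a m g hg0,
    ← Finsupp.mul_prod_erase' (a - Finsupp.single m 1) m g hg0]
  have he : (a - Finsupp.single m 1).erase m = a.erase m := by
    ext s
    by_cases h : s = m
    · subst h; simp
    · simp [Finsupp.erase_ne h, Ne.symm h]
  obtain ⟨n, hn⟩ := Nat.exists_eq_succ_of_ne_zero (Finsupp.mem_support_iff.1 hm)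
  rw [he, ← mul_assoc, ← smul_mul_assoc]
  congr 1
  simp only [hg, Finsupp.tsub_apply, Finsupp.single_eq_same, hn, Nat.succ_sub_one,
    Nat.factorial_succ, smul_smul, mul_smul_comm]
  rw [pow_succ']
  congr 1
  have : ((n.factorial : ℕ) : k) ≠ 0 := by exact_mod_cast n.factorial_ne_zero
  have h2 : ((n + 1 : ℕ) : k) ≠ 0 := by exact_mod_cast n.succ_ne_zero
  push_cast at h2 ⊢
  field_simp

/-- The pairing of an exponential `e^H v` with a test vector, for operators `T m` which act
on the test vectors through a commutative algebra. -/
theorem pair_expHamiltonian [CharZero k] {T : ℕ+ → FockHat k → FockHat k}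
    {V : Submodule k (FockHat k)} {W : Submodule k (Fock k)}
    (ρ : R →ₐ[k] Module.End k (Fock k)) (b : ℕ+ → R)
    (hV : ∀ m, ∀ v ∈ V, T m v ∈ V)
    (hT : ∀ m, ∀ v ∈ V, ∀ w ∈ W, pair (T m v) w = pair v (ρ (b m) w))
    (hW : ∀ m, ∀ w ∈ W, ρ (b m) w ∈ W) {v : FockHat k} (hv : v ∈ V) (a : ℕ+ →₀ ℕ)
    {w : Fock k} (hw : w ∈ W) :
    pair (expHamiltonian T (constSeries v) a) w =
      pair v (ρ (MvPowerSeries.coeff a (expSeries k fun m : ℕ+ => (2 / ((m : ℕ) : k)) • b m)) w) := by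
  set u : ℕ+ → R := fun m => (2 / ((m : ℕ) : k)) • b m with hu
  -- The `i`-th power of the Hamiltonian lives in degree `i`, where it is `i!` times the coefficient
  -- of the exponential. In the induction step the derivative identity produces the factor `∑ a_m =
  -- i + 1`. Membership in `V` is carried along because the operators act by polynomials only there.
  have key : ∀ (i : ℕ) (a : ℕ+ →₀ ℕ), (hamiltonian T)^[i] (constSeries v) a ∈ V ∧
      ∀ w ∈ W, pair ((hamiltonian T)^[i] (constSeries v) a) w =
        if a.degree = i then (Nat.factorial i : k) *
          pair v (ρ (MvPowerSeries.coeff a (expSeries k u)) w) else 0 := by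
    intro i
    induction i with
    | zero =>
      intro a
      simp only [Function.iterate_zero, id_eq, constSeries]
      by_cases ha : a = 0
      · subst ha
        refine ⟨by simpa using hv, fun w _ => ?_⟩
        simp [coeff_expSeries]
      · have : a.degree ≠ 0 := fun h => ha ((Finsupp.degree_eq_zero_iff a).1 h)
        refine ⟨by simp [ha], fun w _ => ?_⟩
        rw [if_neg ha, if_neg this, pair_zero, LinearMap.zero_apply]
    | succ i ih =>
      intro a
      rw [Function.iterate_succ']
      simp only [Function.comp_apply, hamiltonian]
      refine ⟨Submodule.sum_mem _ fun m _ => Submodule.smul_mem _ _ (hV m _ (ih _).1),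
        fun w hw => ?_⟩
      have hs : ∀ (s : Finset ℕ+) (f : ℕ+ → FockHat k), pair (∑ m ∈ s, f m) = ∑ m ∈ s, pair (f m) := by
        intro s f
        classical
        induction s using Finset.induction_on with
        | empty => simp [pair_zero]
        | insert x s hx ih => rw [Finset.sum_insert hx, Finset.sum_insert hx, pair_add, ih]
      rw [hs, LinearMap.sum_apply]
      have hterm : ∀ m ∈ a.support, pair ((2 / ((m : ℕ) : k)) •
          T m ((hamiltonian T)^[i] (constSeries v) (a - Finsupp.single m 1))) w =
          if a.degree = i + 1 then (Nat.factorial i : k) * (a m : k) *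
            pair v (ρ (MvPowerSeries.coeff a (expSeries k u)) w) else 0 := by
        intro m hm
        have hdeg : (a - Finsupp.single m 1).degree = i ↔ a.degree = i + 1 := by
          have h1 : Finsupp.single m 1 ≤ a := by
            rw [Finsupp.single_le_iff]
            exact Nat.one_le_iff_ne_zero.2 (Finsupp.mem_support_iff.1 hm)
          have h2 : (a - Finsupp.single m 1 + Finsupp.single m 1).degree = a.degree := by
            rw [tsub_add_cancel_of_le h1]
          rw [map_add, Finsupp.degree_single] at h2
          omega
        rw [pair_smul, LinearMap.smul_apply, hT m _ (ih _).1 w hw, (ih _).2 _ (hW m w hw)]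
        simp only [hdeg]
        split_ifs with h
        · have h3 := mul_coeff_expSeries (k := k) u a hm
          have h4 : ρ (u m * MvPowerSeries.coeff (a - Finsupp.single m 1) (expSeries k u)) w =
              (2 / ((m : ℕ) : k)) •
                ρ (MvPowerSeries.coeff (a - Finsupp.single m 1) (expSeries k u)) (ρ (b m) w) := by
            rw [mul_comm, map_mul, hu]
            simp only [map_smul, Module.End.mul_apply, LinearMap.smul_apply]
          rw [h3] at h4
          rw [smul_eq_mul, mul_left_comm, ← smul_eq_mul (2 / _), ← map_smul, ← h4]
          simp only [map_smul, LinearMap.smul_apply, smul_eq_mul]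
          ring
        · simp
      rw [Finset.sum_congr rfl hterm]
      split_ifs with h
      · rw [← Finset.sum_mul, ← Finset.mul_sum, ← Nat.cast_sum, ← Finsupp.degree_apply, h,
          Nat.factorial_succ]
        push_cast
        ring
      · simp
  have hsum : pair (expHamiltonian T (constSeries v) a) w = ∑ i ∈ Finset.range (a.degree + 1),
      (Nat.factorial i : k)⁻¹ * pair ((hamiltonian T)^[i] (constSeries v) a) w := by
    unfold expHamiltonian
    induction Finset.range (a.degree + 1) using Finset.induction_on with
    | empty => simp [pair_zero]
    | insert x s hx ih =>
      rw [Finset.sum_insert hx, Finset.sum_insert hx, pair_add, LinearMap.add_apply, ih, pair_smul]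
      rfl
  rw [hsum, Finset.sum_eq_single a.degree]
  · rw [(key _ _).2 w hw, if_pos rfl, ← mul_assoc, inv_mul_cancel₀, one_mul]
    exact_mod_cast Nat.factorial_ne_zero _
  · intro i _ hi
    rw [(key _ _).2 w hw, if_neg (Ne.symm hi), mul_zero]
  · intro h
    simp at h

end ExpSeries

/-! ### The action of polynomials in the Heisenberg generators -/

/-- The algebra homomorphism given by a commuting family. -/
def commEval {A : Type*} [Ring A] [Algebra k A] (f : ℕ → A) (h : ∀ i j, f i * f j = f j * f i) :
    MvPolynomial ℕ k →ₐ[k] A :=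
  -- Evaluation of polynomials needs a commutative target, so it passes through the subalgebra
  -- generated by the commuting family.
  let S : Subalgebra k A := Algebra.adjoin k (Set.range f)
  letI : CommRing S :=
    { (inferInstance : Ring S) with
      mul_comm := (Algebra.isMulCommutative_adjoin k (by
        rintro _ ⟨i, rfl⟩ _ ⟨j, rfl⟩
        exact h i j) : IsMulCommutative S).is_comm.comm }
  let φ : MvPolynomial ℕ k →ₐ[k] S :=
    MvPolynomial.aeval fun i => (⟨f i, Algebra.subset_adjoin ⟨i, rfl⟩⟩ : S)
  S.val.comp φ

theorem commEval_X {A : Type*} [Ring A] [Algebra k A] (f : ℕ → A)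
    (h : ∀ i j, f i * f j = f j * f i) (i : ℕ) : commEval (k := k) f h (MvPolynomial.X i) = f i := by
  simp [commEval]

theorem heisT_odd_comm [CharZero k] (i j : ℕ) :
    (heisT (2 * i + 1) * heisT (2 * j + 1) : Module.End k (Fock k)) =
      heisT (2 * j + 1) * heisT (2 * i + 1) := by
  refine LinearMap.ext fun w => ?_
  exact heisT_comm_of_pos (odd_two_mul_add_one _) (odd_two_mul_add_one _) (by omega) (by omega) w

theorem heisT_neg_odd_comm [CharZero k] (i j : ℕ) :
    (heisT (-(2 * i + 1)) * heisT (-(2 * j + 1)) : Module.End k (Fock k)) =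
      heisT (-(2 * j + 1)) * heisT (-(2 * i + 1)) := by
  refine LinearMap.ext fun w => ?_
  exact heisT_comm_of_neg (odd_two_mul_add_one _).neg (odd_two_mul_add_one _).neg (by omega)
    (by omega) w

/-- The action of polynomials in `b₁, b₃, …` on the test vectors. -/
def rho [CharZero k] : MvPolynomial ℕ k →ₐ[k] Module.End k (Fock k) :=
  commEval (fun i => (heisT (2 * i + 1) : Module.End k (Fock k))) heisT_odd_comm

/-- The action of polynomials in `b₋₁, b₋₃, …` on the test vectors. -/
def rhoNeg [CharZero k] : MvPolynomial ℕ k →ₐ[k] Module.End k (Fock k) :=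
  commEval (fun i => (heisT (-(2 * i + 1)) : Module.End k (Fock k))) heisT_neg_odd_comm

theorem rho_X [CharZero k] (i : ℕ) : rho (MvPolynomial.X i) = heisT (k := k) (2 * i + 1) :=
  commEval_X ..

theorem rhoNeg_X [CharZero k] (i : ℕ) :
    rhoNeg (MvPolynomial.X i) = heisT (k := k) (-(2 * i + 1)) :=
  commEval_X ..

/-! ### Heisenberg monomials and their Gram matrix. -/

/-- The weight `∑ a_i (2 i + 1)` of the exponent vector of an odd partition. -/
def wt : (ℕ →₀ ℕ) →+ ℕ := Finsupp.weight fun i => 2 * i + 1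

theorem wt_single (i n : ℕ) : wt (Finsupp.single i n) = n * (2 * i + 1) := by
  simp [wt, Finsupp.weight_single]

/-- The norm `∏ ((2 i + 1) / 2)^{a_i} a_i!` of a monomial. -/
def normW (k : Type*) [Field k] (a : ℕ →₀ ℕ) : k :=
  a.prod fun i n => ((2 * i + 1) / 2 : k) ^ n * Nat.factorial n

theorem normW_ne_zero [CharZero k] (a : ℕ →₀ ℕ) : normW k a ≠ 0 := by
  refine Finset.prod_ne_zero_iff.2 fun i _ => ?_
  have : (2 * i + 1 : k) ≠ 0 := by exact_mod_cast (2 * i).succ_ne_zero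
  have h2 : ((a i).factorial : k) ≠ 0 := by exact_mod_cast Nat.factorial_ne_zero _
  have h3 : (2 : k) ≠ 0 := two_ne_zero
  exact mul_ne_zero (pow_ne_zero _ (div_ne_zero this h3)) h2

theorem normW_add_single (a : ℕ →₀ ℕ) (i : ℕ) :
    normW k (a + Finsupp.single i 1) = normW k a * (((2 * i + 1) / 2 : k) * (a i + 1)) := by
  set g : ℕ → ℕ → k := fun i n => ((2 * i + 1) / 2 : k) ^ n * Nat.factorial n with hg
  have hg0 : ∀ s, g s 0 = 1 := fun s => by simp [hg]
  unfold normW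
  rw [← Finsupp.mul_prod_erase' (a + Finsupp.single i 1) i g hg0,
    ← Finsupp.mul_prod_erase' a i g hg0]
  have he : (a + Finsupp.single i 1).erase i = a.erase i := by
    ext s
    by_cases h : s = i
    · subst h; simp
    · simp [Finsupp.erase_ne h]
  rw [he]
  simp only [hg, Finsupp.add_apply, Finsupp.single_eq_same, Nat.factorial_succ]
  push_cast
  ring

theorem induction_monomial {P : (ℕ →₀ ℕ) → Prop} (h0 : P 0)
    (h : ∀ a i, P a → P (a + Finsupp.single i 1)) (a : ℕ →₀ ℕ) : P a := by
  induction hn : a.degree generalizing a with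
  | zero => rwa [Finsupp.degree_eq_zero_iff _ |>.1 hn]
  | succ n ih =>
    have ha : a ≠ 0 := by rintro rfl; simp at hn
    obtain ⟨i, hi⟩ := Finsupp.ne_iff.1 ha
    have h1 : a - Finsupp.single i 1 + Finsupp.single i 1 = a :=
      tsub_add_cancel_of_le (Finsupp.single_le_iff.2 (Nat.one_le_iff_ne_zero.2 hi))
    rw [← h1] at hn ⊢
    rw [map_add, Finsupp.degree_single] at hn
    exact h _ i (ih _ (by omega))

theorem isHomog_rho [CharZero k] {d : ℤ} {p : Prop} {w : Fock k} (hw : IsHomog d p w)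
    (a : ℕ →₀ ℕ) : IsHomog (d + wt a) p (rho (MvPolynomial.monomial a 1) w) := by
  induction a using induction_monomial with
  | h0 => simpa using hw
  | h a i ih =>
    rw [add_comm a, MvPolynomial.monomial_single_add, pow_one, map_mul, rho_X, Module.End.mul_apply]
    have := ih.heisT (m := 2 * i + 1) (by omega)
    convert this using 1
    rw [wt.map_add, wt_single]
    push_cast
    ring

theorem rho_comm [CharZero k] (P Q : MvPolynomial ℕ k) (w : Fock k) :
    rho P (rho Q w) = rho Q (rho P w) := by
  rw [← Module.End.mul_apply, ← map_mul, mul_comm, map_mul, Module.End.mul_apply]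

/-- The Heisenberg relation says that commuting with `b_{-(2i+1)}` is the derivation `((2i+1)/2)
∂_i` on polynomials in the commuting generators; it suffices to know this on the variables. -/
theorem heisT_neg_rho [CharZero k] (i : ℕ) (P : MvPolynomial ℕ k) (w : Fock k) :
    heisT (-(2 * i + 1)) (rho P w) =
      rho P (heisT (-(2 * i + 1)) w) + ((2 * i + 1) / 2 : k) • rho (MvPolynomial.pderiv i P) w := by
  induction P using MvPolynomial.induction_on generalizing w with
  | C c =>
    rw [MvPolynomial.pderiv_C, map_zero, ← MvPolynomial.algebraMap_eq, AlgHom.commutes]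
    simp
  | add p q hp hq =>
    simp only [map_add, LinearMap.add_apply, hp, hq, smul_add]
    abel
  | mul_X p j hp =>
    rw [map_mul, Module.End.mul_apply, hp, rho_X,
      heisT_neg_heisT (m := 2 * i + 1) (n := 2 * j + 1) (by simp) (by simp) (by positivity)
        (by positivity)]
    rw [Derivation.leibniz, MvPolynomial.pderiv_X]
    simp only [map_add, smul_eq_mul, map_mul, ← rho_X, LinearMap.add_apply, Module.End.mul_apply,
      smul_add, map_smul, rho_comm (MvPolynomial.X j)]
    by_cases hij : i = j
    · subst hij
      simp only [if_true, Pi.single_eq_same, map_one, Module.End.one_apply]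
      push_cast
      abel
    · have : ¬ ((2 * i + 1 : ℤ) = 2 * j + 1) := by omega
      rw [if_neg this, Pi.single_eq_of_ne (Ne.symm hij)]
      simp

/-- The pairing of monomials in the creation and annihilation operators. -/
theorem rhoNeg_rho_vac [CharZero k] (a b : ℕ →₀ ℕ) :
    rhoNeg (MvPolynomial.monomial a 1) (rho (MvPolynomial.monomial b 1) (ket ∅ : Fock k)) ∅ =
      if a = b then normW k a else 0 := by
  induction a using induction_monomial generalizing b with
  | h0 =>
    have h1 : (MvPolynomial.monomial (0 : ℕ →₀ ℕ) (1 : k)) = 1 := rfl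
    rw [h1, map_one, Module.End.one_apply]
    by_cases hb : 0 = b
    · subst hb
      simp [h1, normW, ket_apply]
    · rw [if_neg hb]
      by_contra hne
      have := (isHomog_rho (isHomog_ket (k := k) ∅) b ∅ hne).1
      simp at this
      obtain ⟨i, hi⟩ := Finsupp.ne_iff.1 (Ne.symm hb)
      have h2 : 2 * i + 1 ≤ wt b := Finsupp.le_weight_of_ne_zero' (fun i => 2 * i + 1) hi
      omega
  | h a i ih =>
    -- One annihilator, which kills the vacuum, differentiates the monomial `b`; the remaining ones
    -- are handled by induction.
    rw [add_comm a, MvPolynomial.monomial_single_add, pow_one, mul_comm, map_mul, rhoNeg_X,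
      Module.End.mul_apply, heisT_neg_rho, heisT_neg_vac (by omega), map_zero, zero_add,
      MvPolynomial.pderiv_monomial]
    by_cases hb : b i = 0
    · rw [if_neg]
      · simp [hb]
      · rintro rfl
        simp at hb
    · have hle : Finsupp.single i 1 ≤ b := by
        rw [Finsupp.single_le_iff]; exact Nat.one_le_iff_ne_zero.2 hb
      obtain ⟨b', rfl⟩ := exists_add_of_le hle
      rw [add_tsub_cancel_left]
      have h3 : MvPolynomial.monomial b' (1 * (((Finsupp.single i 1 + b' : ℕ →₀ ℕ) i : ℕ) : k)) =
          ((b' i + 1 : k)) • MvPolynomial.monomial b' 1 := by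
        rw [MvPolynomial.smul_monomial]
        simp [add_comm]
      rw [h3]
      simp only [map_smul, LinearMap.smul_apply, Finsupp.smul_apply, ih, smul_eq_mul]
      simp only [add_right_inj]
      split_ifs with h
      · subst h
        rw [add_comm _ a, normW_add_single]
        ring
      · simp

/-! ### The coefficients of the deformed generators -/

theorem inv_one_sub_C_mul_X (c : k) :
    (1 - PowerSeries.C c * PowerSeries.X)⁻¹ =
      PowerSeries.rescale c (PowerSeries.mk (1 : ℕ → k)) := by
  rw [PowerSeries.inv_eq_iff_mul_eq_one (by simp)]
  have := congrArg (PowerSeries.rescale c) (PowerSeries.mk_one_mul_one_sub_eq_one k)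
  rwa [map_mul, map_sub, map_one, PowerSeries.rescale_X] at this

theorem coeff_geom_pow (c : k) (n i : ℕ) :
    PowerSeries.coeff (i + (n + 1))
      ((PowerSeries.X * (1 - PowerSeries.C c * PowerSeries.X)⁻¹) ^ (n + 1)) =
      c ^ i * (n + i).choose n := by
  rw [mul_pow, inv_one_sub_C_mul_X, PowerSeries.coeff_X_pow_mul, ← map_pow,
    PowerSeries.coeff_rescale, PowerSeries.mk_one_pow_eq_mk_choose_add, PowerSeries.coeff_mk]

theorem coeff_geom_pow_of_lt (c : k) {n j : ℕ} (h : j < n) :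
    PowerSeries.coeff j ((PowerSeries.X * (1 - PowerSeries.C c * PowerSeries.X)⁻¹) ^ n) = 0 := by
  rw [mul_pow, PowerSeries.coeff_X_pow_mul', if_neg (by omega)]

theorem one_add_C_mul_X (c : k) : (1 + PowerSeries.C c * PowerSeries.X : PowerSeries k) =
    1 - PowerSeries.C (-c) * PowerSeries.X := by
  rw [map_neg]; ring

theorem negCoeff_of_lt (β : k) {m j : ℕ} (h : j < m) : negCoeff β m j = 0 := by
  unfold negCoeff
  rw [neg_pow, one_add_C_mul_X, map_sub, coeff_geom_pow_of_lt _ h,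
    show ((-1 : PowerSeries k) ^ m) = PowerSeries.C ((-1) ^ m) by simp,
    PowerSeries.coeff_C_mul, coeff_geom_pow_of_lt _ h]
  simp

theorem negCoeff_eq (β : k) (n i : ℕ) : negCoeff β (n + 1) (i + (n + 1)) =
    (1 - (-1) ^ (i + (n + 1))) * ((β / 2) ^ i * (n + i).choose n) / 2 := by
  unfold negCoeff
  rw [neg_pow, one_add_C_mul_X, map_sub, coeff_geom_pow,
    show ((-1 : PowerSeries k) ^ (n + 1)) = PowerSeries.C ((-1) ^ (n + 1)) by simp,
    PowerSeries.coeff_C_mul, coeff_geom_pow, neg_pow (β / 2)]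
  ring

theorem negCoeff_even (β : k) (m : ℕ+) {j : ℕ} (hj : Even j) : negCoeff β m j = 0 := by
  rcases lt_or_ge j m with h | h
  · exact negCoeff_of_lt β h
  · obtain ⟨n, hn⟩ := Nat.exists_eq_succ_of_ne_zero m.ne_zero
    obtain ⟨i, rfl⟩ := exists_add_of_le h
    rw [hn, Nat.succ_eq_add_one] at hj ⊢
    rw [add_comm (n + 1) i] at hj ⊢
    rw [negCoeff_eq, hj.neg_one_pow]
    simp

theorem posCoeff_eq (β : k) (m j : ℕ) : posCoeff β m j =
    ((-1) ^ (m - j) - (-1) ^ m) * ((β / 2) ^ (m - j) * m.choose j) / 2 := by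
  unfold posCoeff
  have h1 : (-Polynomial.X - Polynomial.C (β / 2) : Polynomial k) ^ m =
      Polynomial.C ((-1) ^ m) * (Polynomial.X + Polynomial.C (β / 2)) ^ m := by
    rw [map_pow, ← mul_pow]
    congr 1
    simp
    ring
  rw [sub_eq_add_neg Polynomial.X, ← map_neg Polynomial.C, h1, Polynomial.coeff_sub,
    Polynomial.coeff_C_mul, Polynomial.coeff_X_add_C_pow, Polynomial.coeff_X_add_C_pow,
    neg_pow (β / 2)]
  ring

theorem posCoeff_of_lt (β : k) {m j : ℕ} (h : m < j) : posCoeff β m j = 0 := by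
  unfold posCoeff
  have h1 : (-Polynomial.X - Polynomial.C (β / 2) : Polynomial k) ^ m =
      Polynomial.C ((-1) ^ m) * (Polynomial.X + Polynomial.C (β / 2)) ^ m := by
    rw [map_pow, ← mul_pow]
    congr 1
    simp
    ring
  rw [sub_eq_add_neg Polynomial.X, ← map_neg Polynomial.C, h1, Polynomial.coeff_sub,
    Polynomial.coeff_C_mul, Polynomial.coeff_X_add_C_pow, Polynomial.coeff_X_add_C_pow,
    Nat.choose_eq_zero_of_lt h]
  simp

theorem posCoeff_even (β : k) (m : ℕ) {j : ℕ} (hj : Even j) : posCoeff β m j = 0 := by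
  rcases lt_or_ge m j with h | h
  · exact posCoeff_of_lt β h
  · rw [posCoeff_eq β m j]
    obtain ⟨i, rfl⟩ := exists_add_of_le h
    rw [add_tsub_cancel_left, pow_add, hj.neg_one_pow]
    simp

/-- The series `x / (1 + (β/2) x)`. -/
def xPar (β : k) : PowerSeries k :=
  PowerSeries.X * (1 + PowerSeries.C (β / 2) * PowerSeries.X)⁻¹

/-- The series `(x + β/2)^n - (β/2)^n`. -/
def xBrk (β : k) (n : ℕ) : PowerSeries k :=
  (PowerSeries.X + PowerSeries.C (β / 2)) ^ n - PowerSeries.C ((β / 2) ^ n)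

theorem coeff_xBrk (β : k) (N : ℕ) {n : ℕ} (hn : n ≠ 0) :
    PowerSeries.coeff n (xBrk β N) = (β / 2) ^ (N - n) * N.choose n := by
  have : (PowerSeries.X + PowerSeries.C (β / 2) : PowerSeries k) ^ N =
      (((Polynomial.X + Polynomial.C (β / 2)) ^ N : Polynomial k) : PowerSeries k) := by
    simp
  rw [xBrk, map_sub, this, Polynomial.coeff_coe, Polynomial.coeff_X_add_C_pow,
    PowerSeries.coeff_C, if_neg hn, sub_zero]

theorem coeff_zero_xBrk (β : k) (N : ℕ) : PowerSeries.coeff 0 (xBrk β N) = 0 := by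
  simp [xBrk]

/-- The absorption identity `j * C(m, j) = m * C(m-1, j-1)`, with `j = 2i+1`. It exchanges the
expansion of `b_m^{(β)}` in the `b_j` with that of `(x/(1+βx/2))^j` in powers of `x`, so the total
coefficient of `b_j` in the exponent becomes `(2/j) p_j^{(β)}`. -/
theorem posCoeff_mul [CharZero k] (β : k) (m : ℕ+) (i : ℕ) :
    2 / ((m : ℕ) : k) * posCoeff β m (2 * i + 1) =
      2 / (2 * i + 1) * PowerSeries.coeff (m : ℕ) (xPar β ^ (2 * i + 1)) := by
  unfold xPar
  rw [one_add_C_mul_X]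
  rcases lt_or_ge (m : ℕ) (2 * i + 1) with h | h
  · rw [posCoeff_of_lt β h, coeff_geom_pow_of_lt _ h, mul_zero, mul_zero]
  · rw [posCoeff_eq β _ _]
    have hm : ((m : ℕ) : k) ≠ 0 := by exact_mod_cast m.ne_zero
    have hi : (2 * i + 1 : k) ≠ 0 := by exact_mod_cast (2 * i).succ_ne_zero
    obtain ⟨l, hl⟩ := exists_add_of_le h
    have hg := coeff_geom_pow (-(β / 2)) (2 * i) l
    rw [add_comm l] at hg
    rw [hl] at hm ⊢
    rw [hg, add_tsub_cancel_left]
    have hch : ((2 * i + 1 + l : ℕ) : k) * ((2 * i + l).choose (2 * i) : k) =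
        ((2 * i + 1 + l).choose (2 * i + 1) : k) * (2 * i + 1) := by
      have := Nat.add_one_mul_choose_eq (2 * i + l) (2 * i)
      have h2 := congrArg (Nat.cast : ℕ → k) this
      rw [show 2 * i + l + 1 = 2 * i + 1 + l by ring] at h2
      push_cast at h2 ⊢
      linear_combination h2
    have hodd : (-1 : k) ^ (2 * i + 1) = -1 := (odd_two_mul_add_one i).neg_one_pow
    rw [neg_pow (β / 2), pow_add, hodd]
    generalize β / 2 = c
    generalize ((2 * i + 1 + l).choose (2 * i + 1) : k) = A at *
    generalize ((2 * i + l).choose (2 * i) : k) = B at *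
    push_cast at hm hch ⊢
    field_simp
    linear_combination (-2 * c ^ l) * hch

/-- The same absorption identity with the roles of the two indices exchanged, which produces `(2/j)
p_j^{[β]}`. -/
theorem negCoeff_mul [CharZero k] (β : k) (m : ℕ+) (i : ℕ) :
    2 / ((m : ℕ) : k) * negCoeff β m (2 * i + 1) =
      2 / (2 * i + 1) * PowerSeries.coeff (m : ℕ) (xBrk β (2 * i + 1)) := by
  rw [coeff_xBrk _ _ m.ne_zero]
  rcases lt_or_ge (2 * i + 1) (m : ℕ) with h | h
  · rw [negCoeff_of_lt β h, Nat.choose_eq_zero_of_lt h]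
    simp
  · have hm : ((m : ℕ) : k) ≠ 0 := by exact_mod_cast m.ne_zero
    have hi : (2 * i + 1 : k) ≠ 0 := by exact_mod_cast (2 * i).succ_ne_zero
    obtain ⟨n, hn⟩ := Nat.exists_eq_succ_of_ne_zero m.ne_zero
    rw [hn, Nat.succ_eq_add_one] at h hm ⊢
    obtain ⟨l, hl⟩ := exists_add_of_le h
    have hodd : (-1 : k) ^ (2 * i + 1) = -1 := (odd_two_mul_add_one i).neg_one_pow
    have e1 : 2 * i + 1 - (n + 1) = l := by omega
    have hch : ((2 * i + 1 : ℕ) : k) * ((n + l).choose n : k) =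
        ((2 * i + 1).choose (n + 1) : k) * (n + 1) := by
      have := Nat.add_one_mul_choose_eq (n + l) n
      have h2 := congrArg (Nat.cast : ℕ → k) this
      rw [show n + l + 1 = 2 * i + 1 by omega] at h2
      push_cast at h2 ⊢
      exact h2
    rw [e1]
    have h3 : negCoeff β (n + 1) (2 * i + 1) = (β / 2) ^ l * (n + l).choose n := by
      rw [show 2 * i + 1 = l + (n + 1) by omega, negCoeff_eq, ← show 2 * i + 1 = l + (n + 1) by omega,
        hodd]
      ring
    rw [h3]
    push_cast at hm hch ⊢
    generalize β / 2 = c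
    field_simp
    linear_combination (c ^ l) * hch

/-! ### The deformed generators as polynomials in the Heisenberg generators -/

theorem finsum_odd {M : Type*} [AddCommMonoid M] {f : ℕ → M} (h : ∀ j, Even j → f j = 0) :
    ∑ᶠ j, f j = ∑ᶠ i, f (2 * i + 1) := by
  have hinj : Function.Injective fun i : ℕ => 2 * i + 1 := fun a b h => by simpa using h
  rw [← finsum_mem_range (f := f) hinj]
  refine finsum_congr fun j => ?_
  rcases Nat.even_or_odd j with hj | ⟨i, rfl⟩
  · rw [h j hj, finsum_zero]
  · simp

/-- Vectors of the completed Fock space supported in weights `≤ D`. -/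
def weightLE (k : Type*) [Field k] (D : ℕ) : Submodule k (FockHat k) where
  carrier := {v | ∀ S, v S ≠ 0 → ∑ s ∈ S, s ≤ D}
  zero_mem' S h := absurd rfl h
  add_mem' := by
    intro v v' h h' S hS
    by_cases h0 : v S = 0
    · exact h' S (by simpa [h0] using hS)
    · exact h S h0
  smul_mem' := by
    intro c v h S hS
    exact h S fun h0 => hS (by simp [h0])

/-- Vectors of the Fock space supported in weights `≤ D`. -/
def fockLE (k : Type*) [Field k] (D : ℕ) : Submodule k (Fock k) where
  carrier := {v | ∀ S, v S ≠ 0 → ∑ s ∈ S, s ≤ D}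
  zero_mem' S h := absurd rfl h
  add_mem' := by
    intro v v' h h' S hS
    by_cases h0 : v S = 0
    · exact h' S (by simpa [h0] using hS)
    · exact h S h0
  smul_mem' := by
    intro c v h S hS
    exact h S fun h0 => hS (by simp [h0])

theorem heisT_ket_support {m : ℤ} (hm : m ≠ 0) {S T : Finset ℕ}
    (h : heisT m (ket S : Fock k) T ≠ 0) :
    ((∑ s ∈ T, s : ℕ) : ℤ) = ((∑ s ∈ S, s : ℕ) : ℤ) + m :=
  (((isHomog_ket (k := k) S).heisT hm) T h).1

theorem pair_eq_zero {v : FockHat k} {w : Fock k} (h : ∀ S, w S ≠ 0 → v S = 0) : pair v w = 0 := by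
  rw [pair_apply]
  refine Finset.sum_eq_zero fun S hS => ?_
  simp only [h S (Finsupp.mem_support_iff.1 hS), mul_zero]

theorem heis_mem_weightLE {D : ℕ} {v : FockHat k} (hv : v ∈ weightLE k D) (i : ℕ) {S : Finset ℕ}
    (h : D < (∑ s ∈ S, s) + (2 * i + 1)) : heis (2 * i + 1) v S = 0 := by
  rw [heis_apply (by omega)]
  refine pair_eq_zero fun T hT => ?_
  by_contra hne
  have h1 := heisT_ket_support (by omega) hT
  have h2 := hv T hne
  omega

theorem heis_neg_eq_zero (v : FockHat k) (i : ℕ) {S : Finset ℕ}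
    (h : (∑ s ∈ S, s) < 2 * i + 1) : heis (-(2 * i + 1)) v S = 0 := by
  rw [heis_apply (by omega)]
  refine pair_eq_zero fun T hT => ?_
  have h1 := heisT_ket_support (by omega) hT
  omega

/-- `b^{(β)}_m` as a polynomial in `b₁, b₃, …`. -/
def posPoly (β : k) (m : ℕ+) : MvPolynomial ℕ k :=
  ∑ i ∈ Finset.range m, posCoeff β m (2 * i + 1) • MvPolynomial.X i

/-- `b^{[β]}_m`, up to terms of weight `> 2 D`, as a polynomial in `b₁, b₃, …`. -/
def negPoly (β : k) (D : ℕ) (m : ℕ+) : MvPolynomial ℕ k :=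
  ∑ i ∈ Finset.range D, negCoeff β m (2 * i + 1) • MvPolynomial.X i

theorem pair_finset_sum {ι : Type*} (s : Finset ι) (c : ι → k) (f : ι → FockHat k) (w : Fock k) :
    pair (fun S => ∑ i ∈ s, c i * f i S) w = ∑ i ∈ s, c i * pair (f i) w := by
  classical
  induction s using Finset.induction_on with
  | empty =>
    simp only [Finset.sum_empty]
    exact congrFun (congrArg _ pair_zero) w
  | insert x s hx ih =>
    simp only [Finset.sum_insert hx]
    rw [← ih, ← smul_eq_mul (c x), ← LinearMap.smul_apply, ← pair_smul, ← LinearMap.add_apply,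
      ← pair_add]
    rfl

theorem bPar_eq (β : k) (m : ℕ+) (v : FockHat k) :
    bPar β m v = fun S => ∑ i ∈ Finset.range m, posCoeff β m (2 * i + 1) * heis (2 * i + 1) v S := by
  funext S
  have h1 : ∑ j ∈ Finset.range ((m : ℕ) + 1), posCoeff β m j * heis (j : ℤ) v S =
      ∑ᶠ j : ℕ, posCoeff β m j * heis (j : ℤ) v S := by
    rw [finsum_eq_sum_of_support_subset]
    intro j hj
    by_contra h
    refine hj ?_
    simp only [posCoeff_of_lt β (show (m : ℕ) < j by simpa using h), zero_mul]
  rw [bPar, h1, finsum_odd (fun j hj => by rw [posCoeff_even β m hj, zero_mul]),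
    finsum_eq_sum_of_support_subset (s := Finset.range m)]
  · push_cast
    rfl
  · intro i hi
    by_contra h
    refine hi ?_
    have h2 : (m : ℕ) ≤ i := by simpa using h
    simp only [posCoeff_of_lt β (show (m : ℕ) < 2 * i + 1 by omega), zero_mul]

theorem pair_bPar [CharZero k] (β : k) (m : ℕ+) (v : FockHat k) (w : Fock k) :
    pair (bPar β m v) w = pair v (rho (posPoly β m) w) := by
  rw [bPar_eq, pair_finset_sum, posPoly]
  simp only [map_sum, map_smul, LinearMap.sum_apply, LinearMap.smul_apply, rho_X, smul_eq_mul]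
  refine Finset.sum_congr rfl fun i _ => ?_
  rw [pair_heis (by omega)]

/-- `b_{2i+1}` lowers the weight by `2i+1`, so it kills vectors of weight at most `D` once `i ≥ D`,
and the infinite series may be cut off there. -/
theorem bBrk_eq (β : k) (m : ℕ+) {D : ℕ} {v : FockHat k} (hv : v ∈ weightLE k D) :
    bBrk β m v = fun S => ∑ i ∈ Finset.range D, negCoeff β m (2 * i + 1) * heis (2 * i + 1) v S := by
  funext S
  simp only [bBrk, heisStar_eq_heis, neg_neg]
  rw [finsum_odd (fun j hj => by rw [negCoeff_even β m hj, zero_mul]),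
    finsum_eq_sum_of_support_subset (s := Finset.range D)]
  · push_cast
    rfl
  · intro i hi
    by_contra h
    refine hi ?_
    have h2 : D ≤ i := by simpa using h
    push_cast
    rw [heis_mem_weightLE hv i (by omega), mul_zero]

theorem bBrk_mem (β : k) (m : ℕ+) {D : ℕ} {v : FockHat k} (hv : v ∈ weightLE k D) :
    bBrk β m v ∈ weightLE k D := by
  rw [bBrk_eq β m hv]
  intro S hS
  by_contra h
  refine hS (Finset.sum_eq_zero fun i _ => ?_)
  rw [heis_mem_weightLE hv i (by omega), mul_zero]

theorem pair_bBrk [CharZero k] (β : k) (m : ℕ+) {D : ℕ} {v : FockHat k} (hv : v ∈ weightLE k D)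
    (w : Fock k) : pair (bBrk β m v) w = pair v (rho (negPoly β D m) w) := by
  rw [bBrk_eq β m hv, pair_finset_sum, negPoly]
  simp only [map_sum, map_smul, LinearMap.sum_apply, LinearMap.smul_apply, rho_X, smul_eq_mul]
  refine Finset.sum_congr rfl fun i _ => ?_
  rw [pair_heis (by omega)]

/-- Here `v` is arbitrary and the series acts on it with infinitely many terms. The cutoff comes
from the test vector: the coefficient at `S` of `b_{-(2i+1)} v` vanishes when `2i+1` exceeds the
weight of `S`. -/
theorem pair_bParNeg [CharZero k] (β : k) (m : ℕ+) {D : ℕ} (v : FockHat k) {w : Fock k}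
    (hw : w ∈ fockLE k D) : pair (bParNeg β m v) w = pair v (rhoNeg (negPoly β D m) w) := by
  have h1 : pair (bParNeg β m v) w =
      pair (fun S => ∑ i ∈ Finset.range D, negCoeff β m (2 * i + 1) * heis (-(2 * i + 1)) v S) w := by
    rw [pair_apply, pair_apply]
    refine Finset.sum_congr rfl fun S hS => ?_
    have hSD := hw S (Finsupp.mem_support_iff.1 hS)
    simp only [bParNeg]
    congr 1
    rw [finsum_odd (fun j hj => by rw [negCoeff_even β m hj, zero_mul]),
      finsum_eq_sum_of_support_subset (s := Finset.range D)]
    · push_cast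
      rfl
    · intro i hi
      by_contra h
      refine hi ?_
      have h2 : D ≤ i := by simpa using h
      push_cast
      rw [heis_neg_eq_zero v i (by omega), mul_zero]
  rw [h1, pair_finset_sum, negPoly]
  simp only [map_sum, map_smul, LinearMap.sum_apply, LinearMap.smul_apply, rhoNeg_X, smul_eq_mul]
  refine Finset.sum_congr rfl fun i _ => ?_
  rw [pair_heis (by omega)]

/-- Transposed creation operators lower the weight, so the same cutoff `D` stays valid for all
further factors of the exponential. -/
theorem rhoNeg_mem [CharZero k] {D : ℕ} (P : MvPolynomial ℕ k) {w : Fock k} (hw : w ∈ fockLE k D) :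
    rhoNeg P w ∈ fockLE k D := by
  induction P using MvPolynomial.induction_on generalizing w with
  | C c =>
    rw [← MvPolynomial.algebraMap_eq, AlgHom.commutes]
    exact (fockLE k D).smul_mem c hw
  | add p q hp hq =>
    rw [map_add]
    exact (fockLE k D).add_mem (hp hw) (hq hw)
  | mul_X p j hp =>
    rw [map_mul, Module.End.mul_apply]
    refine hp ?_
    rw [rhoNeg_X]
    have hs : w = ∑ S ∈ w.support, w S • ket S := by
      conv_lhs => rw [← w.sum_single]
      simp [Finsupp.sum, ket]
    rw [hs, map_sum]
    refine (fockLE k D).sum_mem fun S hS => ?_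
    rw [map_smul]
    refine (fockLE k D).smul_mem _ fun T hT => ?_
    have h1 := heisT_ket_support (by omega) hT
    have h2 := hw S (Finsupp.mem_support_iff.1 hS)
    omega

/-- The exponents of `e^{H^{(β)}}`. -/
def posExp (β : k) (m : ℕ+) : MvPolynomial ℕ k := (2 / ((m : ℕ) : k)) • posPoly β m

/-- The exponents of `e^{H^{[β]}}` and `e^{H^{(β)}_-}`, up to terms of high weight. -/
def negExp (β : k) (D : ℕ) (m : ℕ+) : MvPolynomial ℕ k := (2 / ((m : ℕ) : k)) • negPoly β D m

theorem pair_exp_bPar [CharZero k] (β : k) (v : FockHat k) (w : Fock k) (a : ℕ+ →₀ ℕ) :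
    pair (expHamiltonian (bPar β) (constSeries v) a) w =
      pair v (rho (MvPowerSeries.coeff a (expSeries k (posExp β))) w) :=
  pair_expHamiltonian (V := ⊤) (W := ⊤) rho (posPoly β) (fun _ _ _ => trivial)
    (fun m v _ w _ => pair_bPar β m v w) (fun _ _ _ => trivial) trivial a trivial

theorem pair_exp_bBrk [CharZero k] (β : k) {D : ℕ} {v : FockHat k} (hv : v ∈ weightLE k D)
    (w : Fock k) (a : ℕ+ →₀ ℕ) :
    pair (expHamiltonian (bBrk β) (constSeries v) a) w =
      pair v (rho (MvPowerSeries.coeff a (expSeries k (negExp β D))) w) :=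
  pair_expHamiltonian (V := weightLE k D) (W := ⊤) rho (negPoly β D)
    (fun m _ hv => bBrk_mem β m hv) (fun m _ hv w _ => pair_bBrk β m hv w)
    (fun _ _ _ => trivial) hv a trivial

theorem pair_exp_bParNeg [CharZero k] (β : k) {D : ℕ} (v : FockHat k) {w : Fock k}
    (hw : w ∈ fockLE k D) (a : ℕ+ →₀ ℕ) :
    pair (expHamiltonian (bParNeg β) (constSeries v) a) w =
      pair v (rhoNeg (MvPowerSeries.coeff a (expSeries k (negExp β D))) w) :=
  pair_expHamiltonian (V := ⊤) (W := fockLE k D) rhoNeg (negPoly β D)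
    (fun _ _ _ => trivial) (fun m v _ _ hw => pair_bParNeg β m v hw)
    (fun _ _ hw => rhoNeg_mem _ hw) trivial a hw

theorem vacExp_bPar [CharZero k] (β : k) (v : FockHat k) (a : ℕ+ →₀ ℕ) :
    MvPowerSeries.coeff a (vacExp (bPar β) v) =
      pair v (rho (MvPowerSeries.coeff a (expSeries k (posExp β))) (ket ∅)) := by
  rw [← pair_exp_bPar, pair_ket]; rfl

theorem vacExp_bBrk [CharZero k] (β : k) {D : ℕ} {v : FockHat k} (hv : v ∈ weightLE k D)
    (a : ℕ+ →₀ ℕ) :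
    MvPowerSeries.coeff a (vacExp (bBrk β) v) =
      pair v (rho (MvPowerSeries.coeff a (expSeries k (negExp β D))) (ket ∅)) := by
  rw [← pair_exp_bBrk β hv, pair_ket]; rfl

/-! ### Substitution into exponential series -/

section ExpSubst

theorem finsum_of_injective {α γ M : Type*} [AddCommMonoid M] {g : α → γ}
    (hg : Function.Injective g) {f : γ → M} (h : ∀ j, j ∉ Set.range g → f j = 0) :
    ∑ᶠ j, f j = ∑ᶠ i, f (g i) := by
  classical
  rw [← finsum_mem_range (f := f) hg]
  refine finsum_congr fun j => ?_
  by_cases hj : j ∈ Set.range g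
  · rw [finsum_eq_if, if_pos hj]
  · rw [finsum_eq_if, if_neg hj, h j hj]

variable {σ τ R : Type*} [CommRing R] [Algebra k R]

/-- The linear series `∑ u_s X_s`. -/
def linSeries (u : σ → R) : MvPowerSeries σ R :=
  fun d => if d.degree = 1 then d.sum fun s n => n • u s else 0

theorem coeff_linSeries_single (u : σ → R) (s : σ) :
    MvPowerSeries.coeff (Finsupp.single s 1) (linSeries u) = u s := by
  change (if _ then _ else _) = _
  simp

theorem coeff_linSeries_of_ne (u : σ → R) {d : σ →₀ ℕ} (h : ∀ s, d ≠ Finsupp.single s 1) :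
    MvPowerSeries.coeff d (linSeries u) = 0 := by
  change (if _ then _ else _) = _
  rw [if_neg]
  intro h1
  have : d ≠ 0 := by rintro rfl; simp at h1
  obtain ⟨s, hs⟩ := Finsupp.ne_iff.1 this
  have hle : Finsupp.single s 1 ≤ d := Finsupp.single_le_iff.2 (Nat.one_le_iff_ne_zero.2 hs)
  obtain ⟨e, rfl⟩ := exists_add_of_le hle
  rw [map_add, Finsupp.degree_single, add_eq_left, Finsupp.degree_eq_zero_iff] at h1
  exact h s (by rw [h1, add_zero])

theorem coeff_linSeries_mul (u : σ → R) (F : MvPowerSeries σ R) (a : σ →₀ ℕ) :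
    MvPowerSeries.coeff a (linSeries u * F) =
      ∑ m ∈ a.support, u m * MvPowerSeries.coeff (a - Finsupp.single m 1) F := by
  classical
  rw [MvPowerSeries.coeff_mul]
  symm
  refine Finset.sum_of_injOn (fun m => (Finsupp.single m 1, a - Finsupp.single m 1)) ?_ ?_ ?_ ?_
  · intro x _ y _ h
    simpa using Finsupp.single_left_injective one_ne_zero (Prod.ext_iff.1 h).1
  · intro m hm
    rw [Finset.mem_coe, Finset.HasAntidiagonal.mem_antidiagonal]
    exact add_tsub_cancel_of_le (Finsupp.single_le_iff.2
      (Nat.one_le_iff_ne_zero.2 (Finsupp.mem_support_iff.1 hm)))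
  · rintro ⟨x, y⟩ hxy hne
    rw [Finset.HasAntidiagonal.mem_antidiagonal] at hxy
    simp only at hxy ⊢
    rw [coeff_linSeries_of_ne u, zero_mul]
    rintro s rfl
    refine hne ⟨s, ?_, ?_⟩
    · rw [Finset.mem_coe, Finsupp.mem_support_iff, ← hxy]
      simp
    · simp only [← hxy, add_tsub_cancel_left]
  · intro m _
    rw [coeff_linSeries_single]

/-- The multinomial theorem, obtained by induction from the derivative identity for the exponential;
it shows that `expSeries` is the exponential of a linear series. -/
theorem coeff_linSeries_pow [CharZero k] (u : σ → R) (n : ℕ) (a : σ →₀ ℕ) :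
    MvPowerSeries.coeff a (linSeries u ^ n) = if a.degree = n then
      (Nat.factorial n : k) • MvPowerSeries.coeff a (expSeries k u) else 0 := by
  classical
  induction n generalizing a with
  | zero =>
    rw [pow_zero, MvPowerSeries.coeff_one]
    by_cases ha : a = 0
    · subst ha; simp [coeff_expSeries]
    · rw [if_neg ha, if_neg (fun h => ha ((Finsupp.degree_eq_zero_iff a).1 h))]
  | succ n ih =>
    rw [pow_succ', coeff_linSeries_mul]
    have hterm : ∀ m ∈ a.support, u m * MvPowerSeries.coeff (a - Finsupp.single m 1)
        (linSeries u ^ n) = if a.degree = n + 1 then ((a m : k) * (Nat.factorial n : k)) •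
          MvPowerSeries.coeff a (expSeries k u) else 0 := by
      intro m hm
      have hdeg : (a - Finsupp.single m 1).degree = n ↔ a.degree = n + 1 := by
        have h1 : Finsupp.single m 1 ≤ a := by
          rw [Finsupp.single_le_iff]
          exact Nat.one_le_iff_ne_zero.2 (Finsupp.mem_support_iff.1 hm)
        have h2 : (a - Finsupp.single m 1 + Finsupp.single m 1).degree = a.degree := by
          rw [tsub_add_cancel_of_le h1]
        rw [map_add, Finsupp.degree_single] at h2
        omega
      rw [ih]
      simp only [hdeg]
      split_ifs
      · rw [mul_smul_comm, mul_coeff_expSeries (k := k) u a hm, smul_smul, mul_comm (a m : k)]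
      · simp
    rw [Finset.sum_congr rfl hterm]
    split_ifs with h
    · rw [← Finset.sum_smul, ← Finset.sum_mul, ← Nat.cast_sum, ← Finsupp.degree_apply, h,
        Nat.factorial_succ]
      push_cast
      rfl
    · simp

theorem hasSubst_linSeries (u : σ → R) : PowerSeries.HasSubst (linSeries u) := by
  refine PowerSeries.HasSubst.of_constantCoeff_zero ?_
  rw [← MvPowerSeries.coeff_zero_eq_constantCoeff_apply]
  refine coeff_linSeries_of_ne u fun s h => ?_
  have := DFunLike.congr_fun h s
  simp at this

theorem expSeries_eq_subst [CharZero k] (u : σ → R) :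
    expSeries k u = PowerSeries.subst (linSeries u) (PowerSeries.exp k) := by
  ext a
  rw [PowerSeries.coeff_subst (hasSubst_linSeries u), finsum_eq_single _ a.degree]
  · rw [coeff_linSeries_pow (k := k), if_pos rfl, PowerSeries.coeff_exp, smul_smul]
    have : ((a.degree.factorial : ℕ) : k) ≠ 0 := by exact_mod_cast Nat.factorial_ne_zero _
    simp [this]
  · intro n hn
    rw [coeff_linSeries_pow (k := k), if_neg (Ne.symm hn), smul_zero]

/-- Extension of scalars. -/
abbrev scalars (R : Type*) [CommRing R] [Algebra k R] (p : σ → MvPowerSeries τ k) :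
    σ → MvPowerSeries τ R := fun s => MvPowerSeries.map (algebraMap k R) (p s)

/-- The application of a linear functional to all coefficients of a series. -/
def mapCoeff (L : R →ₗ[k] k) (F : MvPowerSeries σ R) : MvPowerSeries σ k :=
  fun a => L (MvPowerSeries.coeff a F)

theorem coeff_mapCoeff (L : R →ₗ[k] k) (F : MvPowerSeries σ R) (a : σ →₀ ℕ) :
    MvPowerSeries.coeff a (mapCoeff L F) = L (MvPowerSeries.coeff a F) := rfl

/-- The substituted series have scalar coefficients, so a linear functional passes through the
substitution. Expectation values are not multiplicative; this allows exponentials to be manipulated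
over the ring of operators before the functional is applied. -/
theorem coeff_subst_functional {p : σ → MvPowerSeries τ k} (hp : MvPowerSeries.HasSubst p)
    (L : R →ₗ[k] k) (F : MvPowerSeries σ R) (d : τ →₀ ℕ) :
    MvPowerSeries.coeff d (MvPowerSeries.subst p (mapCoeff L F)) =
      L (MvPowerSeries.coeff d (MvPowerSeries.subst (scalars R p) F)) := by
  have hP : MvPowerSeries.HasSubst (scalars R p) := hp.map (algebraMap k R)
  rw [MvPowerSeries.coeff_subst hp, MvPowerSeries.coeff_subst hP]
  have := L.toAddMonoidHom.map_finsum (MvPowerSeries.coeff_subst_finite hP F d)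
  refine Eq.trans (finsum_congr fun a => ?_) this.symm
  have h1 : (a.prod fun s e => scalars R p s ^ e) =
      MvPowerSeries.map (algebraMap k R) (a.prod fun s e => p s ^ e) := by
    simp only [Finsupp.prod, map_prod, map_pow]
  rw [h1, MvPowerSeries.coeff_map, LinearMap.toAddMonoidHom_coe, smul_eq_mul (MvPowerSeries.coeff a F),
    mul_comm, ← Algebra.smul_def, map_smul, smul_eq_mul, smul_eq_mul, mul_comm]
  rfl

theorem coeff_subst_linSeries {P : σ → MvPowerSeries τ R} (hP : MvPowerSeries.HasSubst P)
    (u : σ → R) (d : τ →₀ ℕ) : MvPowerSeries.coeff d (MvPowerSeries.subst P (linSeries u)) =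
      ∑ᶠ s, u s * MvPowerSeries.coeff d (P s) := by
  rw [MvPowerSeries.coeff_subst hP, finsum_of_injective
    (Finsupp.single_left_injective (one_ne_zero : (1 : ℕ) ≠ 0))]
  · refine finsum_congr fun s => ?_
    rw [coeff_linSeries_single]
    simp
  · intro a ha
    rw [coeff_linSeries_of_ne u fun s h => ha ⟨s, h.symm⟩, zero_smul]

theorem subst_expSeries [CharZero k] {P : σ → MvPowerSeries τ R} (hP : MvPowerSeries.HasSubst P)
    (u : σ → R) : MvPowerSeries.subst P (expSeries k u) =
      PowerSeries.subst (MvPowerSeries.subst P (linSeries u)) (PowerSeries.exp k) := by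
  rw [expSeries_eq_subst]
  exact MvPowerSeries.subst_comp_subst_apply (hasSubst_linSeries u).const hP _

/-- A substitution into the image of an exponential series under a functional only depends
on the exponent. -/
theorem subst_functional_expSeries_congr [CharZero k] {σ' : Type*} (L : R →ₗ[k] k) {u : σ → R}
    {u' : σ' → R} {p : σ → MvPowerSeries τ k} {p' : σ' → MvPowerSeries τ k}
    (hp : MvPowerSeries.HasSubst p) (hp' : MvPowerSeries.HasSubst p')
    (h : ∀ d, ∑ᶠ s, MvPowerSeries.coeff d (p s) • u s =
      ∑ᶠ s, MvPowerSeries.coeff d (p' s) • u' s) :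
    MvPowerSeries.subst p (mapCoeff L (expSeries k u)) =
    MvPowerSeries.subst p' (mapCoeff L (expSeries k u')) := by
  ext d
  rw [coeff_subst_functional hp, coeff_subst_functional hp', subst_expSeries (hp.map _),
    subst_expSeries (hp'.map _)]
  congr 4
  ext e
  rw [coeff_subst_linSeries (hp.map _), coeff_subst_linSeries (hp'.map _)]
  simp only [MvPowerSeries.coeff_map, mul_comm (u _), mul_comm (u' _), ← Algebra.smul_def]
  exact h e

end ExpSubst

/-! ### Sums over the variables -/

section SumVars

variable {σ : Type*}

open Classical in
theorem coeff_subst_X (s : σ) (φ : PowerSeries k) (d : σ →₀ ℕ) :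
    MvPowerSeries.coeff d (PowerSeries.subst (MvPowerSeries.X (R := k) s) φ) =
      if d = Finsupp.single s (d s) then PowerSeries.coeff (d s) φ else 0 := by
  exact PowerSeries.coeff_subst_single s φ d

theorem coeff_sumVars_single {e : ℕ → σ} (he : Function.Injective e) (φ : PowerSeries k) (i : ℕ)
    {n : ℕ} (hn : n ≠ 0) :
    MvPowerSeries.coeff (Finsupp.single (e i) n) (sumVars e φ) = PowerSeries.coeff n φ := by
  change ∑ᶠ i : ℕ, _ = _
  rw [finsum_eq_single _ i]
  · simp [coeff_subst_X]
  · intro j hj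
    rw [coeff_subst_X, if_neg]
    have h1 : e i ≠ e j := fun h => hj (he h.symm)
    rw [Finsupp.single_eq_of_ne h1.symm]
    simp [hn]

theorem coeff_sumVars_of_ne {e : ℕ → σ} {φ : PowerSeries k} (h0 : PowerSeries.coeff 0 φ = 0)
    {d : σ →₀ ℕ} (h : ∀ i n, n ≠ 0 → d ≠ Finsupp.single (e i) n) :
    MvPowerSeries.coeff d (sumVars e φ) = 0 := by
  change ∑ᶠ i : ℕ, _ = _
  refine finsum_eq_zero_of_forall_eq_zero fun i => ?_
  rw [coeff_subst_X]
  split_ifs with hd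
  · by_cases hn : d (e i) = 0
    · rw [hn, h0]
    · exact absurd hd (h i _ hn)
  · rfl

theorem coeff_sumVars_zero (e : ℕ → σ) {φ : PowerSeries k} (h0 : PowerSeries.coeff 0 φ = 0) :
    MvPowerSeries.coeff 0 (sumVars e φ) = 0 :=
  coeff_sumVars_of_ne h0 fun i n hn h => hn (by simpa using (DFunLike.congr_fun h (e i)).symm)

/-- A family `∑_i φ_s(x_i)` can be substituted if the order of `φ_s` tends to infinity. -/
theorem hasSubst_sumVars {ι : Type*} {e : ℕ → σ} (he : Function.Injective e) {φ : ι → PowerSeries k}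
    (h0 : ∀ s, PowerSeries.coeff 0 (φ s) = 0)
    (hfin : ∀ n, {s | PowerSeries.coeff n (φ s) ≠ 0}.Finite) :
    MvPowerSeries.HasSubst fun s => sumVars e (φ s) where
  const_coeff s := by
    rw [← MvPowerSeries.coeff_zero_eq_constantCoeff_apply, coeff_sumVars_zero e (h0 s)]
    exact IsNilpotent.zero
  coeff_zero d := by
    by_cases h : ∃ i n, n ≠ 0 ∧ d = Finsupp.single (e i) n
    · obtain ⟨i, n, hn, rfl⟩ := h
      refine (hfin n).subset fun s hs => ?_
      simpa [coeff_sumVars_single he _ _ hn] using hs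
    · have : ∀ s, MvPowerSeries.coeff d (sumVars e (φ s)) = 0 := fun s =>
        coeff_sumVars_of_ne (h0 s) fun i n hn hd => h ⟨i, n, hn, hd⟩
      simp [this]

end SumVars

/-! ### The expectation values in terms of power sums -/

theorem coeff_zero_xPar_pow (β : k) (n : ℕ) : PowerSeries.coeff 0 (xPar β ^ (n + 1)) = 0 := by
  simp [xPar]

theorem coeff_xPar_pow_of_lt (β : k) {n j : ℕ} (h : j < n) :
    PowerSeries.coeff j (xPar β ^ n) = 0 := by
  unfold xPar
  rw [one_add_C_mul_X, coeff_geom_pow_of_lt _ h]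

theorem coeff_zero_X_pow_pnat (m : ℕ+) :
    PowerSeries.coeff 0 (PowerSeries.X ^ (m : ℕ) : PowerSeries k) = 0 := by
  rw [PowerSeries.coeff_X_pow, if_neg m.ne_zero.symm]

section Exponents

variable {σ R : Type*} [CommRing R] [Algebra k R] {e : ℕ → σ}

theorem finsum_powerSum (he : Function.Injective e) (u : ℕ+ → R) (i : ℕ) (n : ℕ+) :
    ∑ᶠ m : ℕ+, MvPowerSeries.coeff (Finsupp.single (e i) (n : ℕ)) (powerSum k e m) • u m = u n := by
  rw [finsum_eq_single _ n]
  · rw [powerSum, coeff_sumVars_single he _ _ n.ne_zero, PowerSeries.coeff_X_pow, if_pos rfl,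
      one_smul]
  · intro m hm
    rw [powerSum, coeff_sumVars_single he _ _ n.ne_zero, PowerSeries.coeff_X_pow, if_neg, zero_smul]
    exact fun h => hm (PNat.coe_injective h.symm)

/-- The exponent regrouped by odd Heisenberg generator. Both sides have only pure powers of single
variables, and at these the claim is `posCoeff_mul`. -/
theorem finsum_posCoeff [CharZero k] (he : Function.Injective e) (β : k) (x : ℕ → R) (d : σ →₀ ℕ) :
    ∑ᶠ m : ℕ+, MvPowerSeries.coeff d (powerSum k e m) •
        ((2 / ((m : ℕ) : k)) • ∑ i ∈ Finset.range m, posCoeff β m (2 * i + 1) • x i) =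
      ∑ᶠ i : ℕ, MvPowerSeries.coeff d (sumVars e (xPar β ^ (2 * i + 1))) •
        ((2 / (2 * i + 1) : k) • x i) := by
  by_cases h : ∃ i n, n ≠ 0 ∧ d = Finsupp.single (e i) n
  · obtain ⟨i, n, hn, rfl⟩ := h
    obtain ⟨n, rfl⟩ : ∃ m : ℕ+, (m : ℕ) = n := ⟨⟨n, Nat.pos_of_ne_zero hn⟩, rfl⟩
    rw [finsum_powerSum he, Finset.smul_sum, finsum_eq_sum_of_support_subset (s := Finset.range n)]
    · refine Finset.sum_congr rfl fun j _ => ?_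
      rw [coeff_sumVars_single he _ _ hn, smul_smul, smul_smul, posCoeff_mul, mul_comm]
    · intro j hj
      by_contra h
      refine hj ?_
      have h2 : (n : ℕ) ≤ j := by simpa using h
      beta_reduce
      rw [coeff_sumVars_single he _ _ hn, coeff_xPar_pow_of_lt β (by omega), zero_smul]
  · rw [finsum_eq_zero_of_forall_eq_zero, finsum_eq_zero_of_forall_eq_zero]
    · intro i
      rw [coeff_sumVars_of_ne (coeff_zero_xPar_pow β _) fun i n hn hd => h ⟨i, n, hn, hd⟩, zero_smul]
    · intro m
      rw [powerSum, coeff_sumVars_of_ne (coeff_zero_X_pow_pnat m)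
        fun i n hn hd => h ⟨i, n, hn, hd⟩, zero_smul]

theorem finsum_negCoeff [CharZero k] (he : Function.Injective e) (β : k) (D : ℕ) (x : ℕ → R)
    (d : σ →₀ ℕ) :
    ∑ᶠ m : ℕ+, MvPowerSeries.coeff d (powerSum k e m) •
        ((2 / ((m : ℕ) : k)) • ∑ i ∈ Finset.range D, negCoeff β m (2 * i + 1) • x i) =
      ∑ᶠ i : ℕ, MvPowerSeries.coeff d (sumVars e (if i < D then xBrk β (2 * i + 1) else 0)) •
        ((2 / (2 * i + 1) : k) • x i) := by
  have h0 : ∀ i, PowerSeries.coeff 0 (if i < D then xBrk β (2 * i + 1) else 0) = 0 := by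
    intro i
    split_ifs
    · exact coeff_zero_xBrk β _
    · simp
  by_cases h : ∃ i n, n ≠ 0 ∧ d = Finsupp.single (e i) n
  · obtain ⟨i, n, hn, rfl⟩ := h
    obtain ⟨n, rfl⟩ : ∃ m : ℕ+, (m : ℕ) = n := ⟨⟨n, Nat.pos_of_ne_zero hn⟩, rfl⟩
    rw [finsum_powerSum he, Finset.smul_sum, finsum_eq_sum_of_support_subset (s := Finset.range D)]
    · refine Finset.sum_congr rfl fun j hj => ?_
      rw [coeff_sumVars_single he _ _ hn, smul_smul, smul_smul, negCoeff_mul, mul_comm,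
        if_pos (Finset.mem_range.1 hj)]
    · intro j hj
      by_contra h
      refine hj ?_
      have h2 : ¬ j < D := by simpa using h
      beta_reduce
      rw [coeff_sumVars_single he _ _ hn, if_neg h2, map_zero, zero_smul]
  · rw [finsum_eq_zero_of_forall_eq_zero, finsum_eq_zero_of_forall_eq_zero]
    · intro i
      rw [coeff_sumVars_of_ne (h0 i) fun i n hn hd => h ⟨i, n, hn, hd⟩, zero_smul]
    · intro m
      rw [powerSum, coeff_sumVars_of_ne (coeff_zero_X_pow_pnat m)
        fun i n hn hd => h ⟨i, n, hn, hd⟩, zero_smul]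

theorem hasSubst_powerSum (he : Function.Injective e) :
    MvPowerSeries.HasSubst fun m : ℕ+ => powerSum k e (m : ℕ) := by
  refine hasSubst_sumVars he (fun m => coeff_zero_X_pow_pnat m) fun n => ?_
  refine Set.Subsingleton.finite fun a ha b hb => ?_
  simp only [Set.mem_ofPred_eq, PowerSeries.coeff_X_pow, ne_eq, ite_eq_right_iff, one_ne_zero,
    imp_false, not_not] at ha hb
  exact PNat.coe_injective (ha ▸ hb)

theorem hasSubst_xPar (he : Function.Injective e) (β : k) :
    MvPowerSeries.HasSubst fun i : ℕ => sumVars e (xPar β ^ (2 * i + 1)) := by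
  refine hasSubst_sumVars he (fun m => coeff_zero_xPar_pow β _) fun n => ?_
  refine (Set.finite_Iio (n + 1)).subset fun i hi => ?_
  by_contra h
  rw [Set.mem_Iio, not_lt] at h
  exact hi (coeff_xPar_pow_of_lt β (by omega))

/-- The truncation at `D` matters: the linear coefficient `(2i+1)(β/2)^{2i}` of `xBrk` is nonzero
for every `i` when `β ≠ 0`, so the full family cannot be substituted. -/
theorem hasSubst_xBrk (he : Function.Injective e) (β : k) (D : ℕ) :
    MvPowerSeries.HasSubst fun i : ℕ => sumVars e (if i < D then xBrk β (2 * i + 1) else 0) := by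
  refine hasSubst_sumVars he (fun i => ?_) fun n => ?_
  · split_ifs
    · exact coeff_zero_xBrk β _
    · simp
  · refine (Set.finite_Iio D).subset fun i hi => ?_
    by_contra h
    rw [Set.mem_Iio] at h
    simp [h] at hi

end Exponents

/-- The factors `2/(2i+1)` of the regrouped exponent and the factorials combine to the inverse of
the Gram norm of the monomial. -/
theorem coeff_expSeries_monomial (a : ℕ →₀ ℕ) :
    MvPowerSeries.coeff a (expSeries k fun i : ℕ => (2 / (2 * i + 1) : k) • MvPolynomial.X i) =
      (normW k a)⁻¹ • (MvPolynomial.monomial a 1 : MvPolynomial ℕ k) := by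
  rw [coeff_expSeries, MvPolynomial.monomial_eq, normW, Finsupp.prod, Finsupp.prod, Finsupp.prod,
    map_one, one_mul, ← Finset.prod_inv_distrib, ← Finset.prod_smul]
  refine Finset.prod_congr rfl fun i _ => ?_
  rw [smul_pow, smul_smul, mul_inv, ← inv_pow, inv_div, mul_comm]

/-- The functional `P ↦ ⟨0| P(b₁, b₃, …) |v⟩`. -/
def vacFun [CharZero k] (v : FockHat k) : MvPolynomial ℕ k →ₗ[k] k :=
  pair v ∘ₗ LinearMap.applyₗ (ket ∅) ∘ₗ (rho (k := k)).toLinearMap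

theorem vacFun_apply [CharZero k] (v : FockHat k) (P : MvPolynomial ℕ k) :
    vacFun v P = pair v (rho P (ket ∅)) := rfl

/-- The coefficients of `⟨0| e^H |v⟩` as a series in the odd power sums. -/
def oddCoeff [CharZero k] (v : FockHat k) : MvPowerSeries ℕ k :=
  fun a => (normW k a)⁻¹ * vacFun v (MvPolynomial.monomial a 1)

theorem coeff_oddCoeff [CharZero k] (v : FockHat k) (a : ℕ →₀ ℕ) :
    MvPowerSeries.coeff a (oddCoeff v) = (normW k a)⁻¹ * vacFun v (MvPolynomial.monomial a 1) := rfl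

theorem mapCoeff_vacFun [CharZero k] (v : FockHat k) : mapCoeff (vacFun v)
    (expSeries k fun i : ℕ => (2 / (2 * i + 1) : k) • MvPolynomial.X i) = oddCoeff v := by
  ext a
  rw [coeff_mapCoeff, coeff_expSeries_monomial, map_smul, coeff_oddCoeff, smul_eq_mul]

/-- The substitution depends only on the regrouped exponent. The coefficient series `oddCoeff v` is
independent of `β`; the deformation sits entirely in the power sums. -/
theorem expectPar_eq [CharZero k] (β : k) (v : FockHat k) :
    expectPar β v = MvPowerSeries.subst (fun i => powerSumPar β (2 * i + 1)) (oddCoeff v) := by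
  have h1 : vacExp (bPar β) v = mapCoeff (vacFun v) (expSeries k (posExp β)) := by
    ext a
    rw [vacExp_bPar]; rfl
  rw [expectPar, h1, ← mapCoeff_vacFun]
  exact subst_functional_expSeries_congr (vacFun v) (hasSubst_powerSum Function.injective_id)
    (hasSubst_xPar Function.injective_id β)
    (finsum_posCoeff Function.injective_id β MvPolynomial.X)

theorem vacFun_eq_zero [CharZero k] {D : ℕ} {v : FockHat k} (hv : v ∈ weightLE k D)
    {a : ℕ →₀ ℕ} (ha : D < wt a) : vacFun v (MvPolynomial.monomial a 1) = 0 := by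
  rw [vacFun_apply]
  refine pair_eq_zero fun S hS => ?_
  by_contra hne
  have h1 := hv S hne
  have h2 := (isHomog_rho (isHomog_ket (k := k) ∅) a S hS).1
  simp at h2
  have h3 : ((∑ s ∈ S, s : ℕ) : ℤ) = wt a := by rw [← h2]; push_cast; rfl
  omega

theorem exists_mem_weightLE (w : Fock k) : ∃ D, (w : FockHat k) ∈ weightLE k D := by
  refine ⟨w.support.sup fun S => ∑ s ∈ S, s, fun S hS => ?_⟩
  exact Finset.le_sup (f := fun S => ∑ s ∈ S, s) (Finsupp.mem_support_iff.2 hS)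

theorem expectBrk_eq_subst [CharZero k] (β : k) {D : ℕ} {w : Fock k}
    (hw : (w : FockHat k) ∈ weightLE k D) :
    expectBrk β w = MvPowerSeries.subst
      (fun i => sumVars id (if i < D then xBrk β (2 * i + 1) else 0)) (oddCoeff (w : FockHat k)) := by
  have h1 : vacExp (bBrk β) w = mapCoeff (vacFun (w : FockHat k)) (expSeries k (negExp β D)) := by
    ext a
    rw [vacExp_bBrk β hw]; rfl
  rw [expectBrk, h1, ← mapCoeff_vacFun]
  exact subst_functional_expSeries_congr (vacFun (w : FockHat k))
    (hasSubst_powerSum Function.injective_id) (hasSubst_xBrk Function.injective_id β D)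
    (finsum_negCoeff Function.injective_id β D MvPolynomial.X)

theorem lt_of_wt_le {a : ℕ →₀ ℕ} {D i : ℕ} (h : wt a ≤ D) (hi : a i ≠ 0) : 2 * i + 1 ≤ D :=
  (Finsupp.le_weight_of_ne_zero' (fun i => 2 * i + 1) hi).trans h

theorem apply_le_wt (a : ℕ →₀ ℕ) (i : ℕ) : a i ≤ wt a :=
  Finsupp.le_weight (fun i => 2 * i + 1) (s := i) (by omega) a

/-- The exponent vectors of weight at most `N`. -/
def wtLE (N : ℕ) : Finset (ℕ →₀ ℕ) :=
  ((Finset.range (N + 1)).finsupp fun _ => Finset.range (N + 1)).filter fun a => wt a ≤ N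

theorem mem_wtLE {N : ℕ} {a : ℕ →₀ ℕ} : a ∈ wtLE N ↔ wt a ≤ N := by
  rw [wtLE, Finset.mem_filter, Finset.mem_finsupp_iff]
  refine ⟨fun h => h.2, fun h => ⟨⟨fun i hi => ?_, fun i _ => ?_⟩, h⟩⟩
  · have := lt_of_wt_le h (Finsupp.mem_support_iff.1 hi)
    rw [Finset.mem_range]; omega
  · have := apply_le_wt a i
    rw [Finset.mem_range]; omega

/-- The coefficients vanish above weight `D`, so the substitution is a finite sum, and in weight at
most `D` the truncated power sums are the true ones. -/
theorem expectBrk_eq [CharZero k] (β : k) {D : ℕ} {w : Fock k}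
    (hw : (w : FockHat k) ∈ weightLE k D) :
    expectBrk β w = ∑ a ∈ wtLE D, MvPowerSeries.coeff a (oddCoeff (w : FockHat k)) •
      a.prod fun i n => powerSumBrk β (2 * i + 1) ^ n := by
  rw [expectBrk_eq_subst β hw]
  ext d
  rw [MvPowerSeries.coeff_subst (hasSubst_xBrk Function.injective_id β D),
    finsum_eq_sum_of_support_subset (s := wtLE D), map_sum]
  · refine Finset.sum_congr rfl fun a ha => ?_
    rw [map_smul]
    congr 2
    refine Finset.prod_congr rfl fun i hi => ?_
    have := lt_of_wt_le (mem_wtLE.1 ha) (Finsupp.mem_support_iff.1 hi)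
    beta_reduce
    rw [if_pos (by omega)]
    rfl
  · intro a ha
    by_contra h
    rw [Finset.mem_coe, mem_wtLE, not_le] at h
    refine ha ?_
    beta_reduce
    rw [coeff_oddCoeff, vacFun_eq_zero hw h, mul_zero, zero_smul]

/-! ### Odd and strict partitions -/

/-- The odd partition with exponent vector `a`. -/
def oddParts (a : ℕ →₀ ℕ) : Multiset ℕ := (Finsupp.toMultiset a).map fun i => 2 * i + 1

theorem oddParts_add (a b : ℕ →₀ ℕ) : oddParts (a + b) = oddParts a + oddParts b := by
  simp [oddParts]

theorem oddParts_single (i n : ℕ) :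
    oddParts (Finsupp.single i n) = Multiset.replicate n (2 * i + 1) := by
  simp [oddParts, Finsupp.toMultiset_single, Multiset.nsmul_singleton]

theorem oddParts_injective : Function.Injective oddParts := by
  intro a b h
  have h1 := Multiset.map_injective (fun x y (hxy : 2 * x + 1 = 2 * y + 1) => by omega) h
  rw [← Finsupp.toMultiset_toFinsupp a, h1, Finsupp.toMultiset_toFinsupp]

theorem sum_oddParts (a : ℕ →₀ ℕ) : (oddParts a).sum = wt a := by
  induction a using induction_monomial with
  | h0 => simp [oddParts]
  | h a i ih => rw [oddParts_add, Multiset.sum_add, ih, map_add, oddParts_single, wt_single]; simp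

theorem card_oddParts (a : ℕ →₀ ℕ) : Multiset.card (oddParts a) = a.degree := by
  induction a using induction_monomial with
  | h0 => simp [oddParts]
  | h a i ih =>
    rw [oddParts_add, Multiset.card_add, ih, map_add, oddParts_single, Finsupp.degree_single]; simp

theorem isOddPartition_oddParts (a : ℕ →₀ ℕ) : IsOddPartition (oddParts a) := by
  intro x hx
  obtain ⟨i, -, rfl⟩ := Multiset.mem_map.1 hx
  exact odd_two_mul_add_one i

theorem exists_oddParts {lam : Multiset ℕ} (h : IsOddPartition lam) : ∃ a, oddParts a = lam := by
  refine ⟨Multiset.toFinsupp (lam.map fun x => x / 2), ?_⟩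
  rw [oddParts, Multiset.toFinsupp_toMultiset, Multiset.map_map]
  conv_rhs => rw [← Multiset.map_id lam]
  refine Multiset.map_congr rfl fun x hx => ?_
  have := Nat.odd_iff.1 (h x hx)
  simp only [Function.comp_apply, id]
  omega

theorem prod_map_oddParts {M : Type*} [CommMonoid M] (f : ℕ → M) (a : ℕ →₀ ℕ) :
    ((oddParts a).map f).prod = a.prod fun i n => f (2 * i + 1) ^ n := by
  induction a using induction_monomial with
  | h0 => simp [oddParts]
  | h a i ih =>
    rw [oddParts_add, Multiset.map_add, Multiset.prod_add, ih, oddParts_single,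
      Finsupp.prod_add_index' (fun _ => pow_zero _) fun _ _ _ => pow_add _ _ _,
      Finsupp.prod_single_index (h := fun i n => f (2 * i + 1) ^ n) (pow_zero _)]
    simp

/-- The strict partitions of numbers at most `N`. -/
def strictLE (N : ℕ) : Finset (Finset ℕ) :=
  (Finset.range (N + 1)).powerset.filter fun S => 0 ∉ S ∧ ∑ s ∈ S, s ≤ N

theorem mem_strictLE {N : ℕ} {S : Finset ℕ} : S ∈ strictLE N ↔ 0 ∉ S ∧ ∑ s ∈ S, s ≤ N := by
  rw [strictLE, Finset.mem_filter, Finset.mem_powerset]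
  refine ⟨fun h => h.2, fun h => ⟨fun s hs => ?_, h⟩⟩
  have := Finset.single_le_sum (f := fun s : ℕ => s) (fun _ _ => Nat.zero_le _) hs
  rw [Finset.mem_range]
  have h2 := h.2
  omega

/-- The even sets of weight at most `N`. -/
def evenLE (N : ℕ) : Finset (Finset ℕ) :=
  (Finset.range (N + 1)).powerset.filter fun S => Even S.card ∧ ∑ s ∈ S, s ≤ N

theorem mem_evenLE {N : ℕ} {S : Finset ℕ} : S ∈ evenLE N ↔ Even S.card ∧ ∑ s ∈ S, s ≤ N := by
  rw [evenLE, Finset.mem_filter, Finset.mem_powerset]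
  refine ⟨fun h => h.2, fun h => ⟨fun s hs => ?_, h⟩⟩
  have := Finset.single_le_sum (f := fun s : ℕ => s) (fun _ _ => Nat.zero_le _) hs
  rw [Finset.mem_range]
  have h2 := h.2
  omega

theorem card_wtLE (N : ℕ) :
    (wtLE N).card = ∑ n ∈ Finset.range (N + 1), (Nat.Partition.odds n).card := by
  rw [Finset.card_eq_sum_card_fiberwise (f := wt) (t := Finset.range (N + 1))
    (fun a ha => by
      have := mem_wtLE.1 (Finset.mem_coe.1 ha)
      rw [Finset.mem_coe, Finset.mem_range]; omega)]
  refine Finset.sum_congr rfl fun n hn => ?_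
  rw [Finset.mem_range] at hn
  refine Finset.card_bij (fun a ha => ⟨oddParts a, ?_, ?_⟩) ?_ ?_ ?_
  · intro i hi
    exact (isOddPartition_oddParts a i hi).pos
  · rw [sum_oddParts]
    exact (Finset.mem_filter.1 ha).2
  · intro a ha
    simp only [Nat.Partition.odds, Nat.Partition.restricted, Finset.mem_filter, Finset.mem_univ,
      true_and]
    intro i hi
    exact Nat.not_even_iff_odd.2 (isOddPartition_oddParts a i hi)
  · intro a _ b _ h
    exact oddParts_injective (congrArg Nat.Partition.parts h)
  · intro p hp
    simp only [Nat.Partition.odds, Nat.Partition.restricted, Finset.mem_filter, Finset.mem_univ,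
      true_and] at hp
    obtain ⟨a, ha⟩ := exists_oddParts (lam := p.parts) fun i hi => Nat.not_even_iff_odd.1 (hp i hi)
    have hw : wt a = n := by rw [← sum_oddParts, ha, p.parts_sum]
    refine ⟨a, Finset.mem_filter.2 ⟨mem_wtLE.2 (by omega), hw⟩, Nat.Partition.ext ha⟩

theorem card_strictLE (N : ℕ) :
    (strictLE N).card = ∑ n ∈ Finset.range (N + 1), (Nat.Partition.distincts n).card := by
  rw [Finset.card_eq_sum_card_fiberwise (f := fun S => ∑ s ∈ S, s) (t := Finset.range (N + 1))
    (fun S hS => by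
      have := (mem_strictLE.1 (Finset.mem_coe.1 hS)).2
      rw [Finset.mem_coe, Finset.mem_range]; beta_reduce; omega)]
  refine Finset.sum_congr rfl fun n hn => ?_
  rw [Finset.mem_range] at hn
  refine Finset.card_bij (fun S hS => ⟨S.val, ?_, ?_⟩) ?_ ?_ ?_
  · intro i hi
    refine Nat.pos_of_ne_zero ?_
    rintro rfl
    exact (mem_strictLE.1 (Finset.mem_filter.1 hS).1).1 hi
  · have := (Finset.mem_filter.1 hS).2
    rwa [Finset.sum_eq_multiset_sum, Multiset.map_id'] at this
  · intro S hS
    simp only [Nat.Partition.distincts, Finset.mem_filter, Finset.mem_univ, true_and]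
    exact S.nodup
  · intro S _ T _ h
    exact Finset.val_injective (congrArg Nat.Partition.parts h)
  · intro p hp
    simp only [Nat.Partition.distincts, Finset.mem_filter, Finset.mem_univ, true_and] at hp
    have hs : ∑ s ∈ (⟨p.parts, hp⟩ : Finset ℕ), s = n := by
      rw [Finset.sum_eq_multiset_sum, Multiset.map_id', p.parts_sum]
    refine ⟨⟨p.parts, hp⟩, Finset.mem_filter.2 ⟨mem_strictLE.2 ⟨?_, by omega⟩, hs⟩, rfl⟩
    intro h0
    exact (p.parts_pos h0).ne rfl

/-- Euler's theorem on odd and distinct parts. It is the dimension count that turns linear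
independence into spanning, in the Fock space as well as in `GΓ` and `gΓ`. -/
theorem card_wtLE_eq_card_strictLE (N : ℕ) : (wtLE N).card = (strictLE N).card := by
  rw [card_wtLE, card_strictLE]
  exact Finset.sum_congr rfl fun n _ => Nat.Partition.card_odds_eq_card_distincts n

theorem sum_erase_zero (S : Finset ℕ) : ∑ s ∈ S.erase 0, s = ∑ s ∈ S, s :=
  Finset.sum_erase S rfl

/-- Deleting `0` does not change the weight, and the even cardinality determines whether `0` has to
be restored. -/
theorem card_evenLE (N : ℕ) : (evenLE N).card = (strictLE N).card := by
  refine Finset.card_bij (fun S _ => S.erase 0) ?_ ?_ ?_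
  · intro S hS
    rw [mem_strictLE, sum_erase_zero]
    exact ⟨Finset.notMem_erase 0 S, (mem_evenLE.1 hS).2⟩
  · intro S hS T hT h
    have h1 := (mem_evenLE.1 hS).1
    have h2 := (mem_evenLE.1 hT).1
    by_cases hS0 : 0 ∈ S <;> by_cases hT0 : 0 ∈ T
    · rw [← Finset.insert_erase hS0, ← Finset.insert_erase hT0, h]
    · rw [Finset.erase_eq_of_notMem hT0] at h
      have h3 := Finset.card_erase_add_one hS0
      rw [h] at h3
      rw [← h3, Nat.even_add_one] at h1
      exact absurd h2 h1
    · rw [Finset.erase_eq_of_notMem hS0] at h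
      have h3 := Finset.card_erase_add_one hT0
      rw [← h] at h3
      rw [← h3, Nat.even_add_one] at h2
      exact absurd h1 h2
    · rwa [Finset.erase_eq_of_notMem hS0, Finset.erase_eq_of_notMem hT0] at h
  · intro T hT
    obtain ⟨h0, hN⟩ := mem_strictLE.1 hT
    by_cases he : Even T.card
    · exact ⟨T, mem_evenLE.2 ⟨he, hN⟩, Finset.erase_eq_of_notMem h0⟩
    · refine ⟨insert 0 T, mem_evenLE.2 ⟨?_, ?_⟩, Finset.erase_insert h0⟩
      · rw [Finset.card_insert_of_notMem h0, Nat.even_add_one]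
        exact he
      · rw [Finset.sum_insert h0, zero_add]
        exact hN

/-! ### Adjoints and the completeness of the Heisenberg monomials -/

/-- The square norm `2^{#(S \ {0})}` of the basis vector of `S`. -/
def ketNorm (k : Type*) [Field k] (S : Finset ℕ) : k := 2 ^ (S.erase 0).card

theorem ketNorm_ne_zero [CharZero k] (S : Finset ℕ) : ketNorm k S ≠ 0 :=
  pow_ne_zero _ two_ne_zero

/-- The largest index acts first and exceeds every element present at that moment, so no signs
arise. Each positive index contributes `(-1)^n * 2 * (-1)^n = 2` and the index `0` contributes `1`.
-/
theorem foldl_phiStar (L : List ℕ) (u : FockHat k) (T : Finset ℕ)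
    (hL : L.Pairwise fun a b => b < a) (hT : ∀ n ∈ L, ∀ t ∈ T, t < n) :
    L.foldl (fun (u : FockHat k) (n : ℕ) => phiStar (n : ℤ) u) u T =
      2 ^ (L.toFinset.erase 0).card * u (T ∪ L.toFinset) := by
  induction L generalizing u with
  | nil => simp
  | cons n L ih =>
    rw [List.pairwise_cons] at hL
    rw [List.foldl_cons, ih _ hL.2 fun m hm => hT m (List.mem_cons_of_mem _ hm)]
    have hlt : ∀ t ∈ T ∪ L.toFinset, t < n := by
      intro t ht
      rcases Finset.mem_union.1 ht with h | h
      · exact hT n List.mem_cons_self t h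
      · exact hL.1 t (List.mem_toFinset.1 h)
    have hn : n ∉ T ∪ L.toFinset := fun h => lt_irrefl _ (hlt n h)
    have hnL : n ∉ L.toFinset := fun h => hn (Finset.mem_union_right _ h)
    have hs : (sgnAbove n (T ∪ L.toFinset) : k) = 1 := by
      unfold sgnAbove
      rw [Finset.filter_false_of_mem, Finset.card_empty, pow_zero]
      intro t ht
      exact (hlt t ht).not_gt
    have hu : T ∪ (n :: L).toFinset = insert n (T ∪ L.toFinset) := by
      rw [List.toFinset_cons, Finset.union_insert]
    rw [hu]
    unfold phiStar
    rw [Pi.smul_apply, smul_eq_mul, phi_apply, psi_ket, map_smul, pair_ket, smul_eq_mul,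
      Int.natAbs_neg, Int.natAbs_natCast, toggle_of_notMem hn, hs]
    rcases Nat.eq_zero_or_pos n with rfl | hpos
    · simp [chi]
    · have h1 : ((n :: L).toFinset.erase 0).card = (L.toFinset.erase 0).card + 1 := by
        rw [List.toFinset_cons, Finset.erase_insert_of_ne hpos.ne',
          Finset.card_insert_of_notMem fun h => hnL (Finset.mem_of_mem_erase h)]
      rw [h1]
      have h2 : (-1 : k) ^ n * (-1) ^ n = 1 := by rw [← pow_add, ← two_mul, pow_mul]; simp
      simp only [chi, Int.natAbs_neg, Int.natAbs_natCast, hn, if_false]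
      rw [if_neg (by omega), if_pos (by omega), pow_succ]
      linear_combination (2 ^ (L.toFinset.erase 0).card * 2 * u (insert n (T ∪ L.toFinset))) * h2

theorem braBasis_eq (S : Finset ℕ) (v : FockHat k) : braBasis S v = ketNorm k S * v S := by
  rw [braBasis, foldl_phiStar, Finset.sort_toFinset, Finset.empty_union, ketNorm]
  · have h1 := Finset.pairwise_sort S fun a b => b ≤ a
    have h2 := Finset.sort_nodup S fun a b => b ≤ a
    exact h1.imp₂ (fun a b hab hne => lt_of_le_of_ne hab (Ne.symm hne)) h2
  · simp

/-- The operator multiplying each basis vector by its square norm. -/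
def normOp : Fock k →ₗ[k] Fock k :=
  Finsupp.linearCombination k fun S => ketNorm k S • ket S

theorem normOp_ket (S : Finset ℕ) : normOp (ket S : Fock k) = ketNorm k S • ket S := by
  simp [normOp, ket]

theorem normOp_apply (w : Fock k) (S : Finset ℕ) : normOp w S = ketNorm k S * w S := by
  suffices h : Finsupp.lapply S ∘ₗ normOp = ketNorm k S • (Finsupp.lapply S : Fock k →ₗ[k] k) from
    LinearMap.congr_fun h w
  refine linearMap_ext_ket fun T => ?_
  simp only [LinearMap.comp_apply, normOp_ket, map_smul, Finsupp.lapply_apply, ket_apply,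
    LinearMap.smul_apply, smul_eq_mul]
  by_cases h : T = S
  · rw [h]
  · simp [h]

theorem braket_eq (w : Fock k) (v : FockHat k) : braket w v = pair v (normOp w) := by
  have h : ∀ w : Fock k, pair v (normOp w) = w.sum fun S c => c * (ketNorm k S * v S) := by
    intro w
    have : (pair v ∘ₗ normOp : Fock k →ₗ[k] k) =
        Finsupp.linearCombination k fun S => ketNorm k S * v S := by
      refine linearMap_ext_ket fun S => ?_
      rw [LinearMap.comp_apply, normOp_ket, map_smul, pair_ket]
      simp [ket]
    rw [← LinearMap.comp_apply, this, Finsupp.linearCombination_apply]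
    rfl
  rw [h, braket]
  simp only [braBasis_eq]

/-- The symmetric bilinear form dual to the one of which `ketNorm` are the square norms. -/
def bilForm : Fock k →ₗ[k] Fock k →ₗ[k] k :=
  Finsupp.linearCombination k fun S => (ketNorm k S)⁻¹ • (Finsupp.lapply S : Fock k →ₗ[k] k)

theorem bilForm_ket (S : Finset ℕ) (y : Fock k) : bilForm (ket S) y = (ketNorm k S)⁻¹ * y S := by
  simp [bilForm, ket]

theorem bilForm_normOp [CharZero k] (w y : Fock k) : bilForm (normOp w) y = pair w y := by
  suffices h : bilForm ∘ₗ normOp = (Finsupp.linearCombination k fun S =>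
      (Finsupp.lapply S : Fock k →ₗ[k] k)) by
    have h1 := LinearMap.congr_fun (LinearMap.congr_fun h w) y
    rw [LinearMap.comp_apply] at h1
    rw [h1, pair_apply, Finsupp.linearCombination_apply, Finsupp.sum, Finsupp.sum,
      LinearMap.sum_apply]
    simp only [LinearMap.smul_apply, Finsupp.lapply_apply, smul_eq_mul]
    rw [Finset.sum_subset (Finset.subset_union_left (s₁ := w.support) (s₂ := y.support)),
      Finset.sum_subset (Finset.subset_union_right (s₁ := w.support) (s₂ := y.support))]
    · exact Finset.sum_congr rfl fun S _ => mul_comm _ _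
    · intro S _ hS
      rw [Finsupp.notMem_support_iff.1 hS, zero_mul]
    · intro S _ hS
      rw [Finsupp.notMem_support_iff.1 hS, zero_mul]
  refine linearMap_ext_ket fun S => LinearMap.ext fun y => ?_
  rw [LinearMap.comp_apply, normOp_ket, map_smul, LinearMap.smul_apply, bilForm_ket, smul_eq_mul,
    mul_inv_cancel_left₀ (ketNorm_ne_zero S)]
  simp [ket]

/-- The transposed fermions satisfy the same adjunction rule as the original ones, provided the
square norms are inverted. On basis vectors it reduces to `key`, the comparison of the norms of `S`
and of `S` with `|n|` toggled. -/
theorem bilForm_psi [CharZero k] (n : ℤ) (x y : Fock k) :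
    bilForm x (psi n y) = eps n * bilForm (psi (-n) x) y := by
  suffices h : ∀ S, bilForm x (psi n (ket S)) = eps n * bilForm (psi (-n) x) (ket S) by
    have h1 : bilForm x ∘ₗ psi n = (eps n : k) • bilForm (psi (-n) x) :=
      linearMap_ext_ket fun S => h S
    exact LinearMap.congr_fun h1 y
  intro S
  suffices h : ∀ T, bilForm (ket T) (psi n (ket S)) =
      (eps n : k) * bilForm (psi (-n) (ket T)) (ket S) by
    induction x using Finsupp.induction_linear with
    | zero => simp only [map_zero, LinearMap.zero_apply, mul_zero]
    | add x x' hx hx' => simp only [map_add, LinearMap.add_apply, mul_add, hx, hx']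
    | single T c =>
      have h1 : (Finsupp.single T c : Fock k) = c • ket T := by simp [ket]
      rw [h1]
      simp only [map_smul, LinearMap.smul_apply, smul_eq_mul, h T]
      ring
  intro T
  simp only [psi_ket, map_smul, bilForm_ket, smul_eq_mul, LinearMap.smul_apply, ket_apply,
    Int.natAbs_neg]
  by_cases h : symmDiff S {n.natAbs} = T
  · subst h
    rw [if_pos rfl, toggle_toggle, if_pos rfl, sgnAbove_toggle_of_le le_rfl]
    have key : (chi n S * ketNorm k S : k) = eps n * chi (-n) (symmDiff S {n.natAbs}) *
        ketNorm k (symmDiff S {n.natAbs}) := by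
      have ht : n.natAbs ∈ symmDiff S {n.natAbs} ↔ n.natAbs ∉ S := by
        rw [mem_toggle]; tauto
      have he := eps_mul_self (k := k) n
      rw [eps] at he
      rcases lt_trichotomy n 0 with h0 | h0 | h0
      · by_cases hS : n.natAbs ∈ S
        · simp [chi, ht, hS, h0, h0.not_gt]
        · have h1 : ketNorm k (symmDiff S {n.natAbs}) = 2 * ketNorm k S := by
            rw [toggle_of_notMem hS, ketNorm, Finset.erase_insert_of_ne (by omega),
              Finset.card_insert_of_notMem fun h => hS (Finset.mem_of_mem_erase h), pow_succ',
              ketNorm]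
          rw [h1]
          simp only [chi, ht, hS, h0, h0.not_gt, eps, Int.natAbs_neg]
          simp [h0]
          ring
      · subst h0
        have h1 : ketNorm k (symmDiff S {(0 : ℤ).natAbs}) = ketNorm k S := by
          unfold ketNorm
          congr 2
          ext x
          simp [Finset.mem_symmDiff]
          tauto
        rw [h1]
        simp [chi, eps]
      · by_cases hS : n.natAbs ∈ S
        · have h1 : ketNorm k S = 2 * ketNorm k (symmDiff S {n.natAbs}) := by
            conv_lhs => rw [← toggle_toggle S n.natAbs]
            have hS' : n.natAbs ∉ symmDiff S {n.natAbs} := by rw [ht]; exact not_not.2 hS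
            rw [toggle_of_notMem hS', ketNorm, Finset.erase_insert_of_ne (by omega),
              Finset.card_insert_of_notMem fun h => hS' (Finset.mem_of_mem_erase h), pow_succ',
              ketNorm]
          rw [h1]
          simp only [chi, ht, hS, h0, h0.not_gt, eps, Int.natAbs_neg]
          simp [h0, h0.not_gt]
          left
          linear_combination (-2 : k) * he
        · simp [chi, ht, hS, h0, h0.not_gt]
    have h1 := ketNorm_ne_zero (k := k) S
    have h2 := ketNorm_ne_zero (k := k) (symmDiff S {n.natAbs})
    field_simp
    linear_combination (sgnAbove n.natAbs S) * key
  · rw [if_neg h, if_neg]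
    · simp
    · rintro rfl
      exact h (toggle_toggle _ _)

/-- The adjoint reverses the two fermions, and the shift `i ↦ i + m` restores the form of the sum.
-/
theorem bilForm_heisT [CharZero k] {m : ℤ} (hm : m ≠ 0) (x y : Fock k) :
    bilForm x (heisT m y) = bilForm (heisT (-m) x) y := by
  rw [heisT_eq_finsum hm, heisT_eq_finsum (neg_ne_zero.2 hm), map_smul, map_smul,
    LinearMap.smul_apply]
  congr 1
  have h1 := (bilForm x).toAddMonoidHom.map_finsum (heisT_support_finite hm y)
  have h2 := (bilForm.flip y).toAddMonoidHom.map_finsum (heisT_support_finite (neg_ne_zero.2 hm) x)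
  refine h1.trans (Eq.trans ?_ h2.symm)
  refine finsum_eq_of_bijective (fun i => i + m) (Equiv.addRight m).bijective fun i => ?_
  simp only [LinearMap.toAddMonoidHom_coe, map_smul, LinearMap.flip_apply, smul_eq_mul,
    bilForm_psi]
  have e0 : (eps (-i - m) : k) = eps (i + m) := by rw [← eps_neg]; congr 1; ring
  have e1 : -(-i - m) = i + m := by ring
  have e2 : -(i + m) - -m = -i := by ring
  rw [e0, e1, e2]
  linear_combination (eps (i + m) * bilForm (psi (i + m) (psi (-i) x)) y) * eps_mul_self (k := k) i

/-- Adjoints reverse products, which is harmless because the generators commute. -/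
theorem bilForm_rho [CharZero k] (P : MvPolynomial ℕ k) (x y : Fock k) :
    bilForm x (rho P y) = bilForm (rhoNeg P x) y := by
  induction P using MvPolynomial.induction_on generalizing x y with
  | C c =>
    rw [← MvPolynomial.algebraMap_eq, AlgHom.commutes, AlgHom.commutes]
    simp
  | add p q hp hq => simp only [map_add, LinearMap.add_apply, hp, hq]
  | mul_X p j hp =>
    rw [map_mul, Module.End.mul_apply, hp, rho_X, bilForm_heisT (by omega), mul_comm p, map_mul,
      Module.End.mul_apply, rhoNeg_X, ← Module.End.mul_apply, ← rhoNeg_X, ← map_mul]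

/-- The vector `b_{-λ}|0⟩`, transposed. -/
def heisKet [CharZero k] (a : ℕ →₀ ℕ) : Fock k := rho (MvPolynomial.monomial a 1) (ket ∅)

theorem vacFun_monomial [CharZero k] (v : FockHat k) (a : ℕ →₀ ℕ) :
    vacFun v (MvPolynomial.monomial a 1) = pair v (heisKet a) := rfl

/-- Since annihilation monomials are dual to the `heisKet a` up to `normW`, this reads the
coefficients of `normOp w` in that basis as overlaps of `w`. -/
theorem pair_heisKet [CharZero k] (w : Fock k) (a : ℕ →₀ ℕ) :
    pair w (heisKet a) = rhoNeg (MvPolynomial.monomial a 1) (normOp w) ∅ := by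
  have h1 := bilForm_rho (MvPolynomial.monomial a 1) (normOp w) (ket ∅)
  rw [bilForm_normOp] at h1
  rw [heisKet, h1]
  have h2 : ∀ x : Fock k, bilForm x (ket ∅) = x ∅ := by
    intro x
    have : bilForm.flip (ket ∅) = (Finsupp.lapply ∅ : Fock k →ₗ[k] k) := by
      refine linearMap_ext_ket fun S => ?_
      rw [LinearMap.flip_apply, bilForm_ket, Finsupp.lapply_apply, ket_apply, ket_apply]
      by_cases h : S = ∅
      · subst h; simp [ketNorm]
      · simp [h, Ne.symm h]
    exact LinearMap.congr_fun this x
  exact h2 _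

theorem rhoNeg_heisKet [CharZero k] (a b : ℕ →₀ ℕ) :
    rhoNeg (MvPolynomial.monomial a 1) (heisKet b : Fock k) ∅ = if a = b then normW k a else 0 :=
  rhoNeg_rho_vac a b

theorem heisKet_support [CharZero k] {a : ℕ →₀ ℕ} {S : Finset ℕ} (h : (heisKet a : Fock k) S ≠ 0) :
    Even S.card ∧ ∑ s ∈ S, s = wt a := by
  have := isHomog_rho (isHomog_ket (k := k) ∅) a S h
  simp only [Finset.sum_empty, Finset.card_empty, Even.zero, iff_true] at this
  refine ⟨this.2, ?_⟩
  simpa using (by exact_mod_cast this.1 : ∑ s ∈ S, s = 0 + wt a)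

/-- The vectors `heisKet a` span the even part of the Fock space. -/
theorem exists_sum_heisKet [CharZero k] {w : Fock k} (hw : IsEven (w : FockHat k)) {D : ℕ}
    (hD : (w : FockHat k) ∈ weightLE k D) :
    ∃ c : (ℕ →₀ ℕ) → k, w = ∑ a ∈ wtLE D, c a • heisKet a := by
  let M : (wtLE D → k) →ₗ[k] (evenLE D → k) :=
    { toFun := fun c S => (∑ a, c a • heisKet (a : ℕ →₀ ℕ) : Fock k) S
      map_add' := fun c c' => by
        funext S
        simp [add_mul, Finset.sum_add_distrib]
      map_smul' := fun r c => by
        funext S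
        simp [Finset.mul_sum, mul_assoc] }
  have hsupp : ∀ (c : wtLE D → k) (S : Finset ℕ), S ∉ evenLE D →
      (∑ a, c a • heisKet (a : ℕ →₀ ℕ) : Fock k) S = 0 := by
    intro c S hS
    rw [Finsupp.finsetSum_apply]
    refine Finset.sum_eq_zero fun a _ => ?_
    by_contra hne
    have h1 : (heisKet (a : ℕ →₀ ℕ) : Fock k) S ≠ 0 := fun h => hne (by simp [h])
    obtain ⟨h2, h3⟩ := heisKet_support h1
    have h4 := mem_wtLE.1 a.2
    exact hS (mem_evenLE.2 ⟨h2, by omega⟩)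
  -- Independence: the annihilation monomial of `b` isolates the coefficient of `heisKet b`, because
  -- the Gram matrix is diagonal with nonzero entries.
  have hinj : Function.Injective M := by
    rw [injective_iff_map_eq_zero]
    intro c hc
    have h0 : (∑ a, c a • heisKet (a : ℕ →₀ ℕ) : Fock k) = 0 := by
      ext S
      by_cases hS : S ∈ evenLE D
      · exact congrFun hc ⟨S, hS⟩
      · exact hsupp c S hS
    funext b
    have h1 := congrArg (fun x => rhoNeg (MvPolynomial.monomial (b : ℕ →₀ ℕ) 1) x ∅) h0
    simp only [map_sum, map_smul, map_zero, Finsupp.finsetSum_apply, Finsupp.smul_apply,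
      rhoNeg_heisKet, smul_eq_mul, Finsupp.zero_apply, mul_ite, mul_zero] at h1
    rw [Finset.sum_eq_single b] at h1
    · rw [if_pos rfl] at h1
      exact (mul_eq_zero.1 h1).resolve_right (normW_ne_zero _)
    · intro a _ hab
      rw [if_neg fun h => hab (Subtype.ext h.symm)]
    · simp
  -- Both sides have the same finite dimension by Euler's theorem.
  have hsurj : Function.Surjective M := by
    refine (LinearMap.injective_iff_surjective_of_finrank_eq_finrank ?_).1 hinj
    rw [Module.finrank_fintype_fun_eq_card, Module.finrank_fintype_fun_eq_card, Fintype.card_coe,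
      Fintype.card_coe, card_evenLE, card_wtLE_eq_card_strictLE]
  obtain ⟨c, hc⟩ := hsurj fun S => w S
  refine ⟨fun a => if h : a ∈ wtLE D then c ⟨a, h⟩ else 0, ?_⟩
  have h1 : ∑ a ∈ wtLE D, (if h : a ∈ wtLE D then c ⟨a, h⟩ else 0) • (heisKet a : Fock k) =
      ∑ a, c a • heisKet (a : ℕ →₀ ℕ) := by
    rw [← Finset.sum_coe_sort (wtLE D)]
    refine Finset.sum_congr rfl fun a _ => ?_
    rw [dif_pos a.2]
  rw [h1]
  ext S
  by_cases hS : S ∈ evenLE D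
  · exact (congrFun hc ⟨S, hS⟩).symm
  · rw [hsupp c S hS]
    by_contra hne
    exact hS (mem_evenLE.2 ⟨hw S hne, hD S hne⟩)

/-- Parseval's formula in the Fock space. -/
theorem braket_eq_sum [CharZero k] {w : Fock k} {D : ℕ} (hD : (w : FockHat k) ∈ weightLE k D)
    (v : FockHat k) (h : IsEven v ∨ IsEven (w : FockHat k)) :
    braket w v = ∑ a ∈ wtLE D, (normW k a)⁻¹ * pair v (heisKet a) * pair w (heisKet a) := by
  have heven : ∀ (w : Fock k), (w : FockHat k) ∈ weightLE k D → IsEven (w : FockHat k) →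
      braket w v = ∑ a ∈ wtLE D, (normW k a)⁻¹ * pair v (heisKet a) * pair w (heisKet a) := by
    intro w hD hw
    -- Rescaling basis vectors preserves parity and weight, so `normOp w` expands in the `heisKet
    -- a`; its coefficients are then found by orthogonality.
    obtain ⟨c, hc⟩ := exists_sum_heisKet (w := normOp w) (D := D)
      (fun S hS => hw S fun h => hS (by rw [normOp_apply, h, mul_zero]))
      (fun S hS => hD S fun h => hS (by rw [normOp_apply, h, mul_zero]))
    rw [braket_eq, hc, map_sum]
    refine Finset.sum_congr rfl fun b hb => ?_
    have h1 := pair_heisKet w b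
    rw [hc] at h1
    simp only [map_sum, map_smul, Finsupp.finsetSum_apply, Finsupp.smul_apply,
      rhoNeg_heisKet, smul_eq_mul, mul_ite, mul_zero] at h1
    rw [Finset.sum_ite_eq, if_pos hb] at h1
    rw [h1, map_smul, smul_eq_mul]
    have := normW_ne_zero (k := k) b
    field_simp
  rcases h with hv | hw
  -- If only `v` is even, the odd part of `w` contributes to neither side, since the vectors
  -- `heisKet a` are even too.
  · set w' : Fock k := w.filter fun S => Even S.card with hw'
    have hw'S : ∀ S, w' S = if Even S.card then w S else 0 := fun S => Finsupp.filter_apply ..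
    have h1 : braket w v = braket w' v := by
      rw [braket_eq, braket_eq, ← sub_eq_zero, ← map_sub]
      refine pair_eq_zero fun S hS => ?_
      by_contra hne
      refine hS ?_
      rw [Finsupp.sub_apply, normOp_apply, normOp_apply, hw'S, if_pos (hv S hne), sub_self]
    have h2 : ∀ a, pair w (heisKet a : Fock k) = pair w' (heisKet a) := by
      intro a
      rw [pair_apply, pair_apply]
      refine Finsupp.sum_congr fun S hS => ?_
      rw [hw'S, if_pos (heisKet_support (Finsupp.mem_support_iff.1 hS)).1]
    rw [h1, heven w']
    · simp only [h2]
    · intro S hS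
      rw [hw'S] at hS
      refine hD S fun h => hS (by simp [h])
    · intro S hS
      rw [hw'S] at hS
      by_contra h
      exact hS (if_neg h)
  · exact heven w hD hw

/-! ### The ring `GΓ` -/

theorem IsSymm.mul {f g : MvPowerSeries ℕ k} (hf : IsSymm f) (hg : IsSymm g) : IsSymm (f * g) := by
  intro s d
  rw [MvPowerSeries.coeff_mul, MvPowerSeries.coeff_mul]
  symm
  refine Finset.sum_bij' (fun p _ => (p.1.equivMapDomain s, p.2.equivMapDomain s))
    (fun p _ => (p.1.equivMapDomain s.symm, p.2.equivMapDomain s.symm)) ?_ ?_ ?_ ?_ ?_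
  · rintro ⟨a, b⟩ h
    rw [Finset.HasAntidiagonal.mem_antidiagonal] at h ⊢
    rw [← h]
    ext i
    simp
  · rintro ⟨a, b⟩ h
    rw [Finset.HasAntidiagonal.mem_antidiagonal] at h ⊢
    ext i
    have := DFunLike.congr_fun h (s i)
    simpa using this
  · rintro ⟨a, b⟩ h
    ext i <;> simp
  · rintro ⟨a, b⟩ h
    ext i <;> simp
  · rintro ⟨a, b⟩ h
    rw [hf, hg]

theorem isSymm_C (c : k) : IsSymm (MvPowerSeries.C c : MvPowerSeries ℕ k) := by
  intro s d
  rw [MvPowerSeries.coeff_C, MvPowerSeries.coeff_C]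
  refine if_congr ⟨fun h => ?_, fun h => ?_⟩ rfl rfl
  · ext i
    have := DFunLike.congr_fun h (s i)
    simpa using this
  · subst h
    ext i
    simp

theorem isSymm_sumVars {φ : PowerSeries k} (h0 : PowerSeries.coeff 0 φ = 0) :
    IsSymm (sumVars id φ : MvPowerSeries ℕ k) := by
  intro s d
  by_cases h : ∃ i n, n ≠ 0 ∧ d = Finsupp.single i n
  · obtain ⟨i, n, hn, rfl⟩ := h
    rw [Finsupp.equivMapDomain_single]
    exact (coeff_sumVars_single Function.injective_id φ (s i) hn).trans
      (coeff_sumVars_single Function.injective_id φ i hn).symm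
  · push Not at h
    rw [coeff_sumVars_of_ne (e := id) (d := d) h0 h, coeff_sumVars_of_ne (e := id) h0]
    intro i n hn hd
    refine h (s.symm i) n hn ?_
    have hd' : d.equivMapDomain s = Finsupp.single i n := hd
    rw [← Finsupp.equivMapDomain_single, ← hd', ← Finsupp.equivMapDomain_trans]
    simp

/-- `GΓ` as a ring. -/
def GGammaAlg (β : k) : Subalgebra k (MvPowerSeries ℕ k) where
  carrier := {f | f ∈ GGamma β}
  mul_mem' := by
    rintro f g ⟨hf, hf'⟩ ⟨hg, hg'⟩
    refine ⟨hf.mul hg, fun d hd => ?_⟩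
    rw [MvPowerSeries.subst_mul (hasSubst_cancelSubst β), MvPowerSeries.coeff_mul]
    refine Finset.sum_eq_zero fun p hp => ?_
    rw [Finset.HasAntidiagonal.mem_antidiagonal] at hp
    by_cases h : p.1 0 = 0
    · rw [hg' p.2, mul_zero]
      intro h2
      exact hd (by rw [← hp, Finsupp.add_apply, h, h2])
    · rw [hf' p.1 h, zero_mul]
  add_mem' := fun hf hg => (GGamma β).add_mem hf hg
  algebraMap_mem' := by
    classical
    intro c
    refine ⟨isSymm_C c, fun d hd => ?_⟩
    rw [← MvPowerSeries.coe_substAlgHom (hasSubst_cancelSubst β), AlgHom.commutes]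
    change MvPowerSeries.coeff d (MvPowerSeries.C c) = 0
    rw [MvPowerSeries.coeff_C, if_neg]
    rintro rfl
    exact hd rfl

theorem mem_GGammaAlg {β : k} {f : MvPowerSeries ℕ k} : f ∈ GGammaAlg β ↔ f ∈ GGamma β := Iff.rfl

theorem xPar_mul (β : k) : xPar β * (1 + PowerSeries.C (β / 2) * PowerSeries.X) =
    PowerSeries.X := by
  rw [xPar, mul_assoc, PowerSeries.inv_mul_cancel, mul_one]
  simp

theorem subst_xPar_mul {σ : Type*} (β : k) {a : MvPowerSeries σ k}
    (ha : MvPowerSeries.constantCoeff a = 0) :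
    PowerSeries.subst a (xPar β) * (1 + MvPowerSeries.C (β / 2) * a) = a := by
  have hs : PowerSeries.HasSubst a := PowerSeries.HasSubst.of_constantCoeff_zero ha
  have h := congrArg (PowerSeries.subst a) (xPar_mul β)
  rw [PowerSeries.subst_mul hs, PowerSeries.subst_add hs, PowerSeries.subst_mul hs,
    PowerSeries.subst_X hs, PowerSeries.subst_C] at h
  rw [← PowerSeries.coe_substAlgHom hs, map_one, PowerSeries.coe_substAlgHom hs] at h
  exact h

/-- `x / (1 + β x / 2)` changes its sign under `x ↦ - x / (1 + β x)`. -/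
theorem subst_bar_xPar [CharZero k] {σ : Type*} (β : k) (s : σ) :
    PowerSeries.subst (-(MvPowerSeries.X s * (1 + MvPowerSeries.C β * MvPowerSeries.X s)⁻¹))
      (xPar β) = -PowerSeries.subst (MvPowerSeries.X (R := k) s) (xPar β) := by
  set t : MvPowerSeries σ k := MvPowerSeries.X s with ht
  set u : MvPowerSeries σ k := 1 + MvPowerSeries.C β * t with hu
  have ht0 : MvPowerSeries.constantCoeff t = 0 := by simp [ht]
  have hu0 : MvPowerSeries.constantCoeff u = 1 := by simp [hu, ht0]
  have huu : u⁻¹ * u = 1 := MvPowerSeries.inv_mul_cancel _ (by rw [hu0]; exact one_ne_zero)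
  have h1 := subst_xPar_mul β ht0
  have h2 := subst_xPar_mul (σ := σ) (a := -(t * u⁻¹)) β (by simp [ht0])
  set P := PowerSeries.subst t (xPar β)
  set Q := PowerSeries.subst (-(t * u⁻¹)) (xPar β)
  have hβ : MvPowerSeries.C β = (2 : MvPowerSeries σ k) * MvPowerSeries.C (β / 2) := by
    rw [two_mul, ← map_add, add_halves]
  have h3 : (Q + P) * (1 + MvPowerSeries.C (β / 2) * t) = 0 := by
    have h4 : Q * (u - MvPowerSeries.C (β / 2) * t) = -t := by
      linear_combination u * h2 + (Q * MvPowerSeries.C (β / 2) * t - t) * huu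
    have h5 : u - MvPowerSeries.C (β / 2) * t = 1 + MvPowerSeries.C (β / 2) * t := by
      rw [hu, hβ]; ring
    rw [h5] at h4
    linear_combination h4 + h1
  have h6 : (1 + MvPowerSeries.C (β / 2) * t : MvPowerSeries σ k) ≠ 0 := by
    intro h
    have := congrArg MvPowerSeries.constantCoeff h
    simp [ht0] at this
  exact eq_neg_of_add_eq_zero_left ((mul_eq_zero.1 h3).resolve_right h6)

theorem sumVars_eq_add {φ : PowerSeries k} (h0 : PowerSeries.coeff 0 φ = 0) :
    (sumVars id φ : MvPowerSeries ℕ k) = PowerSeries.subst (MvPowerSeries.X (R := k) 0) φ +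
      PowerSeries.subst (MvPowerSeries.X (R := k) 1) φ + sumVars (fun i => i + 2) φ := by
  ext d
  have hc : ∀ i : ℕ, MvPowerSeries.coeff d (PowerSeries.subst (MvPowerSeries.X (R := k) i) φ) ≠ 0 →
      d i ≠ 0 := by
    intro i hi h
    rw [coeff_subst_X] at hi
    split_ifs at hi
    · exact hi (by rw [h, h0])
    · exact hi rfl
  rw [map_add, map_add]
  change ∑ᶠ i : ℕ, _ = _ + _ + ∑ᶠ i : ℕ, _
  have hfin : ∀ e : ℕ → ℕ, Function.Injective e → (Function.support fun i : ℕ =>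
      MvPowerSeries.coeff d (PowerSeries.subst (MvPowerSeries.X (R := k) (e i)) φ)).Finite := by
    intro e he
    refine Set.Finite.subset (d.support.finite_toSet.preimage he.injOn) fun i hi => ?_
    exact Finsupp.mem_support_iff.2 (hc _ hi)
  rw [finsum_eq_sum_of_support_subset _ (s := (Finset.range (d.support.sup id + 3)))
      (fun i hi => ?_), finsum_eq_sum_of_support_subset _
      (s := (Finset.range (d.support.sup id + 1))) (fun i hi => ?_), Finset.sum_range_succ',
    Finset.sum_range_succ']
  · simp only [id]
    ring
  · have h1 := Finset.le_sup (f := id) (Finsupp.mem_support_iff.2 (hc _ hi))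
    simp only [id] at h1
    rw [Finset.coe_range, Set.mem_Iio]
    omega
  · have h1 := Finset.le_sup (f := id) (Finsupp.mem_support_iff.2 (hc _ hi))
    simp only [id] at h1
    rw [Finset.coe_range, Set.mem_Iio]
    omega

/-- At `x₂ = t̄` the quantity `x/(1+βx/2)` changes its sign, so the odd powers coming from the first
two variables cancel, and the remaining terms do not contain `t`. -/
theorem powerSumPar_mem [CharZero k] (β : k) {n : ℕ} (hn : Odd n) :
    powerSumPar β n ∈ GGamma β := by
  obtain ⟨m, rfl⟩ := hn
  have h0 := coeff_zero_xPar_pow β (2 * m)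
  refine ⟨isSymm_sumVars h0, fun d hd => ?_⟩
  change MvPowerSeries.coeff d (MvPowerSeries.subst _ (sumVars id (xPar β ^ (2 * m + 1)))) = 0
  have hA := hasSubst_cancelSubst β
  have hX : ∀ i : ℕ, MvPowerSeries.subst (cancelSubst β)
      (PowerSeries.subst (MvPowerSeries.X (R := k) i) (xPar β ^ (2 * m + 1))) =
      PowerSeries.subst (cancelSubst β i) (xPar β) ^ (2 * m + 1) := by
    intro i
    have hs : PowerSeries.HasSubst (cancelSubst β i) :=
      PowerSeries.HasSubst.of_constantCoeff_zero (by unfold cancelSubst; split_ifs <;> simp)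
    rw [← PowerSeries.subst_pow hs, PowerSeries.subst_def, PowerSeries.subst_def,
      MvPowerSeries.subst_comp_subst_apply (PowerSeries.HasSubst.X i).const hA]
    simp only [MvPowerSeries.subst_X hA]
  rw [sumVars_eq_add h0, MvPowerSeries.subst_add hA, MvPowerSeries.subst_add hA, hX, hX, map_add]
  have h1 : PowerSeries.subst (cancelSubst β 1) (xPar β) =
      -PowerSeries.subst (cancelSubst β 0) (xPar β) := by
    have := subst_bar_xPar (k := k) β (0 : ℕ)
    simpa [cancelSubst] using this
  rw [h1, Odd.neg_pow (odd_two_mul_add_one m), add_neg_cancel, map_zero, zero_add,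
    MvPowerSeries.coeff_subst hA]
  refine finsum_eq_zero_of_forall_eq_zero fun e => ?_
  by_cases he : ∃ i n, n ≠ 0 ∧ e = Finsupp.single (i + 2) n
  · obtain ⟨i, n, hn, rfl⟩ := he
    rw [Finsupp.prod_single_index (h := fun s n => cancelSubst β s ^ n) (pow_zero _)]
    have h2 : cancelSubst β (i + 2) = MvPowerSeries.X (i + 2) := by simp [cancelSubst]
    rw [h2, MvPowerSeries.coeff_X_pow, if_neg, smul_zero]
    rintro rfl
    simp at hd
  · push Not at he
    rw [coeff_sumVars_of_ne h0 he, zero_smul]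

theorem pPar_mem [CharZero k] (β : k) {lam : Multiset ℕ} (h : IsOddPartition lam) :
    pPar β lam ∈ GGamma β := by
  rw [← mem_GGammaAlg]
  refine Subalgebra.multiset_prod_mem _ fun f hf => ?_
  obtain ⟨n, hn, rfl⟩ := Multiset.mem_map.1 hf
  exact powerSumPar_mem β (h n hn)

/-- The product `p_λ^{(β)}` for the odd partition with exponent vector `a`. -/
theorem pPar_oddParts (β : k) (a : ℕ →₀ ℕ) :
    pPar β (oddParts a) = a.prod fun i n => powerSumPar β (2 * i + 1) ^ n :=
  prod_map_oddParts _ a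

theorem pBrk_oddParts (β : k) (a : ℕ →₀ ℕ) :
    pBrk β (oddParts a) = a.prod fun i n => powerSumBrk β (2 * i + 1) ^ n :=
  prod_map_oddParts _ a

/-- `∑_λ c_λ p_λ^{(β)}`, summed over all odd partitions. -/
def parSum (β : k) (c : MvPowerSeries ℕ k) : MvPowerSeries ℕ k :=
  MvPowerSeries.subst (fun i => powerSumPar β (2 * i + 1)) c

theorem hasSubst_powerSumPar (β : k) :
    MvPowerSeries.HasSubst fun i => powerSumPar β (2 * i + 1) :=
  hasSubst_xPar Function.injective_id β

theorem coeff_parSum (β : k) (c : MvPowerSeries ℕ k) (d : ℕ →₀ ℕ) :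
    MvPowerSeries.coeff d (parSum β c) = ∑ᶠ a, MvPowerSeries.coeff a c *
      MvPowerSeries.coeff d (pPar β (oddParts a)) := by
  rw [parSum, MvPowerSeries.coeff_subst (hasSubst_powerSumPar β)]
  simp only [pPar_oddParts, smul_eq_mul]

/-- Both conditions are linear conditions on single coefficients, and each coefficient of the
infinite sum only involves finitely many of the products. -/
theorem parSum_mem [CharZero k] (β : k) (c : MvPowerSeries ℕ k) : parSum β c ∈ GGamma β := by
  have hA := hasSubst_cancelSubst β
  refine ⟨fun s d => ?_, fun d hd => ?_⟩
  · rw [coeff_parSum, coeff_parSum]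
    refine finsum_congr fun a => ?_
    rw [(pPar_mem β (isOddPartition_oddParts a)).1 s d]
  · have hB := hasSubst_powerSumPar β
    rw [parSum, MvPowerSeries.subst_comp_subst_apply hB hA, MvPowerSeries.coeff_subst]
    · refine finsum_eq_zero_of_forall_eq_zero fun a => ?_
      have h := (pPar_mem β (isOddPartition_oddParts a)).2 d hd
      rw [pPar_oddParts, ← MvPowerSeries.coe_substAlgHom hA, Finsupp.prod, map_prod] at h
      simp only [map_pow, MvPowerSeries.coe_substAlgHom] at h
      rw [Finsupp.prod, h, smul_zero]
    · have := hB.comp hA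
      simpa only [MvPowerSeries.coe_substAlgHom] using this

/-! ### The ring `gΓ` -/

/-- The exponents of `x₃, x₄, …`. -/
def tailPart (a : ℕ →₀ ℕ) : ℕ →₀ ℕ := (a.erase 0).erase 1

theorem tailPart_add (a b : ℕ →₀ ℕ) : tailPart (a + b) = tailPart a + tailPart b := by
  simp [tailPart, Finsupp.erase_add]

theorem tailPart_apply (a : ℕ →₀ ℕ) (i : ℕ) :
    tailPart a i = if i = 1 then 0 else if i = 0 then 0 else a i := by
  simp only [tailPart, Finsupp.erase_apply]

theorem head_add_tailPart (a : ℕ →₀ ℕ) :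
    Finsupp.single 0 (a 0) + Finsupp.single 1 (a 1) + tailPart a = a := by
  ext i
  simp only [Finsupp.add_apply, tailPart_apply, Finsupp.single_apply]
  rcases i with _ | _ | i <;> simp

theorem tailPart_head_add (i j : ℕ) {e : ℕ →₀ ℕ} (h0 : e 0 = 0) (h1 : e 1 = 0) :
    tailPart (Finsupp.single 0 i + Finsupp.single 1 j + e) = e := by
  ext n
  simp only [Finsupp.add_apply, tailPart_apply, Finsupp.single_apply]
  rcases n with _ | _ | n <;> simp [h0, h1]

theorem head_add_zero (i j : ℕ) {e : ℕ →₀ ℕ} (h0 : e 0 = 0) :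
    (Finsupp.single 0 i + Finsupp.single 1 j + e : ℕ →₀ ℕ) 0 = i := by
  simp [h0]

theorem head_add_one (i j : ℕ) {e : ℕ →₀ ℕ} (h1 : e 1 = 0) :
    (Finsupp.single 0 i + Finsupp.single 1 j + e : ℕ →₀ ℕ) 1 = j := by
  simp [h1]

/-- The value of `x₁^{a₁} x₂^{a₂}` at `x₁ = t`, `x₂ = -t-β`. -/
def headValue (β : k) (a : ℕ →₀ ℕ) : Polynomial k :=
  Polynomial.X ^ a 0 * (-Polynomial.X - Polynomial.C β) ^ a 1

theorem headValue_add (β : k) (a b : ℕ →₀ ℕ) :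
    headValue β (a + b) = headValue β a * headValue β b := by
  simp only [headValue, Finsupp.add_apply, pow_add]
  ring

theorem dualCancelCoeff_eq_sum (β : k) {f : MvPowerSeries ℕ k} {e : ℕ →₀ ℕ} (h0 : e 0 = 0)
    (h1 : e 1 = 0) {U : Finset (ℕ →₀ ℕ)}
    (hU : ∀ a, MvPowerSeries.coeff a f ≠ 0 → tailPart a = e → a ∈ U) :
    dualCancelCoeff β f e = ∑ a ∈ U with tailPart a = e,
      Polynomial.C (MvPowerSeries.coeff a f) * headValue β a := by
  have h2 : dualCancelCoeff β f e = ∑ᶠ a : ℕ →₀ ℕ, if tailPart a = e then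
      Polynomial.C (MvPowerSeries.coeff a f) * headValue β a else 0 := by
    rw [finsum_of_injective (g := fun ij : ℕ × ℕ =>
      (Finsupp.single 0 ij.1 + Finsupp.single 1 ij.2 + e : ℕ →₀ ℕ))]
    · refine finsum_congr fun ij => ?_
      rw [if_pos (tailPart_head_add _ _ h0 h1), headValue, head_add_zero _ _ h0,
        head_add_one _ _ h1]
    · rintro ⟨i, j⟩ ⟨i', j'⟩ h
      have h3 := DFunLike.congr_fun h 0
      have h4 := DFunLike.congr_fun h 1
      simp only [head_add_zero _ _ h0, head_add_one _ _ h1] at h3 h4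
      rw [h3, h4]
    · intro a ha
      rw [if_neg]
      rintro rfl
      exact ha ⟨(a 0, a 1), head_add_tailPart a⟩
  rw [h2, finsum_eq_sum_of_support_subset _ (s := U), Finset.sum_filter]
  intro a ha
  by_contra hne
  refine ha ?_
  beta_reduce
  split_ifs with h
  · have : MvPowerSeries.coeff a f = 0 := by
      by_contra h3
      exact hne (hU a h3 h)
    rw [this, map_zero, zero_mul]
  · rfl

theorem apply_le_degree (a : ℕ →₀ ℕ) (i : ℕ) : a i ≤ a.degree := by
  by_cases h : i ∈ a.support
  · exact Finset.single_le_sum (f := fun i => a i) (fun _ _ => Nat.zero_le _) h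
  · rw [Finsupp.notMem_support_iff.1 h]; exact Nat.zero_le _

theorem mem_Iic_of_tailPart_le {D : ℕ} {e a : ℕ →₀ ℕ} (ha : a.degree ≤ D) (h : tailPart a ≤ e) :
    a ∈ Finset.Iic (Finsupp.single 0 D + Finsupp.single 1 D + e) := by
  rw [Finset.mem_Iic]
  intro i
  have h1 := h i
  have h2 := apply_le_degree a i
  simp only [tailPart_apply] at h1
  simp only [Finsupp.add_apply, Finsupp.single_apply]
  have h3 : a 1 ≤ a.degree := apply_le_degree a 1
  rcases i with _ | _ | i <;> simp at h1 ⊢ <;> omega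

theorem IsBounded.mul {f g : MvPowerSeries ℕ k} (hf : IsBounded f) (hg : IsBounded g) :
    IsBounded (f * g) := by
  obtain ⟨D, hD⟩ := hf
  obtain ⟨E, hE⟩ := hg
  refine ⟨D + E, fun d hd => ?_⟩
  rw [MvPowerSeries.coeff_mul] at hd
  obtain ⟨p, hp, hne⟩ := Finset.exists_ne_zero_of_sum_ne_zero hd
  rw [Finset.HasAntidiagonal.mem_antidiagonal] at hp
  have h1 := hD _ (left_ne_zero_of_mul hne)
  have h2 := hE _ (right_ne_zero_of_mul hne)
  rw [← hp, map_add]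
  omega

/-- Evaluation of the first two variables at `t` and `-t-β` is multiplicative. Both sides are
rewritten as one sum over pairs of exponent vectors whose tails add up to `e`, inside a box `U` that
contains all contributing exponents because the degrees are bounded. -/
theorem dualCancelCoeff_mul (β : k) {f g : MvPowerSeries ℕ k} (hf : IsBounded f)
    (hg : IsBounded g) {e : ℕ →₀ ℕ} (h0 : e 0 = 0) (h1 : e 1 = 0) :
    dualCancelCoeff β (f * g) e = ∑ p ∈ Finset.HasAntidiagonal.antidiagonal e,
      dualCancelCoeff β f p.1 * dualCancelCoeff β g p.2 := by
  classical
  obtain ⟨D, hD⟩ := hf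
  obtain ⟨E, hE⟩ := hg
  set b := Finsupp.single 0 (D + E) + Finsupp.single 1 (D + E) + e with hb
  set U := Finset.Iic b with hU
  set U2 := Finset.Iic (b + b)
  have hUf : ∀ a, MvPowerSeries.coeff a f ≠ 0 → tailPart a ≤ e → a ∈ U := fun a ha hle =>
    mem_Iic_of_tailPart_le ((hD a ha).trans (Nat.le_add_right D E)) hle
  have hUg : ∀ a, MvPowerSeries.coeff a g ≠ 0 → tailPart a ≤ e → a ∈ U := fun a ha hle =>
    mem_Iic_of_tailPart_le ((hE a ha).trans (Nat.le_add_left E D)) hle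
  set G : (ℕ →₀ ℕ) × (ℕ →₀ ℕ) → Polynomial k := fun p =>
    (Polynomial.C (MvPowerSeries.coeff p.1 f) * headValue β p.1) *
      (Polynomial.C (MvPowerSeries.coeff p.2 g) * headValue β p.2) with hG
  have hle : ∀ p : (ℕ →₀ ℕ) × (ℕ →₀ ℕ), tailPart (p.1 + p.2) = e → G p ≠ 0 → p ∈ U ×ˢ U := by
    rintro ⟨a, c⟩ ht hne
    rw [tailPart_add] at ht
    have hf0 : MvPowerSeries.coeff a f ≠ 0 := fun h => hne (by simp [hG, h])
    have hg0 : MvPowerSeries.coeff c g ≠ 0 := fun h => hne (by simp [hG, h])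
    exact Finset.mk_mem_product (hUf _ hf0 (ht ▸ le_self_add)) (hUg _ hg0 (ht ▸ le_add_self))
  have hmaps : ∀ p ∈ U ×ˢ U, p.1 + p.2 ∈ U2 := by
    intro p hp
    rw [Finset.mem_product, Finset.mem_Iic, Finset.mem_Iic] at hp
    exact Finset.mem_Iic.2 (add_le_add hp.1 hp.2)
  have hL : dualCancelCoeff β (f * g) e = ∑ p ∈ U ×ˢ U with tailPart (p.1 + p.2) = e, G p := by
    rw [dualCancelCoeff_eq_sum β h0 h1 (U := U2)]
    · rw [← Finset.sum_fiberwise_of_maps_to (s := (U ×ˢ U).filter _)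
        (t := U2.filter fun a => tailPart a = e) (g := fun p => p.1 + p.2)
        (fun p hp => Finset.mem_filter.2 ⟨hmaps p (Finset.mem_filter.1 hp).1,
          (Finset.mem_filter.1 hp).2⟩)]
      refine Finset.sum_congr rfl fun a ha => ?_
      rw [Finset.mem_filter] at ha
      rw [MvPowerSeries.coeff_mul, map_sum, Finset.sum_mul]
      symm
      refine Finset.sum_subset_zero_on_sdiff ?_ ?_ ?_
      · intro p hp
        rw [Finset.mem_filter] at hp
        exact Finset.HasAntidiagonal.mem_antidiagonal.2 hp.2
      · intro p hp
        rw [Finset.mem_sdiff, Finset.HasAntidiagonal.mem_antidiagonal, Finset.mem_filter,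
          Finset.mem_filter] at hp
        obtain ⟨hp1, hp2⟩ := hp
        have : G p = 0 := by
          by_contra hne
          have ht : tailPart (p.1 + p.2) = e := by rw [hp1]; exact ha.2
          exact hp2 ⟨⟨hle p ht hne, ht⟩, hp1⟩
        rw [← this, hG, ← hp1, headValue_add, map_mul]
        ring
      · intro p hp
        rw [Finset.mem_filter] at hp
        rw [← hp.2, headValue_add, map_mul, hG]
        ring
    · intro a ha ht
      rw [MvPowerSeries.coeff_mul] at ha
      obtain ⟨p, hp, hne⟩ := Finset.exists_ne_zero_of_sum_ne_zero ha
      rw [Finset.HasAntidiagonal.mem_antidiagonal] at hp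
      rw [← hp] at ht ⊢
      refine hmaps p (Finset.mk_mem_product (hUf _ (left_ne_zero_of_mul hne) ?_)
        (hUg _ (right_ne_zero_of_mul hne) ?_))
      · rw [← ht, tailPart_add]; exact le_self_add
      · rw [← ht, tailPart_add]; exact le_add_self
  rw [hL, ← Finset.sum_fiberwise_of_maps_to (t := Finset.HasAntidiagonal.antidiagonal e)
    (g := fun p => (tailPart p.1, tailPart p.2)) (fun p hp => by
      rw [Finset.HasAntidiagonal.mem_antidiagonal, ← tailPart_add]
      exact (Finset.mem_filter.1 hp).2)]
  refine Finset.sum_congr rfl fun q hq => ?_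
  rw [Finset.HasAntidiagonal.mem_antidiagonal] at hq
  have hq0 := DFunLike.congr_fun hq 0
  have hq1 := DFunLike.congr_fun hq 1
  rw [Finsupp.add_apply, h0] at hq0
  rw [Finsupp.add_apply, h1] at hq1
  rw [dualCancelCoeff_eq_sum β (f := f) (U := U) (by omega) (by omega)
      (fun a ha ht => hUf a ha (by rw [ht, ← hq]; exact le_self_add)),
    dualCancelCoeff_eq_sum β (f := g) (U := U) (by omega) (by omega)
      (fun a ha ht => hUg a ha (by rw [ht, ← hq]; exact le_add_self)),
    Finset.sum_mul_sum, ← Finset.sum_product']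
  refine Finset.sum_congr ?_ fun _ _ => rfl
  ext p
  simp only [Finset.mem_filter, Finset.mem_product, Prod.ext_iff]
  constructor
  · rintro ⟨⟨⟨hp1, hp2⟩, -⟩, hp3, hp4⟩
    exact ⟨⟨hp1, hp3⟩, hp2, hp4⟩
  · rintro ⟨⟨hp1, hp3⟩, hp2, hp4⟩
    refine ⟨⟨⟨hp1, hp2⟩, ?_⟩, hp3, hp4⟩
    rw [tailPart_add, hp3, hp4, hq]

theorem isBounded_C (c : k) : IsBounded (MvPowerSeries.C c : MvPowerSeries ℕ k) := by
  classical
  refine ⟨0, fun d hd => ?_⟩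
  rw [MvPowerSeries.coeff_C] at hd
  have : d = 0 := by
    by_contra h
    exact hd (if_neg h)
  simp [this]

theorem dualCancelCoeff_eq_C_of_tail {β : k} {f : MvPowerSeries ℕ k} {e : ℕ →₀ ℕ}
    (h : ∀ i j, (i, j) ≠ (0, 0) →
      MvPowerSeries.coeff (Finsupp.single 0 i + Finsupp.single 1 j + e) f = 0) :
    dualCancelCoeff β f e = Polynomial.C (MvPowerSeries.coeff e f) := by
  rw [dualCancelCoeff, finsum_eq_single _ (0, 0)]
  · simp
  · rintro ⟨i, j⟩ hij
    rw [h i j hij, map_zero, zero_mul]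

/-- `gΓ` as a ring. -/
def gGammaAlg (β : k) : Subalgebra k (MvPowerSeries ℕ k) where
  carrier := {f | f ∈ gGamma β}
  mul_mem' := by
    rintro f g ⟨hf, hfb, hf'⟩ ⟨hg, hgb, hg'⟩
    refine ⟨hf.mul hg, hfb.mul hgb, fun e h0 h1 => ?_⟩
    rw [dualCancelCoeff_mul β hfb hgb h0 h1]
    have key : ∀ p ∈ Finset.HasAntidiagonal.antidiagonal e, ∃ c : k,
        dualCancelCoeff β f p.1 * dualCancelCoeff β g p.2 = Polynomial.C c := by
      intro p hp
      rw [Finset.HasAntidiagonal.mem_antidiagonal] at hp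
      have hp0 := DFunLike.congr_fun hp 0
      have hp1 := DFunLike.congr_fun hp 1
      rw [Finsupp.add_apply, h0] at hp0
      rw [Finsupp.add_apply, h1] at hp1
      obtain ⟨a, ha⟩ := hf' p.1 (by omega) (by omega)
      obtain ⟨b, hb⟩ := hg' p.2 (by omega) (by omega)
      exact ⟨a * b, by rw [ha, hb, map_mul]⟩
    choose! c hc using key
    exact ⟨∑ p ∈ Finset.HasAntidiagonal.antidiagonal e, c p, by rw [map_sum]; exact Finset.sum_congr rfl hc⟩
  add_mem' := fun hf hg => (gGamma β).add_mem hf hg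
  algebraMap_mem' := by
    classical
    intro c
    refine ⟨isSymm_C c, isBounded_C c, fun e h0 h1 => ⟨_, dualCancelCoeff_eq_C_of_tail ?_⟩⟩
    intro i j hij
    change MvPowerSeries.coeff _ (MvPowerSeries.C c) = 0
    rw [MvPowerSeries.coeff_C, if_neg]
    intro h
    have h2 := DFunLike.congr_fun h 0
    have h3 := DFunLike.congr_fun h 1
    simp [h0, h1] at h2 h3
    exact hij (by rw [h2, h3])

theorem mem_gGammaAlg {β : k} {f : MvPowerSeries ℕ k} : f ∈ gGammaAlg β ↔ f ∈ gGamma β := Iff.rfl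

theorem coeff_xBrk_of_lt (β : k) {N n : ℕ} (h : N < n) : PowerSeries.coeff n (xBrk β N) = 0 := by
  rw [coeff_xBrk β N (by omega), Nat.choose_eq_zero_of_lt h]
  simp

theorem isBounded_powerSumBrk (β : k) (n : ℕ) : IsBounded (powerSumBrk β n) := by
  refine ⟨n, fun d hd => ?_⟩
  by_contra hlt
  refine hd ?_
  by_cases h : ∃ i m, m ≠ 0 ∧ d = Finsupp.single i m
  · obtain ⟨i, m, hm, rfl⟩ := h
    rw [Finsupp.degree_single] at hlt
    exact (coeff_sumVars_single Function.injective_id (xBrk β n) i hm).trans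
      (coeff_xBrk_of_lt β (by omega))
  · push Not at h
    exact coeff_sumVars_of_ne (e := id) (coeff_zero_xBrk β n) h

theorem sum_coeff_xBrk (β : k) (n : ℕ) (x : Polynomial k) :
    ∑ i ∈ Finset.range n, Polynomial.C (PowerSeries.coeff (i + 1) (xBrk β n)) * x ^ (i + 1) =
      (x + Polynomial.C (β / 2)) ^ n - Polynomial.C (β / 2) ^ n := by
  rw [add_pow, Finset.sum_range_succ']
  simp only [pow_zero, one_mul, Nat.sub_zero, Nat.choose_zero_right, Nat.cast_one, mul_one,
    add_sub_cancel_right]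
  refine Finset.sum_congr rfl fun i _ => ?_
  rw [coeff_xBrk β n (Nat.succ_ne_zero i)]
  simp only [map_mul, map_pow, map_natCast]
  ring

/-- The numbers `t + β/2` and `(-t-β) + β/2` are opposite, so their odd powers cancel. -/
theorem powerSumBrk_mem [CharZero k] (β : k) {n : ℕ} (hn : Odd n) :
    powerSumBrk β n ∈ gGamma β := by
  have hz := coeff_zero_xBrk β n
  have hs : ∀ i m, m ≠ 0 → MvPowerSeries.coeff (Finsupp.single i m) (powerSumBrk β n) =
      PowerSeries.coeff m (xBrk β n) := fun i m hm =>
    coeff_sumVars_single Function.injective_id (xBrk β n) i hm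
  have hne : ∀ d : ℕ →₀ ℕ, (∀ i m, m ≠ 0 → d ≠ Finsupp.single i m) →
      MvPowerSeries.coeff d (powerSumBrk β n) = 0 := fun d hd =>
    coeff_sumVars_of_ne (e := id) hz hd
  refine ⟨isSymm_sumVars hz, isBounded_powerSumBrk β n, fun e h0 h1 => ?_⟩
  by_cases he : e = 0
  · subst he
    -- Each of the two variables leaves its normalizing constant `-(β/2)^n`.
    refine ⟨-2 * (β / 2) ^ n, ?_⟩
    rw [dualCancelCoeff, finsum_eq_sum_of_support_subset _
      (s := (Finset.range n).image (fun i => (i + 1, 0)) ∪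
        (Finset.range n).image (fun i => (0, i + 1)))]
    · rw [Finset.sum_union, Finset.sum_image (by simp), Finset.sum_image (by simp)]
      · have h3 : ∀ i, MvPowerSeries.coeff (Finsupp.single 0 (i + 1) + Finsupp.single 1 0 + 0)
            (powerSumBrk β n) = PowerSeries.coeff (i + 1) (xBrk β n) := by
          intro i
          rw [Finsupp.single_zero, add_zero, add_zero, hs _ _ i.succ_ne_zero]
        have h4 : ∀ i, MvPowerSeries.coeff (Finsupp.single 0 0 + Finsupp.single 1 (i + 1) + 0)
            (powerSumBrk β n) = PowerSeries.coeff (i + 1) (xBrk β n) := by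
          intro i
          rw [Finsupp.single_zero, zero_add, add_zero, hs _ _ i.succ_ne_zero]
        simp only [h3, h4, pow_zero, mul_one, one_mul]
        rw [sum_coeff_xBrk, sum_coeff_xBrk]
        have h5 : (-Polynomial.X - Polynomial.C β + Polynomial.C (β / 2) : Polynomial k) =
            -(Polynomial.X + Polynomial.C (β / 2)) := by
          have : Polynomial.C β = Polynomial.C (β / 2) + Polynomial.C (β / 2) := by
            rw [← map_add, add_halves]
          rw [this]
          ring
        rw [h5, hn.neg_pow, map_mul, map_pow, map_neg, map_ofNat]
        ring
      · rw [Finset.disjoint_left]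
        intro p hp hp'
        obtain ⟨i, -, rfl⟩ := Finset.mem_image.1 hp
        obtain ⟨j, -, h⟩ := Finset.mem_image.1 hp'
        simp at h
    · rintro ⟨i, j⟩ hij
      have hc : MvPowerSeries.coeff (Finsupp.single 0 i + Finsupp.single 1 j + 0)
          (powerSumBrk β n) ≠ 0 := fun h => hij (by beta_reduce; rw [h, map_zero, zero_mul])
      rw [Finset.mem_coe, Finset.mem_union, Finset.mem_image, Finset.mem_image]
      by_contra hcon
      push Not at hcon
      refine hc ?_
      by_cases hi : i = 0
      · subst hi
        by_cases hj : j = 0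
        · subst hj
          rw [Finsupp.single_zero, Finsupp.single_zero, add_zero, add_zero]
          exact coeff_sumVars_zero id hz
        · rw [Finsupp.single_zero, zero_add, add_zero, hs _ _ hj]
          obtain ⟨j, rfl⟩ := Nat.exists_eq_succ_of_ne_zero hj
          refine coeff_xBrk_of_lt β ?_
          by_contra hlt
          exact hcon.2 j (Finset.mem_range.2 (by omega)) rfl
      · by_cases hj : j = 0
        · subst hj
          rw [Finsupp.single_zero, add_zero, add_zero, hs _ _ hi]
          obtain ⟨i, rfl⟩ := Nat.exists_eq_succ_of_ne_zero hi
          refine coeff_xBrk_of_lt β ?_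
          by_contra hlt
          exact hcon.1 i (Finset.mem_range.2 (by omega)) rfl
        · refine hne _ fun s m hm hd => ?_
          have hd0 := DFunLike.congr_fun hd 0
          have hd1 := DFunLike.congr_fun hd 1
          rw [head_add_zero _ _ rfl, Finsupp.single_apply] at hd0
          rw [head_add_one _ _ rfl, Finsupp.single_apply] at hd1
          split_ifs at hd0 hd1 <;> omega
  -- Only pure powers of one variable occur, so a nonzero tail excludes any power of the first two
  -- variables.
  · refine ⟨_, dualCancelCoeff_eq_C_of_tail fun i j hij => hne _ ?_⟩
    rintro s m hm hd
    obtain ⟨t, ht⟩ := Finsupp.ne_iff.1 he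
    rw [Finsupp.zero_apply] at ht
    have ht0 : t ≠ 0 := by rintro rfl; exact ht h0
    have ht1 : t ≠ 1 := by rintro rfl; exact ht h1
    have hd0 := DFunLike.congr_fun hd 0
    have hd1 := DFunLike.congr_fun hd 1
    have hdt := DFunLike.congr_fun hd t
    rw [head_add_zero _ _ h0, Finsupp.single_apply] at hd0
    rw [head_add_one _ _ h1, Finsupp.single_apply] at hd1
    simp only [Finsupp.add_apply, Finsupp.single_apply, ht0.symm, ht1.symm, if_false] at hdt
    refine hij ?_
    split_ifs at hd0 hd1 hdt <;> first | omega | simp_all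

theorem pBrk_mem [CharZero k] (β : k) {lam : Multiset ℕ} (h : IsOddPartition lam) :
    pBrk β lam ∈ gGamma β := by
  rw [← mem_gGammaAlg]
  refine Subalgebra.multiset_prod_mem _ fun f hf => ?_
  obtain ⟨n, hn, rfl⟩ := Multiset.mem_map.1 hf
  exact powerSumBrk_mem β (h n hn)

/-! ### Coefficients at strict partitions -/

/-- The exponent vector with values `S`. -/
def strictExp (S : Finset ℕ) : ℕ →₀ ℕ := Finsupp.onFinset S (fun i => if i ∈ S then i else 0)
  fun i hi => by
    by_contra h
    exact hi (if_neg h)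

theorem strictExp_apply (S : Finset ℕ) (i : ℕ) : strictExp S i = if i ∈ S then i else 0 := rfl

theorem degree_equivMapDomain (s : Equiv.Perm ℕ) (d : ℕ →₀ ℕ) :
    (d.equivMapDomain s).degree = d.degree := by
  induction d using Finsupp.induction_linear with
  | zero => simp
  | add d e hd he =>
    have : (d + e).equivMapDomain s = d.equivMapDomain s + e.equivMapDomain s := by
      ext i; simp
    rw [this, map_add, map_add, hd, he]
  | single i n => simp

/-- Permutations of an infinite set are transitive on finite injective tuples, so each position `p`
of the support can be moved to position `d p`; distinctness of the exponents makes the targets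
distinct. -/
theorem exists_perm_strictExp (d : ℕ →₀ ℕ) (hd : Set.InjOn d d.support) :
    ∃ s : Equiv.Perm ℕ, d.equivMapDomain s = strictExp (d.support.image d) := by
  classical
  let x : Fin d.support.card ↪ ℕ :=
    (d.support.equivFin.symm.toEmbedding).trans (Function.Embedding.subtype _)
  have hx : ∀ i, x i ∈ d.support := fun i => (d.support.equivFin.symm i).2
  have hx' : ∀ j ∈ d.support, ∃ i, x i = j := fun j hj =>
    ⟨d.support.equivFin ⟨j, hj⟩, by simp [x]⟩
  let y : Fin d.support.card ↪ ℕ :=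
    ⟨fun i => d (x i), fun i j h => x.injective (hd (hx i) (hx j) h)⟩
  obtain ⟨g, hg⟩ := (Equiv.Perm.isMultiplyPretransitive ℕ d.support.card).exists_smul_eq x y
  have hgx : ∀ i, g (x i) = d (x i) := fun i => DFunLike.congr_fun hg i
  refine ⟨g, ?_⟩
  ext j
  rw [Finsupp.equivMapDomain_apply, strictExp_apply]
  split_ifs with hj
  · obtain ⟨p, hp, rfl⟩ := Finset.mem_image.1 hj
    obtain ⟨i, rfl⟩ := hx' p hp
    rw [← hgx, Equiv.symm_apply_apply, hgx]
  · rw [← Finsupp.notMem_support_iff]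
    intro hmem
    obtain ⟨i, hi⟩ := hx' _ hmem
    refine hj (Finset.mem_image.2 ⟨_, hmem, ?_⟩)
    rw [← hi, ← hgx, hi, Equiv.apply_symm_apply]

theorem exists_perm_head {d : ℕ →₀ ℕ} {p q : ℕ} (h : p ≠ q) :
    ∃ s : Equiv.Perm ℕ, (d.equivMapDomain s) 0 = d p ∧ (d.equivMapDomain s) 1 = d q := by
  let x : Fin 2 ↪ ℕ := ⟨![p, q], by
    intro i j hij
    fin_cases i <;> fin_cases j <;> simp_all⟩
  let y : Fin 2 ↪ ℕ := ⟨![0, 1], by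
    intro i j hij
    fin_cases i <;> fin_cases j <;> simp_all⟩
  obtain ⟨g, hg⟩ := (Equiv.Perm.isMultiplyPretransitive ℕ 2).exists_smul_eq x y
  have h0 : g p = 0 := DFunLike.congr_fun hg 0
  have h1 : g q = 1 := DFunLike.congr_fun hg 1
  refine ⟨g, ?_, ?_⟩
  · rw [Finsupp.equivMapDomain_apply, ← h0, Equiv.symm_apply_apply]
  · rw [Finsupp.equivMapDomain_apply, ← h1, Equiv.symm_apply_apply]

/-- The sum of the squares of the exponents. -/
def sqSum (d : ℕ →₀ ℕ) : ℕ := d.sum fun _ n => n ^ 2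

theorem sqSum_le (d : ℕ →₀ ℕ) : sqSum d ≤ d.degree ^ 2 := by
  rw [sqSum, Finsupp.sum, sq, Finsupp.degree_apply, Finset.sum_mul]
  refine Finset.sum_le_sum fun i _ => ?_
  rw [sq]
  exact Nat.mul_le_mul_left _ (apply_le_degree d i)

theorem sqSum_equivMapDomain (s : Equiv.Perm ℕ) (d : ℕ →₀ ℕ) :
    sqSum (d.equivMapDomain s) = sqSum d :=
  Finsupp.sum_equivMapDomain s d _

theorem sqSum_head_add (i j : ℕ) {e : ℕ →₀ ℕ} (h0 : e 0 = 0) (h1 : e 1 = 0) :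
    sqSum (Finsupp.single 0 i + Finsupp.single 1 j + e) = i ^ 2 + j ^ 2 + sqSum e := by
  rw [sqSum, add_assoc, Finsupp.sum_add_index_of_disjoint, Finsupp.sum_add_index_of_disjoint,
    Finsupp.sum_single_index, Finsupp.sum_single_index, ← sqSum, add_assoc]
  · rfl
  · rfl
  · rw [Finset.disjoint_left]
    intro a ha ha'
    have := Finset.mem_singleton.1 (Finsupp.support_single_subset ha)
    subst this
    exact Finsupp.mem_support_iff.1 ha' h1
  · rw [Finset.disjoint_left]
    intro a ha ha'
    have := Finset.mem_singleton.1 (Finsupp.support_single_subset ha)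
    subst this
    exact Finsupp.mem_support_iff.1 ha' (by simp [h0])

theorem degree_head_add (i j : ℕ) (e : ℕ →₀ ℕ) :
    (Finsupp.single 0 i + Finsupp.single 1 j + e).degree = i + j + e.degree := by
  rw [map_add, map_add, Finsupp.degree_single, Finsupp.degree_single]

/-- A symmetric function satisfying the cancellation relations in degree `n` is determined in
degree `n` by its coefficients at the strict partitions. -/
theorem coeff_eq_zero_of_strict {f : MvPowerSeries ℕ k} (hf : IsSymm f) {n : ℕ}
    (hS : ∀ S : Finset ℕ, 0 ∉ S → ∑ s ∈ S, s = n → MvPowerSeries.coeff (strictExp S) f = 0)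
    (hR : ∀ (e : ℕ →₀ ℕ) (m : ℕ), e 0 = 0 → e 1 = 0 → m ≠ 0 → 2 * m + e.degree = n →
      ∑ p ∈ Finset.HasAntidiagonal.antidiagonal (2 * m), (-1 : k) ^ p.2 *
        MvPowerSeries.coeff (Finsupp.single 0 p.1 + Finsupp.single 1 p.2 + e) f = 0)
    (d : ℕ →₀ ℕ) (hd : d.degree = n) : MvPowerSeries.coeff d f = 0 := by
  -- If two exponents both equal `m`, the relation expresses the coefficient through those where
  -- `(m, m)` is replaced by `(i, j)` with `i + j = 2m` and `i ≠ j`. These have a larger sum of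
  -- squares, which is bounded by `n²`. With no repetition, symmetry leads to a strict partition.
  induction hM : n ^ 2 - sqSum d using Nat.strong_induction_on generalizing d with
  | _ M ih =>
  by_cases hinj : Set.InjOn d d.support
  · obtain ⟨s, hs⟩ := exists_perm_strictExp d hinj
    rw [← hf s d, hs]
    refine hS _ ?_ ?_
    · rw [Finset.mem_image]
      rintro ⟨i, hi, h0⟩
      exact Finsupp.mem_support_iff.1 hi h0
    · rw [Finset.sum_image fun i hi j hj h => hinj hi hj h, ← hd, Finsupp.degree_apply]
  · have : ∃ p ∈ d.support, ∃ q ∈ d.support, d p = d q ∧ p ≠ q := by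
      by_contra hcon
      push Not at hcon
      exact hinj fun p hp q hq h => hcon p hp q hq h
    obtain ⟨p, hp, q, hq, hpq, hne⟩ := this
    obtain ⟨s, hs0, hs1⟩ := exists_perm_head (d := d) hne
    set m := d p with hm
    have hm0 : m ≠ 0 := Finsupp.mem_support_iff.1 hp
    set e := tailPart (d.equivMapDomain s) with he
    have he0 : e 0 = 0 := by simp [he, tailPart_apply]
    have he1 : e 1 = 0 := by simp [he, tailPart_apply]
    have hde : d.equivMapDomain s = Finsupp.single 0 m + Finsupp.single 1 m + e := by
      rw [← head_add_tailPart (d.equivMapDomain s), hs0, hs1, hpq]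
    have hdeg : 2 * m + e.degree = n := by
      rw [← hd, ← degree_equivMapDomain s d, hde, degree_head_add]
      ring
    have h1 := hR e m he0 he1 hm0 hdeg
    rw [Finset.sum_eq_single (m, m)] at h1
    · rw [← hf s d, hde]
      refine (mul_eq_zero.1 h1).resolve_left ?_
      exact pow_ne_zero _ (neg_ne_zero.2 one_ne_zero)
    · rintro ⟨i, j⟩ hij hne'
      rw [Finset.HasAntidiagonal.mem_antidiagonal] at hij
      simp only at hij
      refine mul_eq_zero_of_right _ (ih _ ?_ _ ?_ rfl)
      · have h2 : sqSum d = m ^ 2 + m ^ 2 + sqSum e := by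
          rw [← sqSum_equivMapDomain s d, hde, sqSum_head_add _ _ he0 he1]
        have h3 : sqSum (Finsupp.single 0 i + Finsupp.single 1 j + e) = i ^ 2 + j ^ 2 + sqSum e :=
          sqSum_head_add _ _ he0 he1
        have h4 := sqSum_le (Finsupp.single 0 i + Finsupp.single 1 j + e)
        rw [degree_head_add, hij, hdeg] at h4
        have h5 : m ^ 2 + m ^ 2 < i ^ 2 + j ^ 2 := by
          have hij' : i ≠ j := by
            rintro rfl
            exact hne' (by rw [show i = m by omega])
          zify at hij ⊢
          have h6 : (0 : ℤ) < ((i : ℤ) - j) ^ 2 := by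
            have : (i : ℤ) - j ≠ 0 := sub_ne_zero.2 (by exact_mod_cast hij')
            positivity
          nlinarith
        simp only
        rw [← hM]
        omega
      · rw [degree_head_add, hij, hdeg]
    · intro h
      exact absurd (Finset.HasAntidiagonal.mem_antidiagonal.2 (by omega)) h

/-! #### The relations in `GΓ` -/

/-- Since `t̄ = -t` up to higher order, only the leading term `t^{d₀} (-t)^{d₁}` is visible in
degrees not exceeding that of the monomial. -/
theorem coeff_prod_cancelSubst (β : k) {d E : ℕ →₀ ℕ} (h : E.degree ≤ d.degree) :
    MvPowerSeries.coeff E (d.prod fun i n => cancelSubst β i ^ n) =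
      if Finsupp.single 0 (d 0 + d 1) + tailPart d = E then (-1 : k) ^ d 1 else 0 := by
  classical
  set u : MvPowerSeries ℕ k := (1 + MvPowerSeries.C β * MvPowerSeries.X 0)⁻¹ with hu
  have hu0 : MvPowerSeries.constantCoeff u = 1 := by simp [hu]
  have htail : (tailPart d).prod (fun i n => cancelSubst β i ^ n) =
      MvPowerSeries.monomial (tailPart d) (1 : k) := by
    rw [MvPowerSeries.monomial_one_eq]
    refine Finsupp.prod_congr fun i hi => ?_
    rw [Finsupp.mem_support_iff, tailPart_apply] at hi
    rw [cancelSubst, if_neg]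
    rintro rfl
    exact hi (if_pos rfl)
  have hprod : (d.prod fun i n => cancelSubst β i ^ n) =
      MvPowerSeries.monomial (Finsupp.single 0 (d 0 + d 1) + tailPart d) (1 : k) *
        (-u) ^ d 1 := by
    conv_lhs => rw [← head_add_tailPart d]
    rw [Finsupp.prod_add_index' (fun _ => pow_zero _) fun _ _ _ => pow_add _ _ _,
      Finsupp.prod_add_index' (fun _ => pow_zero _) fun _ _ _ => pow_add _ _ _,
      Finsupp.prod_single_index (h := fun i n => cancelSubst β i ^ n) (pow_zero _),
      Finsupp.prod_single_index (h := fun i n => cancelSubst β i ^ n) (pow_zero _), htail]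
    have h0 : cancelSubst β 0 = MvPowerSeries.X 0 := by simp [cancelSubst]
    have h1 : cancelSubst β 1 = MvPowerSeries.X 0 * (-u) := by simp [cancelSubst, hu]
    rw [h0, h1, mul_pow]
    have h2 : MvPowerSeries.monomial (Finsupp.single 0 (d 0 + d 1) + tailPart d) (1 : k) =
        MvPowerSeries.X 0 ^ (d 0 + d 1) * MvPowerSeries.monomial (tailPart d) (1 : k) := by
      rw [MvPowerSeries.X_pow_eq, MvPowerSeries.monomial_mul_monomial, one_mul]
    rw [h2, pow_add]
    ring
  have hdeg : (Finsupp.single 0 (d 0 + d 1) + tailPart d : ℕ →₀ ℕ).degree = d.degree := by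
    conv_rhs => rw [← head_add_tailPart d, degree_head_add]
    rw [map_add, Finsupp.degree_single]
  rw [hprod, MvPowerSeries.coeff_monomial_mul]
  split_ifs with h1 h2 h2
  · rw [h2, tsub_self, one_mul, MvPowerSeries.coeff_zero_eq_constantCoeff_apply, map_pow, map_neg,
      hu0]
  · exfalso
    refine h2 ?_
    obtain ⟨c, rfl⟩ := exists_add_of_le h1
    rw [map_add, hdeg] at h
    have : c = 0 := (Finsupp.degree_eq_zero_iff c).1 (by omega)
    rw [this, add_zero]
  · exact absurd h2.le h1
  · rfl

/-- On the lowest form the substitution acts as `x₂ = -t`. The condition is read at the even power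
`t^{2m}`, the one to which the exponent pair `(m, m)` contributes. -/
theorem GGamma_relation {β : k} {f : MvPowerSeries ℕ k} (hf : f ∈ GGamma β) {n : ℕ}
    (hlow : ∀ d : ℕ →₀ ℕ, d.degree < n → MvPowerSeries.coeff d f = 0) (e : ℕ →₀ ℕ) (m : ℕ)
    (h0 : e 0 = 0) (h1 : e 1 = 0) (hm : m ≠ 0) (hn : 2 * m + e.degree = n) :
    ∑ p ∈ Finset.HasAntidiagonal.antidiagonal (2 * m), (-1 : k) ^ p.2 *
      MvPowerSeries.coeff (Finsupp.single 0 p.1 + Finsupp.single 1 p.2 + e) f = 0 := by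
  classical
  have h2 := hf.2 (Finsupp.single 0 (2 * m) + e) (by simp [h0, hm])
  rw [MvPowerSeries.coeff_subst (hasSubst_cancelSubst β)] at h2
  have hterm : ∀ d : ℕ →₀ ℕ, MvPowerSeries.coeff d f • MvPowerSeries.coeff
      (Finsupp.single 0 (2 * m) + e) (d.prod fun i n => cancelSubst β i ^ n) =
      if Finsupp.single 0 (d 0 + d 1) + tailPart d = Finsupp.single 0 (2 * m) + e then
        (-1 : k) ^ d 1 * MvPowerSeries.coeff d f else 0 := by
    intro d
    by_cases hd : d.degree < n
    · rw [hlow d hd]; simp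
    · rw [coeff_prod_cancelSubst]
      · split_ifs <;> simp [mul_comm]
      · rw [map_add, Finsupp.degree_single]
        omega
  rw [finsum_congr hterm, finsum_eq_sum_of_support_subset _
    (s := (Finset.HasAntidiagonal.antidiagonal (2 * m)).image fun p =>
      (Finsupp.single 0 p.1 + Finsupp.single 1 p.2 + e : ℕ →₀ ℕ)), Finset.sum_image] at h2
  · rw [← h2]
    refine Finset.sum_congr rfl fun p hp => ?_
    rw [Finset.HasAntidiagonal.mem_antidiagonal] at hp
    rw [tailPart_head_add _ _ h0 h1, head_add_zero _ _ h0, head_add_one _ _ h1, hp, if_pos rfl]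
  · rintro ⟨i, j⟩ - ⟨i', j'⟩ - h
    have h3 := DFunLike.congr_fun h 0
    have h4 := DFunLike.congr_fun h 1
    simp only [head_add_zero _ _ h0, head_add_one _ _ h1] at h3 h4
    rw [h3, h4]
  · intro d hd
    have hd' : Finsupp.single 0 (d 0 + d 1) + tailPart d = Finsupp.single 0 (2 * m) + e := by
      by_contra h
      exact hd (if_neg h)
    rw [Finset.mem_coe, Finset.mem_image]
    have h3 := DFunLike.congr_fun hd' 0
    simp only [Finsupp.add_apply, Finsupp.single_eq_same, tailPart_apply, h0] at h3
    refine ⟨(d 0, d 1), Finset.HasAntidiagonal.mem_antidiagonal.2 (by simpa using h3), ?_⟩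
    have h4 : d 0 + d 1 = 2 * m := by simpa using h3
    rw [h4, add_left_cancel_iff] at hd'
    conv_rhs => rw [← head_add_tailPart d]
    rw [hd']

/-- An element of `GΓ` is determined up to degree `N` by its coefficients at the strict
partitions of size at most `N`. -/
theorem GGamma_eq_zero {β : k} {f : MvPowerSeries ℕ k} (hf : f ∈ GGamma β) {N : ℕ}
    (hS : ∀ S ∈ strictLE N, MvPowerSeries.coeff (strictExp S) f = 0) (d : ℕ →₀ ℕ)
    (hd : d.degree ≤ N) : MvPowerSeries.coeff d f = 0 := by
  induction hn : d.degree using Nat.strong_induction_on generalizing d with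
  | _ n ih =>
  refine coeff_eq_zero_of_strict hf.1 (n := n) (fun S h0 h => hS S (mem_strictLE.2 ⟨h0, by omega⟩))
    (GGamma_relation hf fun d' hd' => ih d'.degree hd' d' (by omega) rfl) d hn

/-! #### The relations in `gΓ` -/

theorem coeff_headPolynomial (β : k) {i j m : ℕ} (h : i + j ≤ m) :
    (Polynomial.X ^ i * (-Polynomial.X - Polynomial.C β) ^ j : Polynomial k).coeff m =
      if i + j = m then (-1 : k) ^ j else 0 := by
  have hdeg : (-Polynomial.X - Polynomial.C β : Polynomial k).natDegree ≤ 1 := by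
    have : (-Polynomial.X - Polynomial.C β : Polynomial k) =
        Polynomial.C (-1) * Polynomial.X + Polynomial.C (-β) := by
      simp only [map_neg, map_one]; ring
    rw [this]
    exact Polynomial.natDegree_linear_le
  have hc : (-Polynomial.X - Polynomial.C β : Polynomial k).coeff 1 = -1 := by
    simp
  obtain ⟨c, rfl⟩ := exists_add_of_le h
  rw [add_assoc, add_comm i, Polynomial.coeff_X_pow_mul]
  rcases Nat.eq_zero_or_pos c with rfl | hpos
  · have := Polynomial.coeff_pow_of_natDegree_le (m := j) hdeg
    rw [mul_one, hc] at this
    rw [add_zero, this, if_pos (by omega)]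
  · rw [if_neg (by omega)]
    refine Polynomial.coeff_eq_zero_of_natDegree_lt ?_
    have := Polynomial.natDegree_pow_le_of_le j hdeg
    omega

/-- The mirror image: on the top form `-t-β` acts as `-t`, because the terms with `β` have lower
degree. -/
theorem gGamma_relation {β : k} {f : MvPowerSeries ℕ k} (hf : f ∈ gGamma β) {n : ℕ}
    (hhigh : ∀ d : ℕ →₀ ℕ, n < d.degree → MvPowerSeries.coeff d f = 0) (e : ℕ →₀ ℕ) (m : ℕ)
    (h0 : e 0 = 0) (h1 : e 1 = 0) (hm : m ≠ 0) (hn : 2 * m + e.degree = n) :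
    ∑ p ∈ Finset.HasAntidiagonal.antidiagonal (2 * m), (-1 : k) ^ p.2 *
      MvPowerSeries.coeff (Finsupp.single 0 p.1 + Finsupp.single 1 p.2 + e) f = 0 := by
  obtain ⟨c, hc⟩ := hf.2.2 e h0 h1
  have h2 := congrArg (fun P => Polynomial.coeff P (2 * m)) hc
  rw [Polynomial.coeff_C, if_neg (by omega), dualCancelCoeff,
    finsum_eq_sum_of_support_subset _ (s := Finset.range (2 * m + 1) ×ˢ Finset.range (2 * m + 1)),
    Polynomial.finsetSum_coeff] at h2
  · rw [← h2]
    refine Finset.sum_subset_zero_on_sdiff ?_ ?_ ?_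
    · rintro ⟨i, j⟩ hij
      rw [Finset.HasAntidiagonal.mem_antidiagonal] at hij
      simp only at hij
      simp only [Finset.mem_product, Finset.mem_range]
      omega
    · rintro ⟨i, j⟩ hij
      rw [Finset.mem_sdiff, Finset.HasAntidiagonal.mem_antidiagonal] at hij
      have hij' := hij.2
      simp only at hij'
      rw [Polynomial.coeff_C_mul]
      rcases lt_or_ge (2 * m) (i + j) with h | h
      · rw [hhigh _ (by rw [degree_head_add]; omega), zero_mul]
      · rw [coeff_headPolynomial β h, if_neg hij', mul_zero]
    · rintro ⟨i, j⟩ hij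
      rw [Finset.HasAntidiagonal.mem_antidiagonal] at hij
      simp only at hij
      rw [Polynomial.coeff_C_mul, coeff_headPolynomial β hij.le, if_pos hij, mul_comm]
  · rintro ⟨i, j⟩ hij
    by_contra hne
    refine hij ?_
    simp only [Finset.coe_product, Finset.coe_range, Set.mem_prod, Set.mem_Iio] at hne
    beta_reduce
    rw [hhigh _ (by rw [degree_head_add]; omega), map_zero, zero_mul]

/-- An element of `gΓ` of degree at most `N` is determined by its coefficients at the strict
partitions of size at most `N`. -/
theorem gGamma_eq_zero {β : k} {f : MvPowerSeries ℕ k} (hf : f ∈ gGamma β) {N : ℕ}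
    (hN : ∀ d : ℕ →₀ ℕ, N < d.degree → MvPowerSeries.coeff d f = 0)
    (hS : ∀ S ∈ strictLE N, MvPowerSeries.coeff (strictExp S) f = 0) : f = 0 := by
  ext d
  rw [map_zero]
  induction hn : N + 1 - d.degree using Nat.strong_induction_on generalizing d with
  | _ n ih =>
  rcases lt_or_ge N d.degree with h | h
  · exact hN d h
  refine coeff_eq_zero_of_strict hf.1 (n := d.degree)
    (fun S h0 h => hS S (mem_strictLE.2 ⟨h0, by omega⟩))
    (gGamma_relation hf fun d' hd' => ?_) d rfl
  exact ih _ (by omega) d' rfl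

/-! ### Independence of the power sums -/

/-- The multiset of the nonzero exponents. -/
def vals (d : ℕ →₀ ℕ) : Multiset ℕ := d.support.val.map d

theorem card_vals (d : ℕ →₀ ℕ) : Multiset.card (vals d) = d.support.card := by
  simp [vals]

theorem vals_zero : vals 0 = 0 := by simp [vals]

theorem support_single_add' {s l : ℕ} (hl : l ≠ 0) {d : ℕ →₀ ℕ} (hs : d s = 0) :
    (Finsupp.single s l + d).support = Finset.cons s d.support (by simp [hs]) := by
  ext i
  simp only [Finsupp.mem_support_iff, Finsupp.add_apply, Finset.mem_cons]
  by_cases h : i = s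
  · subst h; simp [hl]
  · rw [Finsupp.single_apply, if_neg (Ne.symm h), zero_add]
    simp [h]

theorem vals_single_add {s l : ℕ} (hl : l ≠ 0) {d : ℕ →₀ ℕ} (hs : d s = 0) :
    vals (Finsupp.single s l + d) = l ::ₘ vals d := by
  rw [vals, support_single_add' hl hs, Finset.cons_val, Multiset.map_cons, vals]
  congr 1
  · simp [hs]
  · refine Multiset.map_congr rfl fun i hi => ?_
    have : i ≠ s := by
      rintro rfl
      exact Finsupp.mem_support_iff.1 hi hs
    rw [Finsupp.add_apply, Finsupp.single_apply, if_neg (Ne.symm this), zero_add]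

theorem exists_vals_eq {lam : Multiset ℕ} (h : ∀ l ∈ lam, l ≠ 0) :
    ∃ d, vals d = lam ∧ d.degree = lam.sum := by
  induction lam using Multiset.induction_on with
  | empty => exact ⟨0, vals_zero, by simp⟩
  | cons l lam ih =>
    obtain ⟨d, hd, hd'⟩ := ih fun x hx => h x (Multiset.mem_cons_of_mem hx)
    obtain ⟨s, hs⟩ := Infinite.exists_notMem_finset d.support
    refine ⟨Finsupp.single s l + d, ?_, ?_⟩
    · rw [vals_single_add (h l (Multiset.mem_cons_self l lam)) (Finsupp.notMem_support_iff.1 hs), hd]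
    · rw [map_add, Finsupp.degree_single, hd', Multiset.sum_cons]

/-- The product of power sums `p_λ`. -/
def powerProd (k : Type*) [Field k] (lam : Multiset ℕ) : MvPowerSeries ℕ k :=
  (lam.map (powerSum k id)).prod

theorem powerProd_cons (l : ℕ) (lam : Multiset ℕ) :
    powerProd k (l ::ₘ lam) = powerSum k id l * powerProd k lam := by
  rw [powerProd, Multiset.map_cons, Multiset.prod_cons, powerProd]

theorem coeff_zero_X_pow {l : ℕ} (hl : l ≠ 0) :
    PowerSeries.coeff 0 (PowerSeries.X ^ l : PowerSeries k) = 0 := by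
  rw [PowerSeries.coeff_X_pow, if_neg hl.symm]

theorem coeff_powerSum_single {l : ℕ} (hl : l ≠ 0) (s : ℕ) :
    MvPowerSeries.coeff (Finsupp.single s l) (powerSum k id l) = 1 := by
  refine (coeff_sumVars_single Function.injective_id _ s hl).trans ?_
  rw [PowerSeries.coeff_X_pow, if_pos rfl]

theorem coeff_powerSum_of_ne {l : ℕ} (hl : l ≠ 0) {d : ℕ →₀ ℕ}
    (h : ∀ s, d ≠ Finsupp.single s l) : MvPowerSeries.coeff d (powerSum k id l) = 0 := by
  by_cases hd : ∃ i n, n ≠ 0 ∧ d = Finsupp.single i n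
  · obtain ⟨i, n, hn, rfl⟩ := hd
    refine (coeff_sumVars_single Function.injective_id _ i hn).trans ?_
    rw [PowerSeries.coeff_X_pow, if_neg]
    rintro rfl
    exact h i rfl
  · push Not at hd
    exact coeff_sumVars_of_ne (e := id) (coeff_zero_X_pow hl) hd

theorem coeff_powerSum_mul {l : ℕ} (hl : l ≠ 0) (f : MvPowerSeries ℕ k) (d : ℕ →₀ ℕ) :
    MvPowerSeries.coeff d (powerSum k id l * f) =
      ∑ s ∈ d.support with l ≤ d s, MvPowerSeries.coeff (d - Finsupp.single s l) f := by
  classical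
  rw [MvPowerSeries.coeff_mul]
  symm
  have hinj : Set.InjOn (fun s => (Finsupp.single s l, d - Finsupp.single s l))
      ((d.support.filter fun s => l ≤ d s : Finset ℕ) : Set ℕ) := by
    intro s _ t _ h
    exact Finsupp.single_left_injective hl (Prod.ext_iff.1 h).1
  have h1 : ∀ s, MvPowerSeries.coeff (d - Finsupp.single s l) f =
      (fun p : (ℕ →₀ ℕ) × (ℕ →₀ ℕ) => MvPowerSeries.coeff p.1 (powerSum k id l) *
        MvPowerSeries.coeff p.2 f) (Finsupp.single s l, d - Finsupp.single s l) := by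
    intro s
    simp only [coeff_powerSum_single hl, one_mul]
  rw [Finset.sum_congr rfl fun s _ => h1 s]
  refine (Finset.sum_image (f := fun p : (ℕ →₀ ℕ) × (ℕ →₀ ℕ) => MvPowerSeries.coeff p.1
    (powerSum k id l) * MvPowerSeries.coeff p.2 f) hinj).symm.trans ?_
  refine Finset.sum_subset ?_ ?_
  · intro p hp
    obtain ⟨s, hs, rfl⟩ := Finset.mem_image.1 hp
    rw [Finset.HasAntidiagonal.mem_antidiagonal]
    refine add_tsub_cancel_of_le ?_
    rw [Finsupp.single_le_iff]
    exact (Finset.mem_filter.1 hs).2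
  · rintro ⟨a, b⟩ hp hnot
    rw [Finset.HasAntidiagonal.mem_antidiagonal] at hp
    simp only at hp ⊢
    rw [coeff_powerSum_of_ne hl, zero_mul]
    rintro s rfl
    refine hnot (Finset.mem_image.2 ⟨s, ?_, ?_⟩)
    · have h2 := DFunLike.congr_fun hp s
      rw [Finsupp.add_apply, Finsupp.single_eq_same] at h2
      rw [Finset.mem_filter, Finsupp.mem_support_iff]
      omega
    · rw [← hp, add_tsub_cancel_left]

/-- Multiplication by `p_l` adds `l` either at a fresh position or at an occupied one. A product of
power sums thus reaches as many variables as it has factors only if no parts are merged. -/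
theorem coeff_powerProd_ne_zero {lam : Multiset ℕ} (h : ∀ l ∈ lam, l ≠ 0) {d : ℕ →₀ ℕ}
    (hd : MvPowerSeries.coeff d (powerProd k lam) ≠ 0) :
    d.support.card ≤ Multiset.card lam ∧ (d.support.card = Multiset.card lam → vals d = lam) := by
  classical
  induction lam using Multiset.induction_on generalizing d with
  | empty =>
    have : d = 0 := by
      by_contra h0
      refine hd ?_
      rw [powerProd, Multiset.map_zero, Multiset.prod_zero, MvPowerSeries.coeff_one, if_neg h0]
    subst this
    simp [vals_zero]
  | cons l lam ih =>
    have hl := h l (Multiset.mem_cons_self l lam)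
    rw [powerProd_cons, coeff_powerSum_mul hl] at hd
    obtain ⟨s, hs, hne⟩ := Finset.exists_ne_zero_of_sum_ne_zero hd
    obtain ⟨h1, h2⟩ := ih (fun x hx => h x (Multiset.mem_cons_of_mem hx)) hne
    have hle : Finsupp.single s l ≤ d := by
      rw [Finsupp.single_le_iff]
      exact (Finset.mem_filter.1 hs).2
    set d' := d - Finsupp.single s l with hd'
    have hdd : d = Finsupp.single s l + d' := (add_tsub_cancel_of_le hle).symm
    rw [Multiset.card_cons]
    by_cases hs0 : d' s = 0
    · rw [hdd, support_single_add' hl hs0, Finset.card_cons, vals_single_add hl hs0]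
      exact ⟨by omega, fun h3 => by rw [h2 (by omega)]⟩
    · have h3 : d.support = d'.support := by
        ext i
        rw [hdd, Finsupp.mem_support_iff, Finsupp.mem_support_iff, Finsupp.add_apply,
          Finsupp.single_apply]
        split_ifs with hi
        · subst hi
          simp [hs0]
        · rw [zero_add]
      rw [h3]
      exact ⟨by omega, fun h4 => by omega⟩

/-- If removing `l` does not empty its position, too many variables remain. So the positions with
exponent exactly `l` count, and the coefficient is a product of positive multiplicities. -/
theorem coeff_powerProd_of_vals {lam : Multiset ℕ} (h : ∀ l ∈ lam, l ≠ 0) :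
    ∃ m : ℕ, m ≠ 0 ∧ ∀ d, vals d = lam → MvPowerSeries.coeff d (powerProd k lam) = m := by
  classical
  induction lam using Multiset.induction_on with
  | empty =>
    refine ⟨1, one_ne_zero, fun d hd => ?_⟩
    have : d = 0 := by
      have h1 := card_vals d
      rw [hd, Multiset.card_zero] at h1
      exact Finsupp.card_support_eq_zero.1 h1.symm
    subst this
    simp [powerProd]
  | cons l lam ih =>
    have hl := h l (Multiset.mem_cons_self l lam)
    have hlam : ∀ x ∈ lam, x ≠ 0 := fun x hx => h x (Multiset.mem_cons_of_mem hx)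
    obtain ⟨m, hm, ih⟩ := ih hlam
    refine ⟨Multiset.count l (l ::ₘ lam) * m, ?_, fun d hd => ?_⟩
    · rw [Multiset.count_cons_self]
      positivity
    rw [powerProd_cons, coeff_powerSum_mul hl]
    have hterm : ∀ s ∈ d.support.filter fun s => l ≤ d s,
        MvPowerSeries.coeff (d - Finsupp.single s l) (powerProd k lam) =
          if d s = l then (m : k) else 0 := by
      intro s hs
      have hle : Finsupp.single s l ≤ d := by
        rw [Finsupp.single_le_iff]
        exact (Finset.mem_filter.1 hs).2
      set d' := d - Finsupp.single s l with hd'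
      have hdd : d = Finsupp.single s l + d' := (add_tsub_cancel_of_le hle).symm
      have hds : d s = l + d' s := by
        conv_lhs => rw [hdd]
        rw [Finsupp.add_apply, Finsupp.single_eq_same]
      split_ifs with h1
      · have hs0 : d' s = 0 := by omega
        refine ih d' ?_
        rw [hdd, vals_single_add hl hs0] at hd
        exact (Multiset.cons_inj_right l).1 hd
      · by_contra hne
        have h2 := (coeff_powerProd_ne_zero hlam hne).1
        have h3 : d.support ⊆ d'.support := by
          intro i hi
          rw [Finsupp.mem_support_iff] at hi ⊢
          by_cases his : i = s
          · subst his; omega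
          · intro h0
            refine hi ?_
            rw [hdd, Finsupp.add_apply, h0, Finsupp.single_apply, if_neg (Ne.symm his),
              zero_add]
        have h4 := Finset.card_le_card h3
        have h5 := card_vals d
        rw [hd, Multiset.card_cons] at h5
        omega
    rw [Finset.sum_congr rfl hterm, Finset.sum_ite, Finset.sum_const_zero, add_zero,
      Finset.sum_const, nsmul_eq_mul, Nat.cast_mul, Finset.filter_filter]
    congr 2
    rw [← hd, vals, Multiset.count_map, ← Finset.filter_val, Finset.card_val]
    congr 1
    ext s
    simp only [Finset.mem_filter]
    constructor
    · rintro ⟨h1, -, h2⟩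
      exact ⟨h1, h2.symm⟩
    · rintro ⟨h1, h2⟩
      exact ⟨h1, h2.le, h2.symm⟩

theorem oddParts_ne_zero (a : ℕ →₀ ℕ) : ∀ l ∈ oddParts a, l ≠ 0 := fun l hl =>
  (isOddPartition_oddParts a l hl).pos.ne'

/-- Triangularity with respect to length: at a monomial whose exponents are the parts of a longest
partition with nonzero coefficient, only that partition contributes. -/
theorem powerProd_independent [CharZero k] {n : ℕ} (A : Finset (ℕ →₀ ℕ)) (hA : ∀ a ∈ A, wt a = n)
    (c : (ℕ →₀ ℕ) → k) (h : ∀ d : ℕ →₀ ℕ, d.degree = n →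
      ∑ a ∈ A, c a * MvPowerSeries.coeff d (powerProd k (oddParts a)) = 0) :
    ∀ a ∈ A, c a = 0 := by
  classical
  by_contra hcon
  push Not at hcon
  have hne : (A.filter fun a => c a ≠ 0).Nonempty := by
    obtain ⟨a, ha, hc⟩ := hcon
    exact ⟨a, Finset.mem_filter.2 ⟨ha, hc⟩⟩
  obtain ⟨a, ha, hmax⟩ := Finset.exists_max_image _ (fun a : ℕ →₀ ℕ => a.degree) hne
  rw [Finset.mem_filter] at ha
  obtain ⟨d, hd, hdeg⟩ := exists_vals_eq (oddParts_ne_zero a)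
  obtain ⟨m, hm, hcoef⟩ := coeff_powerProd_of_vals (k := k) (oddParts_ne_zero a)
  rw [sum_oddParts, hA a ha.1] at hdeg
  have h1 := h d hdeg
  rw [Finset.sum_eq_single_of_mem a ha.1, hcoef d hd] at h1
  · exact (mul_ne_zero ha.2 (Nat.cast_ne_zero.2 hm)) h1
  · intro b hb hba
    by_contra hne'
    have hcb := left_ne_zero_of_mul hne'
    obtain ⟨h2, h3⟩ := coeff_powerProd_ne_zero (oddParts_ne_zero b) (right_ne_zero_of_mul hne')
    have h4 := hmax b (Finset.mem_filter.2 ⟨hb, hcb⟩)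
    rw [← card_vals, hd, card_oddParts, card_oddParts] at h2 h3
    have h5 := h3 (le_antisymm h2 h4)
    exact hba (oddParts_injective h5.symm)

/-! #### Leading forms -/

/-- `g` is homogeneous of degree `n` and is the part of `f` of degree `n`, while there is no part
of degree `m` with `r m n`. -/
def LeadForm (r : ℕ → ℕ → Prop) (f g : MvPowerSeries ℕ k) (n : ℕ) : Prop :=
  (∀ d : ℕ →₀ ℕ, r d.degree n → MvPowerSeries.coeff d f = 0) ∧
    (∀ d : ℕ →₀ ℕ, d.degree = n → MvPowerSeries.coeff d f = MvPowerSeries.coeff d g) ∧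
    ∀ d : ℕ →₀ ℕ, d.degree ≠ n → MvPowerSeries.coeff d g = 0

/-- The two hypotheses on `r` hold for `<` and for `>`, so lowest forms (for `GΓ`) and top forms
(for `gΓ`) are treated together. -/
theorem LeadForm.mul {r : ℕ → ℕ → Prop}
    (hr : ∀ a b n m, r (a + b) (n + m) → r a n ∨ r b m)
    (hr' : ∀ a b n m, a + b = n + m → a ≠ n → r a n ∨ r b m)
    {f g f' g' : MvPowerSeries ℕ k} {n n' : ℕ} (h : LeadForm r f g n) (h' : LeadForm r f' g' n') :
    LeadForm r (f * f') (g * g') (n + n') := by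
  classical
  refine ⟨fun d hd => ?_, fun d hd => ?_, fun d hd => ?_⟩
  · rw [MvPowerSeries.coeff_mul]
    refine Finset.sum_eq_zero fun p hp => ?_
    rw [Finset.HasAntidiagonal.mem_antidiagonal] at hp
    rw [← hp, map_add] at hd
    rcases hr _ _ _ _ hd with h1 | h1
    · rw [h.1 _ h1, zero_mul]
    · rw [h'.1 _ h1, mul_zero]
  · rw [MvPowerSeries.coeff_mul, MvPowerSeries.coeff_mul]
    refine Finset.sum_congr rfl fun p hp => ?_
    rw [Finset.HasAntidiagonal.mem_antidiagonal] at hp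
    rw [← hp, map_add] at hd
    by_cases h1 : p.1.degree = n
    · rw [h.2.1 _ h1, h'.2.1 _ (by omega)]
    · rw [h.2.2 _ h1, zero_mul]
      rcases hr' _ _ _ _ hd h1 with h2 | h2
      · rw [h.1 _ h2, zero_mul]
      · rw [h'.1 _ h2, mul_zero]
  · rw [MvPowerSeries.coeff_mul]
    refine Finset.sum_eq_zero fun p hp => ?_
    rw [Finset.HasAntidiagonal.mem_antidiagonal] at hp
    rw [← hp, map_add] at hd
    by_cases h1 : p.1.degree = n
    · rw [h'.2.2 _ (by omega), mul_zero]
    · rw [h.2.2 _ h1, zero_mul]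

theorem LeadForm.one {r : ℕ → ℕ → Prop} (hr : ∀ n, ¬r n n) :
    LeadForm r (1 : MvPowerSeries ℕ k) 1 0 := by
  classical
  refine ⟨fun d hd => ?_, fun d _ => rfl, fun d hd => ?_⟩
  · rw [MvPowerSeries.coeff_one, if_neg]
    rintro rfl
    rw [map_zero] at hd
    exact hr _ hd
  · rw [MvPowerSeries.coeff_one, if_neg]
    rintro rfl
    exact hd (map_zero _)

theorem LeadForm.sumVars {r : ℕ → ℕ → Prop} {φ : PowerSeries k} {l : ℕ}
    (hl : l ≠ 0) (h0 : PowerSeries.coeff 0 φ = 0) (h1 : PowerSeries.coeff l φ = 1)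
    (hlow : ∀ n, r n l → PowerSeries.coeff n φ = 0) :
    LeadForm r (sumVars id φ) (powerSum k id l) l := by
  have hs : ∀ (φ : PowerSeries k) i n, n ≠ 0 → MvPowerSeries.coeff (Finsupp.single i n)
      (NeutralFermion.sumVars id φ) = PowerSeries.coeff n φ := fun φ i n hn =>
    coeff_sumVars_single Function.injective_id φ i hn
  have hne : ∀ (φ : PowerSeries k), PowerSeries.coeff 0 φ = 0 → ∀ d : ℕ →₀ ℕ,
      (¬∃ i n, n ≠ 0 ∧ d = Finsupp.single i n) →
      MvPowerSeries.coeff d (NeutralFermion.sumVars id φ) = 0 := fun φ h0 d hd =>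
    coeff_sumVars_of_ne (e := id) h0 (by push Not at hd; exact hd)
  refine ⟨fun d hd => ?_, fun d hd => ?_, fun d hd => ?_⟩ <;>
    by_cases h : ∃ i n, n ≠ 0 ∧ d = Finsupp.single i n
  · obtain ⟨i, n, hn, rfl⟩ := h
    rw [Finsupp.degree_single] at hd
    rw [hs _ _ _ hn, hlow n hd]
  · exact hne φ h0 d h
  · obtain ⟨i, n, hn, rfl⟩ := h
    rw [Finsupp.degree_single] at hd
    subst hd
    rw [hs _ _ _ hn, h1, coeff_powerSum_single hl]
  · rw [hne φ h0 d h, powerSum, hne _ (coeff_zero_X_pow hl) d h]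
  · refine coeff_powerSum_of_ne hl ?_
    rintro s rfl
    exact hd (Finsupp.degree_single _ _)
  · exact hne _ (coeff_zero_X_pow hl) d h

theorem LeadForm.multiset_prod {r : ℕ → ℕ → Prop} (hr0 : ∀ n, ¬r n n)
    (hr : ∀ a b n m, r (a + b) (n + m) → r a n ∨ r b m)
    (hr' : ∀ a b n m, a + b = n + m → a ≠ n → r a n ∨ r b m)
    {P : ℕ → MvPowerSeries ℕ k} {lam : Multiset ℕ}
    (h : ∀ l ∈ lam, LeadForm r (P l) (powerSum k id l) l) :
    LeadForm r (lam.map P).prod (powerProd k lam) lam.sum := by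
  induction lam using Multiset.induction_on with
  | empty => simpa [powerProd] using LeadForm.one hr0
  | cons l lam ih =>
    rw [Multiset.map_cons, Multiset.prod_cons, powerProd_cons, Multiset.sum_cons]
    exact (h l (Multiset.mem_cons_self l lam)).mul hr hr'
      (ih fun x hx => h x (Multiset.mem_cons_of_mem hx))

theorem coeff_xPar_pow_self (β : k) (n : ℕ) :
    PowerSeries.coeff n (xPar β ^ n) = (1 : k) := by
  rw [xPar, mul_pow, PowerSeries.coeff_X_pow_mul', if_pos (le_refl n), Nat.sub_self,
    PowerSeries.coeff_zero_eq_constantCoeff_apply, map_pow]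
  simp

theorem leadForm_pPar (β : k) (a : ℕ →₀ ℕ) :
    LeadForm (· < ·) (pPar β (oddParts a)) (powerProd k (oddParts a)) (wt a) := by
  rw [← sum_oddParts]
  refine LeadForm.multiset_prod (fun n => lt_irrefl n) (fun a b n m h => by omega)
    (fun a b n m h h' => by omega) fun l hl => ?_
  have hl0 := oddParts_ne_zero a l hl
  refine LeadForm.sumVars hl0 ?_ (coeff_xPar_pow_self β l)
    fun n hn => coeff_xPar_pow_of_lt β hn
  exact coeff_xPar_pow_of_lt β (Nat.pos_of_ne_zero hl0)

theorem leadForm_pBrk (β : k) (a : ℕ →₀ ℕ) :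
    LeadForm (· > ·) (pBrk β (oddParts a)) (powerProd k (oddParts a)) (wt a) := by
  rw [← sum_oddParts]
  refine LeadForm.multiset_prod (r := (· > ·)) (fun n => lt_irrefl n) (fun a b n m h => by omega)
    (fun a b n m h h' => by omega) fun l hl => ?_
  have hl0 := oddParts_ne_zero a l hl
  refine LeadForm.sumVars hl0 (coeff_zero_xBrk β l) ?_
    fun n hn => coeff_xBrk_of_lt β hn
  refine (coeff_xBrk β l hl0).trans ?_
  simp

/-- Upward induction on the weight. Once the coefficients of smaller weight vanish, the part of
degree `n` is a combination of ordinary products of power sums of weight `n`, as heavier products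
start in higher degree. -/
theorem eq_zero_of_coeff_parSum [CharZero k] {β : k} {c : MvPowerSeries ℕ k} {N : ℕ}
    (h : ∀ d : ℕ →₀ ℕ, d.degree ≤ N → MvPowerSeries.coeff d (parSum β c) = 0) (a : ℕ →₀ ℕ)
    (ha : wt a ≤ N) : MvPowerSeries.coeff a c = 0 := by
  induction hn : wt a using Nat.strong_induction_on generalizing a with
  | _ n ih =>
  refine powerProd_independent (n := n) ((wtLE n).filter fun b => wt b = n)
    (fun b hb => (Finset.mem_filter.1 hb).2) (fun b => MvPowerSeries.coeff b c) (fun d hd => ?_) a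
    (Finset.mem_filter.2 ⟨mem_wtLE.2 hn.le, hn⟩)
  have h1 := h d (by omega)
  rw [coeff_parSum, finsum_eq_sum_of_support_subset _ (s := (wtLE n).filter fun b => wt b = n)] at h1
  · rw [← h1]
    refine Finset.sum_congr rfl fun b hb => ?_
    rw [(leadForm_pPar β b).2.1 d (by rw [hd, (Finset.mem_filter.1 hb).2])]
  · intro b hb
    rw [Finset.mem_coe, Finset.mem_filter, mem_wtLE]
    by_contra hne
    refine hb ?_
    beta_reduce
    rcases lt_trichotomy (wt b) n with h2 | h2 | h2
    · rw [ih _ h2 b (by omega) rfl, zero_mul]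
    · exact absurd ⟨h2.le, h2⟩ hne
    · rw [(leadForm_pPar β b).1 d (by rw [hd]; exact h2), mul_zero]

/-- The same with top forms, by downward induction from weight `N`. -/
theorem eq_zero_of_sum_pBrk [CharZero k] {β : k} {c : (ℕ →₀ ℕ) → k} {N : ℕ}
    (h : ∑ a ∈ wtLE N, c a • pBrk β (oddParts a) = 0) (a : ℕ →₀ ℕ) (ha : wt a ≤ N) : c a = 0 := by
  induction hn : N - wt a using Nat.strong_induction_on generalizing a with
  | _ n ih =>
  refine powerProd_independent (n := wt a) ((wtLE N).filter fun b => wt b = wt a)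
    (fun b hb => (Finset.mem_filter.1 hb).2) c (fun d hd => ?_) a
    (Finset.mem_filter.2 ⟨mem_wtLE.2 ha, rfl⟩)
  have h1 := congrArg (MvPowerSeries.coeff d) h
  rw [map_sum, map_zero] at h1
  rw [← h1, Finset.sum_filter]
  refine Finset.sum_congr rfl fun b hb => ?_
  rw [map_smul, smul_eq_mul]
  split_ifs with h2
  · rw [(leadForm_pBrk β b).2.1 d (by rw [hd, h2])]
  · rcases lt_or_gt_of_ne h2 with h3 | h3
    · rw [(leadForm_pBrk β b).1 d (by rw [hd]; exact h3), mul_zero]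
    · rw [ih (N - wt b) (by have := mem_wtLE.1 hb; omega) b (mem_wtLE.1 hb) rfl, zero_mul]

/-! ### Expansions in the power sums -/

/-- The matrix of coefficients at strict partitions is square by Euler's theorem, so injectivity
lets these coefficients be prescribed. -/
theorem exists_interpolation {P : (ℕ →₀ ℕ) → MvPowerSeries ℕ k} (N : ℕ)
    (hP : ∀ c : (ℕ →₀ ℕ) → k, (∀ S ∈ strictLE N,
      MvPowerSeries.coeff (strictExp S) (∑ a ∈ wtLE N, c a • P a) = 0) → ∀ a ∈ wtLE N, c a = 0)
    (t : Finset ℕ → k) : ∃ c : (ℕ →₀ ℕ) → k, ∀ S ∈ strictLE N,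
      MvPowerSeries.coeff (strictExp S) (∑ a ∈ wtLE N, c a • P a) = t S := by
  let M : (wtLE N → k) →ₗ[k] (strictLE N → k) :=
    { toFun := fun c S => ∑ a, c a * MvPowerSeries.coeff (strictExp S) (P a)
      map_add' := fun c c' => by
        funext S
        simp [add_mul, Finset.sum_add_distrib]
      map_smul' := fun r c => by
        funext S
        simp [Finset.mul_sum, mul_assoc] }
  let ext0 : (wtLE N → k) → (ℕ →₀ ℕ) → k := fun c a => if h : a ∈ wtLE N then c ⟨a, h⟩ else 0
  have hext : ∀ (c : wtLE N → k) (S : Finset ℕ), MvPowerSeries.coeff (strictExp S)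
      (∑ a ∈ wtLE N, ext0 c a • P a) = ∑ a, c a * MvPowerSeries.coeff (strictExp S) (P a) := by
    intro c S
    rw [map_sum, ← Finset.sum_coe_sort (wtLE N)]
    refine Finset.sum_congr rfl fun a _ => ?_
    simp only [ext0]
    rw [dif_pos a.2, map_smul, smul_eq_mul]
  have hinj : Function.Injective M := by
    rw [injective_iff_map_eq_zero]
    intro c hc
    have h1 := hP (ext0 c) fun S hS => (hext c S).trans (congrFun hc ⟨S, hS⟩)
    funext a
    have h2 := h1 a a.2
    simp only [ext0] at h2
    rwa [dif_pos a.2] at h2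
  have hsurj : Function.Surjective M := by
    refine (LinearMap.injective_iff_surjective_of_finrank_eq_finrank ?_).1 hinj
    rw [Module.finrank_fintype_fun_eq_card, Module.finrank_fintype_fun_eq_card, Fintype.card_coe,
      Fintype.card_coe, card_wtLE_eq_card_strictLE]
  obtain ⟨c, hc⟩ := hsurj fun S => t S
  exact ⟨ext0 c, fun S hS => (hext c S).trans (congrFun hc ⟨S, hS⟩)⟩

/-- The series with the coefficients `c` of weight at most `N`. -/
def truncSeries (N : ℕ) (c : (ℕ →₀ ℕ) → k) : MvPowerSeries ℕ k :=
  fun a => if wt a ≤ N then c a else 0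

theorem coeff_truncSeries (N : ℕ) (c : (ℕ →₀ ℕ) → k) (a : ℕ →₀ ℕ) :
    MvPowerSeries.coeff a (truncSeries N c) = if wt a ≤ N then c a else 0 := rfl

theorem parSum_truncSeries (β : k) (N : ℕ) (c : (ℕ →₀ ℕ) → k) :
    parSum β (truncSeries N c) = ∑ a ∈ wtLE N, c a • pPar β (oddParts a) := by
  ext d
  rw [coeff_parSum, map_sum, finsum_eq_sum_of_support_subset _ (s := wtLE N)]
  · refine Finset.sum_congr rfl fun a ha => ?_
    rw [coeff_truncSeries, if_pos (mem_wtLE.1 ha), map_smul, smul_eq_mul]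
  · intro a ha
    rw [Finset.mem_coe, mem_wtLE]
    by_contra h
    exact ha (by beta_reduce; rw [coeff_truncSeries, if_neg h, zero_mul])

theorem parSum_sub (β : k) (c c' : MvPowerSeries ℕ k) :
    parSum β (c - c') = parSum β c - parSum β c' :=
  MvPowerSeries.subst_sub (hasSubst_powerSumPar β) c c'

theorem parSum_monomial (β : k) (a : ℕ →₀ ℕ) :
    parSum β (MvPowerSeries.monomial a 1) = pPar β (oddParts a) := by
  rw [parSum, MvPowerSeries.subst_monomial (hasSubst_powerSumPar β), pPar_oddParts, map_one]
  exact one_mul _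

theorem coeff_parSum_of_degree_le (β : k) {N : ℕ} {d : ℕ →₀ ℕ} (hd : d.degree ≤ N)
    (c : MvPowerSeries ℕ k) : MvPowerSeries.coeff d (parSum β c) =
      ∑ a ∈ wtLE N, MvPowerSeries.coeff a c * MvPowerSeries.coeff d (pPar β (oddParts a)) := by
  rw [coeff_parSum, finsum_eq_sum_of_support_subset _ (s := wtLE N)]
  intro a ha
  rw [Finset.mem_coe, mem_wtLE]
  by_contra h
  refine ha ?_
  beta_reduce
  rw [(leadForm_pPar β a).1 d (by omega), mul_zero]

theorem coeff_parSum_congr {β : k} {N : ℕ} {c c' : MvPowerSeries ℕ k}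
    (h : ∀ a, wt a ≤ N → MvPowerSeries.coeff a c = MvPowerSeries.coeff a c') {d : ℕ →₀ ℕ}
    (hd : d.degree ≤ N) :
    MvPowerSeries.coeff d (parSum β c) = MvPowerSeries.coeff d (parSum β c') := by
  rw [coeff_parSum_of_degree_le β hd, coeff_parSum_of_degree_le β hd]
  exact Finset.sum_congr rfl fun a ha => by rw [h a (mem_wtLE.1 ha)]

/-- Once the coefficients at strict partitions are matched, the difference lies in `GΓ` and vanishes
up to degree `N`. -/
theorem exists_parSum_approx [CharZero k] {β : k} {f : MvPowerSeries ℕ k} (hf : f ∈ GGamma β)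
    (N : ℕ) : ∃ c : MvPowerSeries ℕ k, ∀ d : ℕ →₀ ℕ, d.degree ≤ N →
      MvPowerSeries.coeff d (parSum β c) = MvPowerSeries.coeff d f := by
  obtain ⟨c, hc⟩ := exists_interpolation (P := fun a => pPar β (oddParts a)) N
    (fun c h a ha => by
      rw [← parSum_truncSeries] at h
      have h1 := eq_zero_of_coeff_parSum (fun d hd => GGamma_eq_zero (parSum_mem β _) h d hd) a
        (mem_wtLE.1 ha)
      rwa [coeff_truncSeries, if_pos (mem_wtLE.1 ha)] at h1)
    fun S => MvPowerSeries.coeff (strictExp S) f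
  rw [← parSum_truncSeries] at hc
  refine ⟨truncSeries N c, fun d hd => sub_eq_zero.1 ?_⟩
  rw [← map_sub]
  refine GGamma_eq_zero ((GGamma β).sub_mem (parSum_mem β _) hf) (fun S hS => ?_) d hd
  rw [map_sub, hc S hS, sub_self]

/-- By uniqueness the coefficient at `a` is the same in all approximations of order at least `wt a`,
so the approximations have a limit. -/
theorem exists_parSum_eq [CharZero k] {β : k} {f : MvPowerSeries ℕ k} (hf : f ∈ GGamma β) :
    ∃ c : MvPowerSeries ℕ k, parSum β c = f := by
  choose c hc using exists_parSum_approx hf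
  have hcoh : ∀ (N : ℕ) (a : ℕ →₀ ℕ), wt a ≤ N →
      MvPowerSeries.coeff a (c (wt a)) = MvPowerSeries.coeff a (c N) := by
    intro N a ha
    rw [← sub_eq_zero, ← map_sub]
    refine eq_zero_of_coeff_parSum (β := β) (N := wt a) (fun d hd => ?_) a le_rfl
    rw [parSum_sub, map_sub, hc _ d hd, hc N d (hd.trans ha), sub_self]
  refine ⟨fun a => MvPowerSeries.coeff a (c (wt a)), ?_⟩
  ext d
  rw [← hc d.degree d le_rfl]
  exact coeff_parSum_congr (N := d.degree) (fun a ha => hcoh _ a ha) le_rfl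

/-- Elements of `GΓ` have unique expansions in the `p_λ^{(β)}`. -/
def parEquiv [CharZero k] (β : k) : MvPowerSeries ℕ k ≃ₗ[k] GGamma β :=
  LinearEquiv.ofBijective
    { toFun := fun c => ⟨parSum β c, parSum_mem β c⟩
      map_add' := fun c c' => Subtype.ext (MvPowerSeries.subst_add (hasSubst_powerSumPar β) c c')
      map_smul' := fun r c => Subtype.ext (MvPowerSeries.subst_smul (hasSubst_powerSumPar β) r c) }
    ⟨by
      rw [injective_iff_map_eq_zero]
      intro c hc
      ext a
      refine eq_zero_of_coeff_parSum (β := β) (N := wt a) (fun d _ => ?_) a le_rfl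
      have : parSum β c = 0 := congrArg Subtype.val hc
      rw [this, map_zero], by
      rintro ⟨f, hf⟩
      obtain ⟨c, hc⟩ := exists_parSum_eq hf
      exact ⟨c, Subtype.ext hc⟩⟩

theorem coe_parEquiv [CharZero k] (β : k) (c : MvPowerSeries ℕ k) :
    (parEquiv β c : MvPowerSeries ℕ k) = parSum β c := rfl

/-- `∑_λ c_λ p_λ^{[β]}`, a finite sum over odd partitions. -/
def brkSum [CharZero k] (β : k) : ((ℕ →₀ ℕ) →₀ k) →ₗ[k] gGamma β :=
  Finsupp.linearCombination k fun a => ⟨pBrk β (oddParts a), pBrk_mem β (isOddPartition_oddParts a)⟩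

theorem brkSum_single [CharZero k] (β : k) (a : ℕ →₀ ℕ) :
    (brkSum β (Finsupp.single a 1) : MvPowerSeries ℕ k) = pBrk β (oddParts a) := by
  rw [brkSum, Finsupp.linearCombination_single, one_smul]

theorem coe_brkSum [CharZero k] (β : k) (c : (ℕ →₀ ℕ) →₀ k) {A : Finset (ℕ →₀ ℕ)}
    (hA : c.support ⊆ A) :
    (brkSum β c : MvPowerSeries ℕ k) = ∑ a ∈ A, c a • pBrk β (oddParts a) := by
  rw [brkSum, Finsupp.linearCombination_apply, Finsupp.sum_of_support_subset _ hA]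
  · rw [AddSubmonoidClass.coe_finsetSum]
    rfl
  · simp

theorem coeff_sum_pBrk_of_lt (β : k) {N : ℕ} (c : (ℕ →₀ ℕ) → k) {d : ℕ →₀ ℕ} (hd : N < d.degree) :
    MvPowerSeries.coeff d (∑ a ∈ wtLE N, c a • pBrk β (oddParts a)) = 0 := by
  rw [map_sum]
  refine Finset.sum_eq_zero fun a ha => ?_
  have := mem_wtLE.1 ha
  rw [map_smul, (leadForm_pBrk β a).1 d (by show wt a < _; omega), smul_zero]

theorem sum_pBrk_mem [CharZero k] (β : k) (A : Finset (ℕ →₀ ℕ)) (c : (ℕ →₀ ℕ) → k) :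
    ∑ a ∈ A, c a • pBrk β (oddParts a) ∈ gGamma β :=
  (gGamma β).sum_mem fun a _ => (gGamma β).smul_mem _ (pBrk_mem β (isOddPartition_oddParts a))

/-- Bounded degree makes a single interpolation exact, with no passage to a limit. -/
theorem exists_sum_pBrk_eq [CharZero k] {β : k} {g : MvPowerSeries ℕ k} (hg : g ∈ gGamma β) :
    ∃ (N : ℕ) (c : (ℕ →₀ ℕ) → k), ∑ a ∈ wtLE N, c a • pBrk β (oddParts a) = g := by
  obtain ⟨N, hN⟩ := hg.2.1
  have hN' : ∀ d : ℕ →₀ ℕ, N < d.degree → MvPowerSeries.coeff d g = 0 := by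
    intro d hd
    by_contra h
    exact absurd (hN d h) (by omega)
  obtain ⟨c, hc⟩ := exists_interpolation (P := fun a => pBrk β (oddParts a)) N
    (fun c h a ha => eq_zero_of_sum_pBrk (gGamma_eq_zero (sum_pBrk_mem β _ c)
      (fun d hd => coeff_sum_pBrk_of_lt β c hd) h) a (mem_wtLE.1 ha))
    fun S => MvPowerSeries.coeff (strictExp S) g
  refine ⟨N, c, sub_eq_zero.1 (gGamma_eq_zero ((gGamma β).sub_mem (sum_pBrk_mem β _ c) hg)
    (N := N) (fun d hd => ?_) fun S hS => ?_)⟩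
  · rw [map_sub, hN' d hd, coeff_sum_pBrk_of_lt β c hd, sub_zero]
  · rw [map_sub, hc S hS, sub_self]

/-- Elements of `gΓ` have unique expansions in the `p_λ^{[β]}`. -/
def brkEquiv [CharZero k] (β : k) : ((ℕ →₀ ℕ) →₀ k) ≃ₗ[k] gGamma β :=
  LinearEquiv.ofBijective (brkSum β)
    ⟨by
      rw [injective_iff_map_eq_zero]
      intro c hc
      ext a
      set N := c.support.sup wt ⊔ wt a with hN
      have hsub : c.support ⊆ wtLE N := fun b hb =>
        mem_wtLE.2 ((Finset.le_sup (f := wt) hb).trans le_sup_left)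
      have h1 := coe_brkSum β c hsub
      rw [hc] at h1
      exact eq_zero_of_sum_pBrk h1.symm a le_sup_right, by
      rintro ⟨g, hg⟩
      obtain ⟨N, c, hc⟩ := exists_sum_pBrk_eq hg
      refine ⟨Finsupp.onFinset (wtLE N) (fun a => if a ∈ wtLE N then c a else 0) fun a ha => ?_,
        Subtype.ext ?_⟩
      · by_contra h
        exact ha (if_neg h)
      · refine (coe_brkSum β _ Finsupp.support_onFinset_subset).trans (Eq.trans ?_ hc)
        refine Finset.sum_congr rfl fun a ha => ?_
        rw [Finsupp.onFinset_apply, if_pos ha]⟩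

theorem brkEquiv_symm_pBrk [CharZero k] {β : k} {g : gGamma β} {a : ℕ →₀ ℕ}
    (h : (g : MvPowerSeries ℕ k) = pBrk β (oddParts a)) :
    (brkEquiv β).symm g = Finsupp.single a 1 := by
  rw [LinearEquiv.symm_apply_eq]
  exact Subtype.ext (h.trans (brkSum_single β a).symm)

theorem parEquiv_symm_pPar [CharZero k] {β : k} {f : GGamma β} {a : ℕ →₀ ℕ}
    (h : (f : MvPowerSeries ℕ k) = pPar β (oddParts a)) :
    (parEquiv β).symm f = MvPowerSeries.monomial a 1 := by
  rw [LinearEquiv.symm_apply_eq]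
  exact Subtype.ext (h.trans (parSum_monomial β a).symm)

/-! ### The bilinear form -/

theorem normW_eq [CharZero k] (a : ℕ →₀ ℕ) : normW k a =
    ((2 : k) ^ Multiset.card (oddParts a))⁻¹ * (zNum (oddParts a) : k) := by
  have hinj : Function.Injective fun i : ℕ => 2 * i + 1 := fun x y h => by
    simp only at h
    omega
  have hcount : ∀ i, (oddParts a).count (2 * i + 1) = a i := by
    intro i
    have := Multiset.count_map_eq_count' (fun i : ℕ => 2 * i + 1) (Finsupp.toMultiset a) hinj i
    rw [Finsupp.count_toMultiset] at this
    exact this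
  have hfin : (oddParts a).toFinset = a.support.image fun i => 2 * i + 1 := by
    rw [oddParts, Multiset.toFinset_map, Finsupp.toFinset_toMultiset]
  rw [card_oddParts, zNum, hfin, Finset.prod_image fun i _ j _ h => hinj h, Finsupp.degree_apply,
    ← Finset.prod_pow_eq_pow_sum, ← Finset.prod_inv_distrib, Nat.cast_prod,
    ← Finset.prod_mul_distrib, normW, Finsupp.prod]
  refine Finset.prod_congr rfl fun i _ => ?_
  rw [hcount, div_pow]
  push_cast
  ring

/-- The form with `⟨p_λ^{(β)}, p_μ^{[β]}⟩ = 2^{-ℓ(λ)} z_λ δ_{λ,μ}`. -/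
def betaForm [CharZero k] (β : k) : GGamma β →ₗ[k] gGamma β →ₗ[k] k :=
  ((Finsupp.linearCombination k fun a => normW k a • MvPowerSeries.coeff (R := k) a) ∘ₗ
    (brkEquiv β).symm.toLinearMap).flip ∘ₗ (parEquiv β).symm.toLinearMap

theorem betaForm_apply [CharZero k] (β : k) (f : GGamma β) (g : gGamma β) :
    betaForm β f g = ((brkEquiv β).symm g).sum fun a r =>
      r * (normW k a * MvPowerSeries.coeff a ((parEquiv β).symm f)) := by
  simp only [betaForm, LinearMap.comp_apply, LinearMap.flip_apply, LinearEquiv.coe_coe,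
    Finsupp.linearCombination_apply, Finsupp.sum, LinearMap.sum_apply, LinearMap.smul_apply,
    smul_eq_mul]

theorem isBetaForm_betaForm [CharZero k] (β : k) : IsBetaForm β (betaForm β) := by
  classical
  refine ⟨fun lam mu hlam hmu f g hf hg => ?_, fun g => ?_⟩
  · obtain ⟨a, rfl⟩ := exists_oddParts hlam
    obtain ⟨b, rfl⟩ := exists_oddParts hmu
    rw [betaForm_apply, brkEquiv_symm_pBrk hg, parEquiv_symm_pPar hf,
      Finsupp.sum_single_index (by rw [zero_mul]), one_mul, MvPowerSeries.coeff_monomial,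
      ← normW_eq]
    by_cases h : b = a
    · subst h; simp
    · rw [if_neg h, if_neg fun h' => h (oddParts_injective h').symm, mul_zero]
  -- Only finitely many products occur in `g`, and an `f` that starts beyond their weights has
  -- vanishing coefficients at all of them.
  · refine ⟨((brkEquiv β).symm g).support.sup wt, fun f hf => ?_⟩
    rw [betaForm_apply]
    refine Finset.sum_eq_zero fun a ha => ?_
    have h1 : MvPowerSeries.coeff a ((parEquiv β).symm f) = 0 := by
      refine eq_zero_of_coeff_parSum (β := β) (fun d hd => ?_) a (Finset.le_sup ha)
      rw [← coe_parEquiv, LinearEquiv.apply_symm_apply]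
      exact hf d hd
    beta_reduce
    rw [h1, mul_zero, mul_zero]

/-- Continuity permits replacing the infinite expansion by its part of weight at most `M`, after
which linearity and the prescribed values decide. This determines the form. -/
theorem IsBetaForm.apply_parSum_pBrk [CharZero k] {β : k} {B : GGamma β →ₗ[k] gGamma β →ₗ[k] k}
    (hB : IsBetaForm β B) (c : MvPowerSeries ℕ k) (b : ℕ →₀ ℕ) :
    B ⟨parSum β c, parSum_mem β c⟩ ⟨pBrk β (oddParts b), pBrk_mem β (isOddPartition_oddParts b)⟩ =
      normW k b * MvPowerSeries.coeff b c := by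
  classical
  set g : gGamma β := ⟨pBrk β (oddParts b), pBrk_mem β (isOddPartition_oddParts b)⟩ with hg
  obtain ⟨N, hN⟩ := hB.2 g
  set M := max N (wt b) with hM
  set p : (ℕ →₀ ℕ) → GGamma β := fun a => ⟨pPar β (oddParts a),
    pPar_mem β (isOddPartition_oddParts a)⟩ with hp
  set c' := truncSeries M fun a => MvPowerSeries.coeff a c with hc'
  have h1 : B ⟨parSum β c, parSum_mem β c⟩ g = B ⟨parSum β c', parSum_mem β c'⟩ g := by
    rw [← sub_eq_zero, ← LinearMap.sub_apply, ← map_sub]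
    refine hN _ fun d hd => ?_
    change MvPowerSeries.coeff d (parSum β c - parSum β c') = 0
    rw [map_sub, sub_eq_zero]
    refine coeff_parSum_congr (N := M) (fun a ha => ?_) (hd.trans (le_max_left _ _))
    rw [hc', coeff_truncSeries, if_pos ha]
  have h2 : (⟨parSum β c', parSum_mem β c'⟩ : GGamma β) =
      ∑ a ∈ wtLE M, MvPowerSeries.coeff a c • p a := by
    refine Subtype.ext ?_
    rw [AddSubmonoidClass.coe_finsetSum]
    exact parSum_truncSeries β M _
  rw [h1, h2, map_sum, LinearMap.sum_apply, Finset.sum_eq_single_of_mem b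
    (mem_wtLE.2 (le_max_right _ _))]
  · rw [map_smul, LinearMap.smul_apply, smul_eq_mul, hB.1 _ _ (isOddPartition_oddParts b)
      (isOddPartition_oddParts b) (p b) g rfl rfl, if_pos rfl, ← normW_eq, mul_comm]
  · intro a _ hab
    rw [map_smul, LinearMap.smul_apply, hB.1 _ _ (isOddPartition_oddParts a)
      (isOddPartition_oddParts b) (p a) g rfl rfl, if_neg fun h => hab (oddParts_injective h),
      smul_zero]

theorem IsBetaForm.apply_sum [CharZero k] {β : k} {B : GGamma β →ₗ[k] gGamma β →ₗ[k] k}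
    (hB : IsBetaForm β B) {f g : MvPowerSeries ℕ k} (hf : f ∈ GGamma β) (hg : g ∈ gGamma β)
    {c : MvPowerSeries ℕ k} (hc : f = parSum β c) {A : Finset (ℕ →₀ ℕ)} {e : (ℕ →₀ ℕ) → k}
    (he : g = ∑ a ∈ A, e a • pBrk β (oddParts a)) :
    B ⟨f, hf⟩ ⟨g, hg⟩ = ∑ a ∈ A, e a * (normW k a * MvPowerSeries.coeff a c) := by
  subst hc
  have h1 : (⟨g, hg⟩ : gGamma β) = ∑ a ∈ A, e a • (⟨pBrk β (oddParts a),
      pBrk_mem β (isOddPartition_oddParts a)⟩ : gGamma β) := by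
    refine Subtype.ext ?_
    rw [AddSubmonoidClass.coe_finsetSum]
    exact he
  rw [h1, map_sum]
  refine Finset.sum_congr rfl fun a _ => ?_
  rw [map_smul, hB.apply_parSum_pBrk, smul_eq_mul]

theorem existsUnique_isBetaForm [CharZero k] (β : k) :
    ∃! B : GGamma β →ₗ[k] gGamma β →ₗ[k] k, IsBetaForm β B := by
  refine ⟨betaForm β, isBetaForm_betaForm β, fun B hB => ?_⟩
  refine LinearMap.ext fun f => LinearMap.ext fun g => ?_
  obtain ⟨f, hf⟩ := f
  obtain ⟨g, hg⟩ := g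
  obtain ⟨c, hc⟩ := exists_parSum_eq hf
  obtain ⟨N, e, he⟩ := exists_sum_pBrk_eq hg
  rw [hB.apply_sum hf hg hc.symm he.symm, (isBetaForm_betaForm β).apply_sum hf hg hc.symm he.symm]

/-! ### Vacuum expectation values -/

theorem expectPar_eq_parSum [CharZero k] (β : k) (v : FockHat k) :
    expectPar β v = parSum β (oddCoeff v) := expectPar_eq β v

theorem expectBrk_eq_sum [CharZero k] (β : k) {D : ℕ} {w : Fock k}
    (hw : (w : FockHat k) ∈ weightLE k D) : expectBrk β w =
      ∑ a ∈ wtLE D, MvPowerSeries.coeff a (oddCoeff (w : FockHat k)) • pBrk β (oddParts a) := by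
  rw [expectBrk_eq β hw]
  simp only [pBrk_oddParts]

/-- Both coefficient series carry a factor `normW⁻¹`; the form removes one of them, and the result
is Parseval's sum. -/
theorem form_expect_eq_braket [CharZero k] (β : k) (v : FockHat k) (w : Fock k) :
    ∃ (hf : expectPar β v ∈ GGamma β) (hg : expectBrk β w ∈ gGamma β),
      (IsEven v ∨ IsEven (w : FockHat k)) →
      ∀ B : GGamma β →ₗ[k] gGamma β →ₗ[k] k, IsBetaForm β B →
        B ⟨expectPar β v, hf⟩ ⟨expectBrk β w, hg⟩ = braket w v := by
  obtain ⟨D, hD⟩ := exists_mem_weightLE w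
  have hf : expectPar β v ∈ GGamma β := by
    rw [expectPar_eq_parSum]
    exact parSum_mem β _
  have hg : expectBrk β w ∈ gGamma β := by
    rw [expectBrk_eq_sum β hD]
    exact sum_pBrk_mem β _ _
  refine ⟨hf, hg, fun heven B hB => ?_⟩
  rw [hB.apply_sum hf hg (expectPar_eq_parSum β v) (expectBrk_eq_sum β hD),
    braket_eq_sum hD v heven]
  refine Finset.sum_congr rfl fun a _ => ?_
  rw [coeff_oddCoeff, coeff_oddCoeff, vacFun_monomial, vacFun_monomial,
    mul_inv_cancel_left₀ (normW_ne_zero a)]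
  ring

/-! ### The Cauchy kernel as an exponential -/

section SumTypes

variable {α γ : Type*}

/-- The exponents of the variables of the first kind. -/
def fstExp (c : α ⊕ γ →₀ ℕ) : α →₀ ℕ := c.comapDomain Sum.inl Sum.inl_injective.injOn

/-- The exponents of the variables of the second kind. -/
def sndExp (c : α ⊕ γ →₀ ℕ) : γ →₀ ℕ := c.comapDomain Sum.inr Sum.inr_injective.injOn

theorem fstExp_apply (c : α ⊕ γ →₀ ℕ) (i : α) : fstExp c i = c (Sum.inl i) := rfl

theorem sndExp_apply (c : α ⊕ γ →₀ ℕ) (i : γ) : sndExp c i = c (Sum.inr i) := rfl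

/-- The exponent vector with given parts. -/
def pairExp (a : α →₀ ℕ) (b : γ →₀ ℕ) : α ⊕ γ →₀ ℕ := a.mapDomain Sum.inl + b.mapDomain Sum.inr

theorem fstExp_pairExp (a : α →₀ ℕ) (b : γ →₀ ℕ) : fstExp (pairExp a b) = a := by
  ext i
  rw [fstExp_apply, pairExp, Finsupp.add_apply, Finsupp.mapDomain_apply Sum.inl_injective,
    Finsupp.mapDomain_of_notMem_range, add_zero]
  simp

theorem sndExp_pairExp (a : α →₀ ℕ) (b : γ →₀ ℕ) : sndExp (pairExp a b) = b := by
  ext i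
  rw [sndExp_apply, pairExp, Finsupp.add_apply, Finsupp.mapDomain_apply Sum.inr_injective,
    Finsupp.mapDomain_of_notMem_range, zero_add]
  simp

theorem pairExp_eta (c : α ⊕ γ →₀ ℕ) : pairExp (fstExp c) (sndExp c) = c := by
  ext i
  rcases i with i | i
  · rw [← fstExp_apply (pairExp _ _), fstExp_pairExp, fstExp_apply]
  · rw [← sndExp_apply (pairExp _ _), sndExp_pairExp, sndExp_apply]

theorem prod_eq_prod_fst_mul_prod_snd {M : Type*} [CommMonoid M] (c : α ⊕ γ →₀ ℕ)
    (h : α ⊕ γ → ℕ → M) : c.prod h =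
      ((fstExp c).prod fun i => h (Sum.inl i)) * (sndExp c).prod fun i => h (Sum.inr i) := by
  have hs : c.support = (fstExp c).support.disjSum (sndExp c).support := by
    ext i
    rcases i with i | i
    · rw [Finset.inl_mem_disjSum, Finsupp.mem_support_iff, Finsupp.mem_support_iff, fstExp_apply]
    · rw [Finset.inr_mem_disjSum, Finsupp.mem_support_iff, Finsupp.mem_support_iff, sndExp_apply]
  rw [Finsupp.prod, hs, Finset.prod_disjSum]
  rfl

theorem coeff_expSeries_sumType {R : Type*} [CommRing R] [Algebra k R] (u : α ⊕ γ → R)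
    (c : α ⊕ γ →₀ ℕ) : MvPowerSeries.coeff c (expSeries k u) =
      MvPowerSeries.coeff (fstExp c) (expSeries k fun i => u (Sum.inl i)) *
        MvPowerSeries.coeff (sndExp c) (expSeries k fun i => u (Sum.inr i)) := by
  rw [coeff_expSeries, coeff_expSeries, coeff_expSeries, prod_eq_prod_fst_mul_prod_snd]

theorem coeff_expSeries_map {R R' : Type*} [CommRing R] [Algebra k R] [CommRing R'] [Algebra k R']
    (φ : R →ₐ[k] R') (u : α → R) (c : α →₀ ℕ) :
    MvPowerSeries.coeff c (expSeries k fun i => φ (u i)) =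
      φ (MvPowerSeries.coeff c (expSeries k u)) := by
  rw [coeff_expSeries, coeff_expSeries, Finsupp.prod, Finsupp.prod, map_prod]
  simp only [map_smul, map_pow]

theorem finsum_sumType {M : Type*} [AddCommMonoid M] {f : α ⊕ γ → M}
    (hf : (Function.support f).Finite) :
    ∑ᶠ s, f s = ∑ᶠ i, f (Sum.inl i) + ∑ᶠ i, f (Sum.inr i) := by
  have h1 : f = fun s => Sum.elim (fun i => f (Sum.inl i)) (fun _ => 0) s +
      Sum.elim (fun _ => 0) (fun i => f (Sum.inr i)) s := by
    funext s
    rcases s with s | s <;> simp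
  conv_lhs => rw [h1]
  rw [finsum_add_distrib]
  · rw [finsum_of_injective Sum.inl_injective, finsum_of_injective Sum.inr_injective]
    · simp
    · rintro (s | s) h
      · rfl
      · exact absurd ⟨s, rfl⟩ h
    · rintro (s | s) h
      · exact absurd ⟨s, rfl⟩ h
      · rfl
  · refine hf.subset ?_
    rintro (s | s) h
    · exact h
    · exact absurd rfl h
  · refine hf.subset ?_
    rintro (s | s) h
    · exact absurd rfl h
    · exact h

theorem hasSubst_sumElim {τ : Type*} {p : α → MvPowerSeries τ k} {q : γ → MvPowerSeries τ k}
    (hp : MvPowerSeries.HasSubst p) (hq : MvPowerSeries.HasSubst q) :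
    MvPowerSeries.HasSubst (Sum.elim p q) where
  const_coeff s := by
    rcases s with s | s
    · exact hp.const_coeff s
    · exact hq.const_coeff s
  coeff_zero d := by
    refine (((hp.coeff_zero d).image Sum.inl).union ((hq.coeff_zero d).image Sum.inr)).subset ?_
    rintro (s | s) h
    · exact Or.inl ⟨s, h, rfl⟩
    · exact Or.inr ⟨s, h, rfl⟩

theorem finite_support_coeff_smul {σ τ R : Type*} [AddCommGroup R] [Module k R]
    {p : σ → MvPowerSeries τ k} (hp : MvPowerSeries.HasSubst p) (u : σ → R) (d : τ →₀ ℕ) :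
    (Function.support fun s => MvPowerSeries.coeff d (p s) • u s).Finite := by
  refine (hp.coeff_zero d).subset fun s hs h => hs ?_
  beta_reduce
  rw [h, zero_smul]

end SumTypes

theorem fockLE_mono {D D' : ℕ} (h : D ≤ D') : fockLE k D ≤ fockLE k D' :=
  fun _ hv S hS => (hv S hS).trans h

theorem exists_mem_fockLE (w : Fock k) : ∃ D, w ∈ fockLE k D :=
  ⟨w.support.sup fun S => ∑ s ∈ S, s, fun _ hS =>
    Finset.le_sup (f := fun S => ∑ s ∈ S, s) (Finsupp.mem_support_iff.2 hS)⟩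

theorem pair_vac (w : Fock k) : pair vac w = w ∅ := by
  have : (pair vac : Fock k →ₗ[k] k) = Finsupp.lapply ∅ := by
    refine linearMap_ext_ket fun S => ?_
    rw [pair_ket, Finsupp.lapply_apply, ket_apply, vac]
  rw [this, Finsupp.lapply_apply]

/-- The functional `P(b₁, b₃, …) Q(b_{-1}, b_{-3}, …) ↦ ⟨0| P Q |0⟩`; the variables of the first
kind stand for `b₁, b₃, …`, those of the second kind for `b_{-1}, b_{-3}, …`. -/
def wickFun [CharZero k] : MvPolynomial (ℕ ⊕ ℕ) k →ₗ[k] k :=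
  (MvPolynomial.basisMonomials (ℕ ⊕ ℕ) k).constr k fun c =>
    if sndExp c = fstExp c then normW k (sndExp c) else 0

/-- Both sides are bilinear, so monomials suffice. Packaging the vacuum expectation as one linear
functional on polynomials in both kinds of generators makes the substitution principle for
exponentials applicable to the product of two exponentials. -/
theorem wickFun_rename [CharZero k] (P Q : MvPolynomial ℕ k) :
    wickFun (MvPolynomial.rename Sum.inl P * MvPolynomial.rename Sum.inr Q) =
      (rhoNeg Q (rho P (ket ∅ : Fock k))) ∅ := by
  let F : MvPolynomial ℕ k →ₗ[k] MvPolynomial ℕ k →ₗ[k] k :=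
    ((LinearMap.mul k (MvPolynomial (ℕ ⊕ ℕ) k)).compl₁₂
      (MvPolynomial.rename Sum.inl).toLinearMap (MvPolynomial.rename Sum.inr).toLinearMap).compr₂
        wickFun
  let G : MvPolynomial ℕ k →ₗ[k] MvPolynomial ℕ k →ₗ[k] k :=
    LinearMap.mk₂ k (fun P Q => (rhoNeg Q (rho P (ket ∅ : Fock k))) ∅)
      (fun P P' Q => by simp only [map_add, LinearMap.add_apply, Finsupp.add_apply])
      (fun c P Q => by simp only [map_smul, LinearMap.smul_apply, Finsupp.smul_apply])
      (fun P Q Q' => by simp only [map_add, LinearMap.add_apply, Finsupp.add_apply])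
      (fun c P Q => by simp only [map_smul, LinearMap.smul_apply, Finsupp.smul_apply])
  have hF : ∀ P Q, F P Q =
      wickFun (MvPolynomial.rename Sum.inl P * MvPolynomial.rename Sum.inr Q) := fun _ _ => rfl
  have hG : ∀ P Q, G P Q = (rhoNeg Q (rho P (ket ∅ : Fock k))) ∅ := fun _ _ => rfl
  have h : F = G := by
    refine (MvPolynomial.basisMonomials ℕ k).ext fun a => ?_
    refine (MvPolynomial.basisMonomials ℕ k).ext fun b => ?_
    rw [hF, hG, MvPolynomial.coe_basisMonomials]
    rw [rhoNeg_rho_vac, MvPolynomial.rename_monomial, MvPolynomial.rename_monomial,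
      MvPolynomial.monomial_mul, mul_one]
    rw [← pairExp]
    have h1 : (MvPolynomial.monomial (pairExp a b) 1 : MvPolynomial (ℕ ⊕ ℕ) k) =
        MvPolynomial.basisMonomials (ℕ ⊕ ℕ) k (pairExp a b) := by
      rw [MvPolynomial.coe_basisMonomials]
    rw [h1, wickFun, Module.Basis.constr_basis, fstExp_pairExp, sndExp_pairExp]
  rw [← hF, ← hG, h]

/-- The exponents of `e^{H^{(β)}} e^{H^{(β)}_-}`, up to terms of high weight. -/
def cauchyVars (β : k) (D : ℕ) : ℕ+ ⊕ ℕ+ → MvPolynomial (ℕ ⊕ ℕ) k :=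
  Sum.elim (fun m => MvPolynomial.rename Sum.inl (posExp β m))
    fun m => MvPolynomial.rename Sum.inr (negExp β D m)

theorem cauchyExp_eq [CharZero k] (β : k) {D : ℕ} (d : ℕ+ ⊕ ℕ+ →₀ ℕ)
    (hD : rho (MvPowerSeries.coeff (fstExp d) (expSeries k (posExp β))) (ket ∅) ∈ fockLE k D) :
    MvPowerSeries.coeff d (cauchyExp β) =
      wickFun (MvPowerSeries.coeff d (expSeries k (cauchyVars β D))) := by
  rw [coeff_expSeries_sumType]
  simp only [cauchyVars, Sum.elim_inl, Sum.elim_inr]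
  rw [coeff_expSeries_map (MvPolynomial.rename Sum.inl), coeff_expSeries_map
    (MvPolynomial.rename Sum.inr), wickFun_rename, ← pair_vac, ← pair_exp_bParNeg β vac hD,
    ← pair_exp_bPar, pair_ket]
  rfl

/-- The substitution of the power sums for the two families of variables. -/
def powerSums₂ (k : Type*) [Field k] : ℕ+ ⊕ ℕ+ → MvPowerSeries (ℕ ⊕ ℕ) k :=
  Sum.elim (fun n : ℕ+ => powerSum k (Sum.inl : ℕ → ℕ ⊕ ℕ) (n : ℕ))
    fun n : ℕ+ => powerSum k (Sum.inr : ℕ → ℕ ⊕ ℕ) (n : ℕ)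

theorem hasSubst_powerSums₂ : MvPowerSeries.HasSubst (powerSums₂ k) :=
  hasSubst_sumElim (hasSubst_powerSum Sum.inl_injective) (hasSubst_powerSum Sum.inr_injective)

/-- A single coefficient in `x` and `y` involves only finitely many exponents `d`, so one truncation
level serves them all. It can be taken above any given `D₀`. -/
theorem exists_coeff_cauchyExpect [CharZero k] (β : k) (e : ℕ ⊕ ℕ →₀ ℕ) (D₀ : ℕ) :
    ∃ D, D₀ ≤ D ∧ MvPowerSeries.coeff e (cauchyExpect β) =
      MvPowerSeries.coeff e (MvPowerSeries.subst (powerSums₂ k)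
        (mapCoeff wickFun (expSeries k (cauchyVars β D)))) := by
  have hp := hasSubst_powerSums₂ (k := k)
  -- A series with all coefficients equal to `1`: finiteness of its substitution says that only
  -- finitely many `d` contribute at `e`.
  set A : MvPowerSeries (ℕ+ ⊕ ℕ+) k := fun _ => 1 with hA
  have hfin : (Function.support fun d : ℕ+ ⊕ ℕ+ →₀ ℕ => MvPowerSeries.coeff d A •
      MvPowerSeries.coeff e (d.prod fun s n => powerSums₂ k s ^ n)).Finite :=
    MvPowerSeries.coeff_subst_finite hp A e
  choose D' hD' using fun d : ℕ+ ⊕ ℕ+ →₀ ℕ => exists_mem_fockLE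
    (rho (MvPowerSeries.coeff (fstExp d) (expSeries k (posExp β))) (ket ∅))
  refine ⟨D₀ ⊔ hfin.toFinset.sup D', le_sup_left, ?_⟩
  rw [cauchyExpect, MvPowerSeries.coeff_subst hp]
  change MvPowerSeries.coeff e (MvPowerSeries.subst (powerSums₂ k) (cauchyExp β)) = _
  rw [MvPowerSeries.coeff_subst hp]
  refine finsum_congr fun d => ?_
  by_cases h : MvPowerSeries.coeff e (d.prod fun s n => powerSums₂ k s ^ n) = 0
  · rw [h, smul_zero, smul_zero]
  · rw [coeff_mapCoeff, cauchyExp_eq]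
    refine fockLE_mono (le_trans ?_ le_sup_right) (hD' d)
    refine Finset.le_sup (f := D') ?_
    rw [Set.Finite.mem_toFinset, Function.mem_support]
    have h1 : MvPowerSeries.coeff d A = 1 := rfl
    rw [h1, one_smul]
    exact h

/-- The odd power sums `p_{2i+1}^{(β)}(x)` and `p_{2i+1}^{[β]}(y)`. -/
def oddSums₂ (β : k) (D : ℕ) : ℕ ⊕ ℕ → MvPowerSeries (ℕ ⊕ ℕ) k :=
  Sum.elim (fun i => sumVars Sum.inl (xPar β ^ (2 * i + 1)))
    fun i => sumVars Sum.inr (if i < D then xBrk β (2 * i + 1) else 0)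

theorem hasSubst_oddSums₂ (β : k) (D : ℕ) : MvPowerSeries.HasSubst (oddSums₂ β D) :=
  hasSubst_sumElim (hasSubst_xPar Sum.inl_injective β) (hasSubst_xBrk Sum.inr_injective β D)

/-- The scaled variables. -/
def oddVars₂ (k : Type*) [Field k] : ℕ ⊕ ℕ → MvPolynomial (ℕ ⊕ ℕ) k :=
  Sum.elim (fun i => (2 / (2 * i + 1) : k) • MvPolynomial.X (Sum.inl i))
    fun i => (2 / (2 * i + 1) : k) • MvPolynomial.X (Sum.inr i)

theorem subst_powerSums₂ [CharZero k] (β : k) (D : ℕ) :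
    MvPowerSeries.subst (powerSums₂ k) (mapCoeff wickFun (expSeries k (cauchyVars β D))) =
      MvPowerSeries.subst (oddSums₂ β D) (mapCoeff wickFun (expSeries k (oddVars₂ k))) := by
  refine subst_functional_expSeries_congr wickFun hasSubst_powerSums₂ (hasSubst_oddSums₂ β D)
    fun d => ?_
  rw [finsum_sumType (finite_support_coeff_smul hasSubst_powerSums₂ _ d),
    finsum_sumType (finite_support_coeff_smul (hasSubst_oddSums₂ β D) _ d)]
  simp only [powerSums₂, cauchyVars, oddSums₂, oddVars₂, Sum.elim_inl, Sum.elim_inr]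
  rw [← finsum_posCoeff Sum.inl_injective β, ← finsum_negCoeff Sum.inr_injective β]
  simp only [posExp, posPoly, negExp, negPoly, map_smul, map_sum, MvPolynomial.rename_X]

theorem coeff_mapCoeff_wickFun [CharZero k] (c : ℕ ⊕ ℕ →₀ ℕ) :
    MvPowerSeries.coeff c (mapCoeff wickFun (expSeries k (oddVars₂ k))) =
      if sndExp c = fstExp c then (normW k (sndExp c))⁻¹ else 0 := by
  rw [coeff_mapCoeff, coeff_expSeries_sumType]
  have h1 : (fun i => oddVars₂ k (Sum.inl i)) = fun i : ℕ =>
      (MvPolynomial.rename Sum.inl : MvPolynomial ℕ k →ₐ[k] MvPolynomial (ℕ ⊕ ℕ) k)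
        ((2 / (2 * i + 1) : k) • MvPolynomial.X i) := by
    funext i
    rw [map_smul, MvPolynomial.rename_X]
    rfl
  have h2 : (fun i => oddVars₂ k (Sum.inr i)) = fun i : ℕ =>
      (MvPolynomial.rename Sum.inr : MvPolynomial ℕ k →ₐ[k] MvPolynomial (ℕ ⊕ ℕ) k)
        ((2 / (2 * i + 1) : k) • MvPolynomial.X i) := by
    funext i
    rw [map_smul, MvPolynomial.rename_X]
    rfl
  rw [h1, h2, coeff_expSeries_map, coeff_expSeries_map, wickFun_rename, coeff_expSeries_monomial,
    coeff_expSeries_monomial]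
  simp only [map_smul, LinearMap.smul_apply, Finsupp.smul_apply, rhoNeg_rho_vac, smul_eq_mul]
  split_ifs with h
  · have := normW_ne_zero (k := k) (sndExp c)
    rw [h] at this ⊢
    field_simp
  · simp

/-- The products `p_{2i+1}^{(β)}(x) p_{2i+1}^{[β]}(y)`. -/
def oddProds (β : k) (D : ℕ) (i : ℕ) : MvPowerSeries (ℕ ⊕ ℕ) k :=
  sumVars Sum.inl (xPar β ^ (2 * i + 1)) *
    sumVars Sum.inr (if i < D then xBrk β (2 * i + 1) else 0)

theorem hasSubst_oddProds (β : k) (D : ℕ) : MvPowerSeries.HasSubst (oddProds β D) :=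
  MvPowerSeries.HasSubst.mul_left (fun i => sumVars Sum.inl (xPar β ^ (2 * i + 1)))
    (hasSubst_xBrk Sum.inr_injective β D)

theorem coeff_expSeries_scalar (a : ℕ →₀ ℕ) :
    MvPowerSeries.coeff a (expSeries k fun i : ℕ => (2 / (2 * i + 1) : k)) = (normW k a)⁻¹ := by
  rw [coeff_expSeries, normW, Finsupp.prod, Finsupp.prod, ← Finset.prod_inv_distrib]
  refine Finset.prod_congr rfl fun i _ => ?_
  rw [smul_eq_mul, mul_inv, ← inv_pow, inv_div, mul_comm]

/-- By orthogonality only equal exponents in the two families survive, and the double series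
collapses to an exponential of the products `p_n^{(β)}(x) p_n^{[β]}(y)`. -/
theorem subst_oddSums₂ [CharZero k] (β : k) (D : ℕ) :
    MvPowerSeries.subst (oddSums₂ β D) (mapCoeff wickFun (expSeries k (oddVars₂ k))) =
      MvPowerSeries.subst (oddProds β D) (expSeries k fun i : ℕ => (2 / (2 * i + 1) : k)) := by
  ext e
  rw [MvPowerSeries.coeff_subst (hasSubst_oddSums₂ β D),
    MvPowerSeries.coeff_subst (hasSubst_oddProds β D),
    finsum_of_injective (g := fun a : ℕ →₀ ℕ => pairExp a a)]
  · refine finsum_congr fun a => ?_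
    rw [coeff_mapCoeff_wickFun, fstExp_pairExp, sndExp_pairExp, if_pos rfl, coeff_expSeries_scalar,
      prod_eq_prod_fst_mul_prod_snd, fstExp_pairExp, sndExp_pairExp, ← Finsupp.prod_mul]
    simp only [oddSums₂, oddProds, Sum.elim_inl, Sum.elim_inr, mul_pow]
  · intro a b h
    have h' : pairExp a a = pairExp b b := h
    rw [← fstExp_pairExp a a, h', fstExp_pairExp]
  · intro c hc
    rw [coeff_mapCoeff_wickFun, if_neg, zero_smul]
    intro h
    refine hc ⟨fstExp c, ?_⟩
    conv_rhs => rw [← pairExp_eta c, h]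

/-- The coefficients of the logarithm of the Cauchy kernel. -/
theorem exists_coeff_cauchyExpect_eq_exp [CharZero k] (β : k) (e : ℕ ⊕ ℕ →₀ ℕ) (D₀ : ℕ) :
    ∃ D, D₀ ≤ D ∧ MvPowerSeries.coeff e (cauchyExpect β) =
      MvPowerSeries.coeff e (PowerSeries.subst (∑ i ∈ Finset.range D, (2 / (2 * i + 1) : k) •
        (sumVars Sum.inl (xPar β ^ (2 * i + 1)) * sumVars Sum.inr (xBrk β (2 * i + 1)) :
          MvPowerSeries (ℕ ⊕ ℕ) k)) (PowerSeries.exp k)) := by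
  obtain ⟨D, hD, h⟩ := exists_coeff_cauchyExpect β e D₀
  refine ⟨D, hD, ?_⟩
  have hq := hasSubst_oddProds β D
  rw [h, subst_powerSums₂, subst_oddSums₂, subst_expSeries hq]
  congr 2
  ext d
  rw [coeff_subst_linSeries hq, map_sum, finsum_eq_sum_of_support_subset _ (s := Finset.range D)]
  · refine Finset.sum_congr rfl fun i hi => ?_
    rw [map_smul, smul_eq_mul, oddProds, if_pos (Finset.mem_range.1 hi)]
  · intro i hi
    by_contra hn
    refine hi ?_
    rw [Finset.mem_coe, Finset.mem_range] at hn
    beta_reduce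
    have h0 : (sumVars Sum.inr (0 : PowerSeries k) : MvPowerSeries (ℕ ⊕ ℕ) k) = 0 := by
      ext d
      rw [map_zero]
      change ∑ᶠ i : ℕ, _ = _
      refine finsum_eq_zero_of_forall_eq_zero fun j => ?_
      rw [← PowerSeries.coe_substAlgHom (PowerSeries.HasSubst.X _), map_zero, map_zero]
    rw [oddProds, if_neg hn, h0, mul_zero, map_zero, mul_zero]

/-! ### Exponentials and logarithms -/

/-- The universal case of two independent variables is the binomial identity for factorials; the
general case follows by substitution. -/
theorem subst_exp_add [CharZero k] {τ : Type*} {a b : MvPowerSeries τ k}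
    (ha : MvPowerSeries.constantCoeff a = 0) (hb : MvPowerSeries.constantCoeff b = 0) :
    PowerSeries.subst (a + b) (PowerSeries.exp k) =
      PowerSeries.subst a (PowerSeries.exp k) * PowerSeries.subst b (PowerSeries.exp k) := by
  have h : PowerSeries.subst (MvPowerSeries.X (R := k) (0 : Fin 2) + MvPowerSeries.X 1)
      (PowerSeries.exp k) = PowerSeries.subst (MvPowerSeries.X (R := k) (0 : Fin 2))
        (PowerSeries.exp k) * PowerSeries.subst (MvPowerSeries.X (R := k) (1 : Fin 2))
        (PowerSeries.exp k) := by
    ext e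
    rw [PowerSeries.coeff_subst_X_zero_add_X_one, PowerSeries.coeff_subst_X_zero_subst_mul_X_one,
      PowerSeries.coeff_exp, PowerSeries.coeff_exp, PowerSeries.coeff_exp,
      Nat.cast_choose k (Nat.le_add_right _ _), Nat.add_sub_cancel_left]
    have h0 := Nat.cast_ne_zero (R := k).2 (Nat.factorial_ne_zero (e 0))
    have h1 := Nat.cast_ne_zero (R := k).2 (Nat.factorial_ne_zero (e 1))
    have h2 := Nat.cast_ne_zero (R := k).2 (Nat.factorial_ne_zero (e 0 + e 1))
    simp only [one_div, map_inv₀, map_natCast]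
    field_simp
  have hv : MvPowerSeries.HasSubst ![a, b] :=
    MvPowerSeries.hasSubst_of_constantCoeff_zero fun i => by fin_cases i <;> simpa
  have hX : ∀ i : Fin 2, MvPowerSeries.subst ![a, b] (MvPowerSeries.X (R := k) i) = ![a, b] i :=
    fun i => MvPowerSeries.subst_X hv i
  have hc : ∀ p : MvPowerSeries (Fin 2) k, MvPowerSeries.constantCoeff p = 0 →
      MvPowerSeries.subst ![a, b] (PowerSeries.subst p (PowerSeries.exp k)) =
        PowerSeries.subst (MvPowerSeries.subst ![a, b] p) (PowerSeries.exp k) := fun p hp =>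
    MvPowerSeries.subst_comp_subst_apply (PowerSeries.HasSubst.of_constantCoeff_zero hp).const hv _
  have h' := congrArg (MvPowerSeries.subst ![a, b]) h
  rw [MvPowerSeries.subst_mul hv, hc _ (by simp), hc _ (by simp), hc _ (by simp),
    MvPowerSeries.subst_add hv, hX, hX] at h'
  exact h'

theorem subst_exp_zero [CharZero k] {τ : Type*} :
    PowerSeries.subst (0 : MvPowerSeries τ k) (PowerSeries.exp k) = 1 := by
  rw [PowerSeries.subst_zero_eq_C_constantCoeff, PowerSeries.constantCoeff_exp, map_one, map_one]

theorem subst_exp_sum [CharZero k] {τ ι : Type*} (s : Finset ι) {a : ι → MvPowerSeries τ k}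
    (ha : ∀ i, MvPowerSeries.constantCoeff (a i) = 0) :
    PowerSeries.subst (∑ i ∈ s, a i) (PowerSeries.exp k) =
      ∏ i ∈ s, PowerSeries.subst (a i) (PowerSeries.exp k) := by
  classical
  induction s using Finset.induction_on with
  | empty => rw [Finset.sum_empty, Finset.prod_empty, subst_exp_zero]
  | insert i s hi ih =>
    rw [Finset.sum_insert hi, Finset.prod_insert hi, subst_exp_add (ha i), ih]
    rw [map_sum]
    exact Finset.sum_eq_zero fun i _ => ha i

/-- The series `log ((1 + t) / (1 - t)) = ∑ 2 t^n / n`, over odd `n`. -/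
def logQuot (k : Type*) [Field k] : PowerSeries k :=
  PowerSeries.mk fun n => if Odd n then (2 / n : k) else 0

theorem constantCoeff_logQuot : PowerSeries.constantCoeff (logQuot k) = 0 := by
  rw [← PowerSeries.coeff_zero_eq_constantCoeff_apply, logQuot, PowerSeries.coeff_mk]
  simp

theorem hasSubst_logQuot : PowerSeries.HasSubst (logQuot k) :=
  PowerSeries.HasSubst.of_constantCoeff_zero' constantCoeff_logQuot

theorem derivative_logQuot [CharZero k] :
    (1 - PowerSeries.X ^ 2) * PowerSeries.derivative k (logQuot k) = 2 := by
  have h : PowerSeries.derivative k (logQuot k) =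
      PowerSeries.mk fun n => if Even n then (2 : k) else 0 := by
    ext n
    rw [PowerSeries.coeff_derivative, logQuot, PowerSeries.coeff_mk, PowerSeries.coeff_mk]
    by_cases hn : Even n
    · rw [if_pos hn, if_pos hn.add_one, Nat.cast_add_one, div_mul_cancel₀]
      exact Nat.cast_add_one_ne_zero n
    · rw [if_neg hn, if_neg (by rwa [Nat.odd_add_one, Nat.not_odd_iff_even]), zero_mul]
  rw [h]
  ext n
  have h2 : (2 : PowerSeries k) = PowerSeries.C 2 := (map_ofNat _ 2).symm
  rw [sub_mul, one_mul, map_sub, PowerSeries.coeff_X_pow_mul', h2, PowerSeries.coeff_C]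
  rcases n with _ | _ | n
  · simp
  · simp
  · rw [if_pos (by omega), show n + 1 + 1 - 2 = n by omega, PowerSeries.coeff_mk, PowerSeries.coeff_mk,
      if_neg (Nat.succ_ne_zero (n + 1))]
    simp [Nat.even_add_one]

/-- With `E` the exponential and `L` the logarithm, `E' = E L'` and `(1 - X²) L' = 2`. Hence `(1 -
X) E / (1 + X)` has derivative zero and constant term `1`. -/
theorem exp_logQuot [CharZero k] :
    (1 - PowerSeries.X) * PowerSeries.subst (logQuot k) (PowerSeries.exp k) =
      1 + PowerSeries.X := by
  set E := PowerSeries.subst (logQuot k) (PowerSeries.exp k) with hE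
  set D := PowerSeries.derivative k (logQuot k) with hD
  have hdE : PowerSeries.derivative k E = E * D := by
    rw [hE, PowerSeries.derivative_subst hasSubst_logQuot, PowerSeries.derivative_exp]
  have hD2 := derivative_logQuot (k := k)
  rw [← hD] at hD2
  set u : PowerSeries k := 1 + PowerSeries.X with hu
  have hu0 : PowerSeries.constantCoeff u ≠ 0 := by simp [hu]
  have huu : u * u⁻¹ = 1 := PowerSeries.mul_inv_cancel _ hu0
  have hdu : PowerSeries.derivative k u = 1 := by
    rw [hu, map_add, PowerSeries.derivative_X, PowerSeries.derivative_one, zero_add]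
  have hdv : PowerSeries.derivative k (1 - PowerSeries.X : PowerSeries k) = -1 := by
    rw [map_sub, PowerSeries.derivative_X, PowerSeries.derivative_one, zero_sub]
  have h1 : (1 - PowerSeries.X) * E * u⁻¹ = 1 := by
    refine PowerSeries.derivative.ext ?_ ?_
    · rw [PowerSeries.derivative_one, Derivation.leibniz, Derivation.leibniz,
        PowerSeries.derivative_inv', hdu, hdv, hdE]
      simp only [smul_eq_mul]
      have hux : u = 1 + PowerSeries.X := hu
      linear_combination (-(1 - PowerSeries.X) * E * D * u⁻¹) * huu +
        E * u⁻¹ ^ 2 * hD2 + ((1 - PowerSeries.X) * E * D * u⁻¹ ^ 2 - u⁻¹ ^ 2 * E) * hux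
          + E * u⁻¹ * huu
    · have hEc : PowerSeries.constantCoeff E = 1 := by
        have h0 : PowerSeries.constantCoeff (PowerSeries.subst (logQuot k)
            (PowerSeries.exp k - 1)) = 0 :=
          PowerSeries.constantCoeff_subst_eq_zero constantCoeff_logQuot _ (by simp)
        rwa [PowerSeries.subst_sub hasSubst_logQuot, ← PowerSeries.coe_substAlgHom hasSubst_logQuot,
          map_one, PowerSeries.coe_substAlgHom, map_sub, ← hE, map_one, sub_eq_zero] at h0
      simp [hEc, hu]
  linear_combination u * h1 - (1 - PowerSeries.X) * E * huu

theorem exp_subst_logQuot [CharZero k] {τ : Type*} {a : MvPowerSeries τ k}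
    (ha : MvPowerSeries.constantCoeff a = 0) :
    (1 - a) * PowerSeries.subst (PowerSeries.subst a (logQuot k)) (PowerSeries.exp k) = 1 + a := by
  have hs : PowerSeries.HasSubst a := PowerSeries.HasSubst.of_constantCoeff_zero ha
  have h := congrArg (PowerSeries.substAlgHom hs) (exp_logQuot (k := k))
  rw [map_mul, map_sub, map_add, map_one, PowerSeries.coe_substAlgHom,
    PowerSeries.subst_comp_subst_apply hasSubst_logQuot hs, PowerSeries.subst_X hs] at h
  exact h

theorem constantCoeff_subst_logQuot {τ : Type*} {a : MvPowerSeries τ k}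
    (ha : MvPowerSeries.constantCoeff a = 0) :
    MvPowerSeries.constantCoeff (PowerSeries.subst a (logQuot k)) = 0 :=
  PowerSeries.constantCoeff_subst_eq_zero ha _ constantCoeff_logQuot

/-- The variable `x_i / (1 + β x_i / 2)`. -/
def parVar (β : k) (i : ℕ) : MvPowerSeries (ℕ ⊕ ℕ) k :=
  PowerSeries.subst (MvPowerSeries.X (R := k) (Sum.inl i : ℕ ⊕ ℕ)) (xPar β)

theorem parVar_mul (β : k) (i : ℕ) :
    parVar β i * (1 + MvPowerSeries.C (β / 2) * MvPowerSeries.X (Sum.inl i)) =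
      MvPowerSeries.X (Sum.inl i) :=
  subst_xPar_mul β (MvPowerSeries.constantCoeff_X _)

theorem constantCoeff_parVar (β : k) (i : ℕ) : MvPowerSeries.constantCoeff (parVar β i) = 0 :=
  PowerSeries.constantCoeff_subst_eq_zero (MvPowerSeries.constantCoeff_X _) _ (by simp [xPar])

/-- The logarithm of `(1 - x̄_i y_j) / (1 - x_i y_j)`. -/
def cauchyLog (β : k) (ij : ℕ × ℕ) : MvPowerSeries (ℕ ⊕ ℕ) k :=
  PowerSeries.subst (parVar β ij.1 * (MvPowerSeries.X (Sum.inr ij.2) + MvPowerSeries.C (β / 2)))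
    (logQuot k) - PowerSeries.subst (parVar β ij.1 * MvPowerSeries.C (β / 2)) (logQuot k)

theorem constantCoeff_cauchyLog (β : k) (ij : ℕ × ℕ) :
    MvPowerSeries.constantCoeff (cauchyLog β ij) = 0 := by
  rw [cauchyLog, map_sub, constantCoeff_subst_logQuot, constantCoeff_subst_logQuot, sub_zero] <;>
  rw [map_mul, constantCoeff_parVar, zero_mul]

/-- With `b = β/2` and `u(1 + bx) = x`, the exponential is `(1+u(y+b))(1-ub) / ((1-u(y+b))(1+ub))`.
Multiplying each factor by `1 + bx` gives `(1+2bx+xy) / ((1-xy)(1+2bx))`, which is the factor since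
`1 - x̄y = 1 + xy/(1+2bx)`. -/
theorem exp_cauchyLog [CharZero k] (β : k) (ij : ℕ × ℕ) :
    PowerSeries.subst (cauchyLog β ij) (PowerSeries.exp k) = cauchyFactor β ij := by
  obtain ⟨i, j⟩ := ij
  have hθ := constantCoeff_cauchyLog β (i, j)
  have hβ : MvPowerSeries.C β = (2 : MvPowerSeries (ℕ ⊕ ℕ) k) * MvPowerSeries.C (β / 2) := by
    rw [two_mul, ← map_add, add_halves]
  have hu := parVar_mul β i
  have hu0 := constantCoeff_parVar β i
  have ha : MvPowerSeries.constantCoeff (parVar β i *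
      (MvPowerSeries.X (Sum.inr j) + MvPowerSeries.C (β / 2))) = 0 := by
    rw [map_mul, hu0, zero_mul]
  have hc : MvPowerSeries.constantCoeff (parVar β i * MvPowerSeries.C (β / 2)) = 0 := by
    rw [map_mul, hu0, zero_mul]
  have hEa := exp_subst_logQuot ha
  have hEc := exp_subst_logQuot hc
  have hadd := subst_exp_add hθ (constantCoeff_subst_logQuot hc)
  rw [cauchyLog, sub_add_cancel, ← cauchyLog] at hadd
  rw [hadd] at hEa
  rw [cauchyFactor, hβ]
  have hx0 : MvPowerSeries.constantCoeff
    (MvPowerSeries.X (Sum.inl i) : MvPowerSeries (ℕ ⊕ ℕ) k) = 0 := MvPowerSeries.constantCoeff_X _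
  dsimp only at hEa hEc ⊢
  generalize PowerSeries.subst (cauchyLog β (i, j)) (PowerSeries.exp k) = T at *
  generalize PowerSeries.subst (PowerSeries.subst (parVar β i * MvPowerSeries.C (β / 2))
    (logQuot k)) (PowerSeries.exp k) = Ec at *
  generalize parVar β i = u at *
  generalize (MvPowerSeries.C (β / 2) : MvPowerSeries (ℕ ⊕ ℕ) k) = b at *
  generalize (MvPowerSeries.X (Sum.inl i) : MvPowerSeries (ℕ ⊕ ℕ) k) = x at *
  generalize (MvPowerSeries.X (Sum.inr j) : MvPowerSeries (ℕ ⊕ ℕ) k) = y at *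
  have hi1 : (1 + 2 * b * x)⁻¹ * (1 + 2 * b * x) = 1 :=
    MvPowerSeries.inv_mul_cancel _ (by simp [hx0])
  have hi2 : (1 - x * y)⁻¹ * (1 - x * y) = 1 := MvPowerSeries.inv_mul_cancel _ (by simp [hx0])
  have h1 : T * ((1 + u * b) * (1 - u * (y + b))) = (1 + u * (y + b)) * (1 - u * b) := by
    linear_combination (1 - u * b) * hEa - T * (1 - u * (y + b)) * hEc
  have h2 : T * ((1 + 2 * b * x) * (1 - x * y)) = 1 + 2 * b * x + x * y := by
    have e1 : (1 + b * x) * (1 + u * b) = 1 + 2 * b * x := by linear_combination b * hu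
    have e2 : (1 + b * x) * (1 - u * (y + b)) = 1 - x * y := by linear_combination -(y + b) * hu
    have e3 : (1 + b * x) * (1 + u * (y + b)) = 1 + 2 * b * x + x * y := by
      linear_combination (y + b) * hu
    have e4 : (1 + b * x) * (1 - u * b) = 1 := by linear_combination -b * hu
    rw [← e2, ← e3]
    nth_rw 1 [← e1]
    linear_combination (1 + b * x) ^ 2 * h1 + (1 + b * x) * (1 + u * (y + b)) * e4
  linear_combination (1 + 2 * b * x)⁻¹ * (1 - x * y)⁻¹ * h2 +
    ((1 - x * y)⁻¹ - T * ((1 - x * y)⁻¹ * (1 - x * y))) * hi1 - T * hi2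

/-! ### The Cauchy product -/

/-- The series without terms of exponent at most `E`. -/
def highIdeal (k : Type*) [Field k] {σ : Type*} (E : σ →₀ ℕ) : Ideal (MvPowerSeries σ k) where
  carrier := {f | ∀ d ≤ E, MvPowerSeries.coeff d f = 0}
  zero_mem' := fun d _ => map_zero _
  add_mem' := fun {f g} hf hg d hd => by rw [map_add, hf d hd, hg d hd, add_zero]
  smul_mem' := fun c f hf d hd => by
    classical
    rw [smul_eq_mul, MvPowerSeries.coeff_mul]
    refine Finset.sum_eq_zero fun p hp => ?_
    rw [hf p.2 (le_trans ?_ hd), mul_zero]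
    rw [← Finset.HasAntidiagonal.mem_antidiagonal.1 hp]
    exact le_add_self

section HighIdeal

variable {σ : Type*} {E : σ →₀ ℕ}

/-- Modulo this ideal sums over infinitely many variables become finite, while the coefficient at
`E` is retained. -/
theorem mk_highIdeal_eq_iff {f g : MvPowerSeries σ k} :
    Ideal.Quotient.mk (highIdeal k E) f = Ideal.Quotient.mk (highIdeal k E) g ↔
      ∀ d ≤ E, MvPowerSeries.coeff d f = MvPowerSeries.coeff d g := by
  rw [Ideal.Quotient.mk_eq_mk_iff_sub_mem]
  refine forall₂_congr fun d _ => ?_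
  rw [map_sub, sub_eq_zero]

theorem mk_subst_congr {a b : MvPowerSeries σ k} (ha : MvPowerSeries.constantCoeff a = 0)
    (hb : MvPowerSeries.constantCoeff b = 0)
    (h : Ideal.Quotient.mk (highIdeal k E) a = Ideal.Quotient.mk (highIdeal k E) b)
    (φ : PowerSeries k) : Ideal.Quotient.mk (highIdeal k E) (PowerSeries.subst a φ) =
      Ideal.Quotient.mk (highIdeal k E) (PowerSeries.subst b φ) := by
  rw [mk_highIdeal_eq_iff]
  intro d hd
  rw [PowerSeries.coeff_subst (PowerSeries.HasSubst.of_constantCoeff_zero ha),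
    PowerSeries.coeff_subst (PowerSeries.HasSubst.of_constantCoeff_zero hb)]
  refine finsum_congr fun n => ?_
  have hn : Ideal.Quotient.mk (highIdeal k E) (a ^ n) =
      Ideal.Quotient.mk (highIdeal k E) (b ^ n) := by rw [map_pow, map_pow, h]
  rw [mk_highIdeal_eq_iff.1 hn d hd]

theorem mk_subst_X_eq_zero {s : σ} (hs : E s = 0) {φ : PowerSeries k}
    (h0 : PowerSeries.coeff 0 φ = 0) : Ideal.Quotient.mk (highIdeal k E)
      (PowerSeries.subst (MvPowerSeries.X (R := k) s) φ) = 0 := by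
  classical
  rw [← map_zero (Ideal.Quotient.mk (highIdeal k E)), mk_highIdeal_eq_iff]
  intro d hd
  rw [PowerSeries.coeff_subst_single, map_zero, Nat.eq_zero_of_le_zero ((hd s).trans_eq hs), h0,
    ite_self]

theorem mk_sumVars {e : ℕ → σ} {φ : PowerSeries k} (h0 : PowerSeries.coeff 0 φ = 0)
    {I : Finset ℕ} (hI : ∀ i, E (e i) ≠ 0 → i ∈ I) :
    Ideal.Quotient.mk (highIdeal k E) (sumVars e φ) =
      ∑ i ∈ I, Ideal.Quotient.mk (highIdeal k E)
        (PowerSeries.subst (MvPowerSeries.X (R := k) (e i)) φ) := by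
  rw [← map_sum, mk_highIdeal_eq_iff]
  intro d hd
  rw [map_sum]
  change ∑ᶠ i : ℕ, _ = _
  refine finsum_eq_sum_of_support_subset _ fun i hi => hI i fun h => hi ?_
  exact (mk_highIdeal_eq_iff.1 ((mk_subst_X_eq_zero h h0).trans (map_zero _).symm) d hd).trans
    (map_zero _)

theorem mk_subst_logQuot {a : MvPowerSeries σ k} (ha : MvPowerSeries.constantCoeff a = 0)
    {D : ℕ} (hD : E.degree < D) :
    Ideal.Quotient.mk (highIdeal k E) (PowerSeries.subst a (logQuot k)) =
      ∑ l ∈ Finset.range D, Ideal.Quotient.mk (highIdeal k E)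
        (MvPowerSeries.C (2 / (2 * l + 1) : k) * a ^ (2 * l + 1)) := by
  rw [← map_sum, mk_highIdeal_eq_iff]
  intro d hd
  rw [PowerSeries.coeff_subst (PowerSeries.HasSubst.of_constantCoeff_zero ha), map_sum,
    finsum_of_injective (g := fun l : ℕ => 2 * l + 1) (fun l l' h => by simpa using h)]
  · rw [finsum_eq_sum_of_support_subset _ (s := Finset.range D)]
    · refine Finset.sum_congr rfl fun l _ => ?_
      rw [MvPowerSeries.coeff_C_mul, logQuot, PowerSeries.coeff_mk, if_pos ⟨l, rfl⟩, smul_eq_mul]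
      push_cast
      rfl
    · intro l hl
      by_contra hn
      refine hl ?_
      beta_reduce
      rw [MvPowerSeries.coeff_of_lt_order, smul_zero]
      refine lt_of_lt_of_le ?_ (MvPowerSeries.le_order_pow_of_constantCoeff_eq_zero _ ha)
      rw [Finset.mem_coe, Finset.mem_range] at hn
      have : d.degree ≤ E.degree := Finsupp.degree_mono hd
      exact_mod_cast (by omega : d.degree < 2 * l + 1)
  · intro n hn
    rw [logQuot, PowerSeries.coeff_mk, if_neg, zero_smul]
    rintro ⟨l, rfl⟩
    exact hn ⟨l, rfl⟩

end HighIdeal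

/-- The difference of the two logarithms factors termwise, `(u(y+b))^n - (ub)^n = u^n ((y+b)^n -
b^n)` with `b = β/2`. Terms of order beyond the degree of `E` drop out. -/
theorem mk_cauchyLog (β : k) {E : ℕ ⊕ ℕ →₀ ℕ} {D : ℕ} (hD : E.degree < D) (i j : ℕ) :
    Ideal.Quotient.mk (highIdeal k E) (cauchyLog β (i, j)) =
      ∑ l ∈ Finset.range D, Ideal.Quotient.mk (highIdeal k E) (MvPowerSeries.C (2 / (2 * l + 1) : k)) *
        (Ideal.Quotient.mk (highIdeal k E)
          (PowerSeries.subst (MvPowerSeries.X (R := k) (Sum.inl i)) (xPar β ^ (2 * l + 1))) *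
        Ideal.Quotient.mk (highIdeal k E)
          (PowerSeries.subst (MvPowerSeries.X (R := k) (Sum.inr j)) (xBrk β (2 * l + 1)))) := by
  have hX : ∀ s : ℕ ⊕ ℕ, PowerSeries.HasSubst (MvPowerSeries.X (R := k) s) :=
    fun s => PowerSeries.HasSubst.X s
  rw [cauchyLog, map_sub, mk_subst_logQuot _ hD, mk_subst_logQuot _ hD, ← Finset.sum_sub_distrib]
  · refine Finset.sum_congr rfl fun l _ => ?_
    rw [PowerSeries.subst_pow (hX _), xBrk, PowerSeries.subst_sub (hX _),
      PowerSeries.subst_pow (hX _), PowerSeries.subst_add (hX _), PowerSeries.subst_X (hX _),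
      PowerSeries.subst_C, PowerSeries.subst_C, ← parVar, ← map_sub, ← map_mul, ← map_mul]
    congr 1
    rw [mul_pow, mul_pow, map_pow]
    ring
  · rw [map_mul, constantCoeff_parVar, zero_mul]
  · rw [map_mul, constantCoeff_parVar, zero_mul]

theorem mk_cauchyLog_eq_zero (β : k) {E : ℕ ⊕ ℕ →₀ ℕ} {i j : ℕ}
    (h : E (Sum.inl i) = 0 ∨ E (Sum.inr j) = 0) :
    Ideal.Quotient.mk (highIdeal k E) (cauchyLog β (i, j)) = 0 := by
  rw [mk_cauchyLog β (Nat.lt_succ_self _)]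
  refine Finset.sum_eq_zero fun l _ => ?_
  rcases h with h | h
  · rw [mk_subst_X_eq_zero h (coeff_zero_xPar_pow β (2 * l)), zero_mul, mul_zero]
  · rw [mk_subst_X_eq_zero h (coeff_zero_xBrk β _), mul_zero, mul_zero]

/-- The sums over `l` and over the pairs of variables are interchanged. Pairs with a variable absent
from `E` contribute zero, so any finite `s` containing the relevant pairs will do. -/
theorem mk_sum_cauchyLog (β : k) {E : ℕ ⊕ ℕ →₀ ℕ} {D : ℕ} (hD : E.degree < D)
    {s : Finset (ℕ × ℕ)} (hs : ∀ i j, E (Sum.inl i) ≠ 0 → E (Sum.inr j) ≠ 0 → (i, j) ∈ s) :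
    Ideal.Quotient.mk (highIdeal k E) (∑ l ∈ Finset.range D, (2 / (2 * l + 1) : k) •
      (sumVars Sum.inl (xPar β ^ (2 * l + 1)) * sumVars Sum.inr (xBrk β (2 * l + 1)))) =
      Ideal.Quotient.mk (highIdeal k E) (∑ p ∈ s, cauchyLog β p) := by
  have hI : ∀ i, E (Sum.inl i) ≠ 0 → i ∈ (fstExp E).support := fun i h =>
    Finsupp.mem_support_iff.2 h
  have hJ : ∀ j, E (Sum.inr j) ≠ 0 → j ∈ (sndExp E).support := fun j h =>
    Finsupp.mem_support_iff.2 h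
  rw [map_sum, map_sum]
  trans ∑ p ∈ (fstExp E).support ×ˢ (sndExp E).support,
    Ideal.Quotient.mk (highIdeal k E) (cauchyLog β p)
  · rw [Finset.sum_product]
    simp only [mk_cauchyLog β hD]
    simp only [Finset.sum_comm (s := (sndExp E).support) (t := Finset.range D)]
    rw [Finset.sum_comm]
    refine Finset.sum_congr rfl fun l _ => ?_
    rw [MvPowerSeries.smul_eq_C_mul, map_mul, map_mul, mk_sumVars (coeff_zero_xPar_pow β (2 * l)) hI,
      mk_sumVars (coeff_zero_xBrk β _) hJ, Finset.sum_mul_sum, Finset.mul_sum]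
    simp only [Finset.mul_sum]
  · refine Finset.sum_subset ?_ ?_
    · rintro ⟨i, j⟩ h
      rw [Finset.mem_product] at h
      exact hs i j (Finsupp.mem_support_iff (f := fstExp E).1 h.1)
        (Finsupp.mem_support_iff (f := sndExp E).1 h.2)
    · rintro ⟨i, j⟩ _ h
      refine mk_cauchyLog_eq_zero β ?_
      by_contra! hn
      exact h (Finset.mem_product.2 ⟨hI i hn.1, hJ j hn.2⟩)

/-- The truncation level `D` is taken beyond the degree of `E`. The exponent then agrees with the
finite sum of logarithms modulo the ideal, and substitution into the exponential respects this
congruence. -/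
theorem coeff_cauchyExpect_eq_coeff_prod [CharZero k] (β : k) {E : ℕ ⊕ ℕ →₀ ℕ}
    {s : Finset (ℕ × ℕ)} (hs : ∀ i j, E (Sum.inl i) ≠ 0 → E (Sum.inr j) ≠ 0 → (i, j) ∈ s) :
    MvPowerSeries.coeff E (cauchyExpect β) =
      MvPowerSeries.coeff E (∏ p ∈ s, cauchyFactor β p) := by
  obtain ⟨D, hD, h⟩ := exists_coeff_cauchyExpect_eq_exp β E (E.degree + 1)
  rw [h, ← Finset.prod_congr rfl fun p _ => exp_cauchyLog β p,
    ← subst_exp_sum s (constantCoeff_cauchyLog β)]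
  refine mk_highIdeal_eq_iff.1 (mk_subst_congr ?_ ?_ (mk_sum_cauchyLog β hD hs) _) E le_rfl
  · rw [map_sum]
    refine Finset.sum_eq_zero fun l _ => ?_
    rw [← MvPowerSeries.coeff_zero_eq_constantCoeff_apply, map_smul,
      MvPowerSeries.coeff_zero_eq_constantCoeff_apply, map_mul,
      ← MvPowerSeries.coeff_zero_eq_constantCoeff_apply,
      coeff_sumVars_zero _ (coeff_zero_xPar_pow β (2 * l)), zero_mul, smul_zero]
  · rw [map_sum]
    exact Finset.sum_eq_zero fun p _ => constantCoeff_cauchyLog β p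

open scoped MvPowerSeries.WithPiTopology in
theorem hasFormalProd_cauchyFactor [CharZero k] (β : k) :
    HasFormalProd (cauchyFactor β) (cauchyExpect β) := by
  let _ : TopologicalSpace k := ⊥
  unfold HasFormalProd
  rw [HasProd, MvPowerSeries.WithPiTopology.tendsto_iff_coeff_tendsto]
  intro E
  refine tendsto_atTop_of_eventually_const
    (i₀ := (fstExp E).support ×ˢ (sndExp E).support) fun s hs => ?_
  refine (coeff_cauchyExpect_eq_coeff_prod β fun i j hi hj => hs ?_).symm
  exact Finset.mem_product.2 ⟨Finsupp.mem_support_iff.2 hi, Finsupp.mem_support_iff.2 hj⟩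

end NeutralFermion

end

/-! ### The theorem. -/

theorem mainTheorem5 {k : Type*} [Field k] [CharZero k] (β : k) :
    -- the power sums generate subspaces of `GΓ` and `gΓ`
    (∀ lam : Multiset ℕ, NeutralFermion.IsOddPartition lam →
      NeutralFermion.pPar β lam ∈ NeutralFermion.GGamma β ∧
      NeutralFermion.pBrk β lam ∈ NeutralFermion.gGamma β) ∧
    -- the bilinear form is well defined
    (∃! B : NeutralFermion.GGamma β →ₗ[k] NeutralFermion.gGamma β →ₗ[k] k,
      NeutralFermion.IsBetaForm β B) ∧
    -- it computes vacuum expectation values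
    (∀ (v : NeutralFermion.FockHat k) (w : NeutralFermion.Fock k),
      ∃ (hf : NeutralFermion.expectPar β v ∈ NeutralFermion.GGamma β)
        (hg : NeutralFermion.expectBrk β w ∈ NeutralFermion.gGamma β),
        (NeutralFermion.IsEven v ∨ NeutralFermion.IsEven (w : NeutralFermion.FockHat k)) →
        ∀ B : NeutralFermion.GGamma β →ₗ[k] NeutralFermion.gGamma β →ₗ[k] k,
          NeutralFermion.IsBetaForm β B →
          B ⟨NeutralFermion.expectPar β v, hf⟩ ⟨NeutralFermion.expectBrk β w, hg⟩ =
            NeutralFermion.braket w v) ∧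
    -- the Cauchy kernel
    NeutralFermion.HasFormalProd (NeutralFermion.cauchyFactor β)
      (NeutralFermion.cauchyExpect β) :=
  ⟨fun _ h => ⟨NeutralFermion.pPar_mem β h, NeutralFermion.pBrk_mem β h⟩,
    NeutralFermion.existsUnique_isBetaForm β, NeutralFermion.form_expect_eq_braket β,
    NeutralFermion.hasFormalProd_cauchyFactor β⟩
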